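/- **Proposition.** Let $2\le k\le n$. Let $\mathcal C_{2n+1}$ be the real Clifford algebra of $\mathbb R^{2n+1}$ with relations $x\cdot x=-\|x\|^2$, let $\mathrm{Spin}(2n+1)\subset\mathcal C_{2n+1}$, and let $\mathcal A:\mathrm{Spin}(2n+1)\to \mathrm{SO}(2n+1)$, $\mathcal A(g)x=gxg^{*}$, be the double cover. For $1\le j\le n$ put $E_j=-\tfrac12 e_{2j-1}e_{2j}$; these elements span the Lie algebra $\mathfrak t$ of a maximal torus of $\mathrm{Spin}(2n+1)$. Let $\varepsilon_j$ be the linear functional on $\mathfrak t$ with $\varepsilon_j\big(\sum_l\theta_lE_l\big)=\mathbf i\,\theta_j$, let $\alpha_j=\varepsilon_j-\varepsilon_{j+1}$ $(1\le j<n)$ and $\alpha_n=\varepsilon_n$ be the simple roots and $\alpha_0=\varepsilon_1+\varepsilon_2$ the highest root. Let $v_k\in\mathfrak t$ be the vertex of the fundamental alcove given by $\alpha_0(v_k)=2\pi\mathbf i$ and $\alpha_j(v_k)=0$ for $1\le j\le n$, $j\ne k$, and let $\mathcal O_k$ be the conjugacy class of $\exp v_k$ in $\mathrm{Spin}(2n+1)$.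 Let $\mathrm{Spin}(2k)$ and $\mathrm{Spin}(2n+1-2k)$ be the subgroups of $\mathrm{Spin}(2n+1)$ belonging to the first $2k$ and the last $2n+1-2k$ coordinates. Then the stabilizer of $\exp v_k$ under conjugation by $\mathrm{Spin}(2n+1)$ is the identity component of $\mathcal A^{-1}\big(S(\mathrm O(2k)\times \mathrm O(2n+1-2k))\big)$, and it is equal to $\mathrm{Spin}(2k)\,\mathrm{Spin}(2n+1-2k)$. Moreover, there are diffeomorphisms $$\mathcal O_k\;\cong\;\mathrm{Spin}(2n+1)/\big(\mathrm{Spin}(2k)\,\mathrm{Spin}(2n+1-2k)\big)\;\cong\;\mathrm{SO}(2n+1)/\big(\mathrm{SO}(2k)\times \mathrm{SO}(2n+1-2k)\big)\;\cong\;\widetilde{\mathrm{Gr}}_{2k}(\mathbb R^{2n+1}),$$ where $\widetilde{\mathrm{Gr}}_{2k}(\mathbb R^{2n+1})$ is the Grassmannian of oriented $2k$-planes in $\mathbb R^{2n+1}$, and all four spaces carry their standard smooth structures. -/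

import Mathlib

open scoped Manifold ContDiff Topology Pointwise Matrix

noncomputable section

namespace SpinOrbit

/-! ## The Clifford algebra and the spin group -/

/-- The negative definite form `x ↦ -(x₁² + ⋯ + xₘ²)` on `ℝᵐ`. -/
abbrev negForm (m : ℕ) : QuadraticForm ℝ (Fin m → ℝ) :=
  QuadraticMap.weightedSumSquares ℝ (fun _ : Fin m => (-1 : ℝ))

/-- The Clifford algebra of `ℝᵐ`, with the relation `x * x = -‖x‖²`; its `star` is the conjugation
`(x₁ ⋯ xₖ)* = (-1)ᵏ xₖ ⋯ x₁`. -/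
abbrev Cl (m : ℕ) : Type := CliffordAlgebra (negForm m)

theorem negForm_apply (m : ℕ) (x : Fin m → ℝ) : negForm m x = -∑ i, x i ^ 2 := by
  simp [negForm, QuadraticMap.weightedSumSquares_apply, pow_two]

instance (m : ℕ) : Module.Finite ℝ (ExteriorAlgebra ℝ (Fin m → ℝ)) := by
  have hbot : ∀ i, m < i → (⋀[ℝ]^i (Fin m → ℝ)) = ⊥ := by
    intro i hi
    have h : Module.finrank ℝ (⋀[ℝ]^i (Fin m → ℝ)) = 0 := by
      rw [exteriorPower.finrank_eq]
      simp [Nat.choose_eq_zero_of_lt hi]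
    exact Submodule.finrank_eq_zero.mp h
  have htop : (⨆ i : Fin (m + 1), (⋀[ℝ]^(i : ℕ) (Fin m → ℝ))) = ⊤ := by
    rw [eq_top_iff, ← (DirectSum.Decomposition.isInternal
      (fun i : ℕ => ⋀[ℝ]^i (Fin m → ℝ))).submodule_iSup_eq_top]
    refine iSup_le fun i => ?_
    by_cases hi : m < i
    · rw [hbot i hi]
      exact bot_le
    · exact le_iSup (fun i : Fin (m + 1) => ⋀[ℝ]^(i : ℕ) (Fin m → ℝ)) ⟨i, by omega⟩
  rw [Module.finite_def, ← htop]
  exact Submodule.fg_iSup _ fun i => Module.Finite.iff_fg.mp inferInstance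

instance (m : ℕ) : Module.Finite ℝ (Cl m) :=
  Module.Finite.equiv (CliffordAlgebra.equivExterior (negForm m)).symm

/-- The vector space topology of the finite-dimensional real algebra `Cl m`. -/
instance (m : ℕ) : TopologicalSpace (Cl m) := moduleTopology ℝ (Cl m)

instance (m : ℕ) : IsModuleTopology ℝ (Cl m) := ⟨rfl⟩

instance (m : ℕ) : IsTopologicalRing (Cl m) := IsModuleTopology.isTopologicalRing ℝ (Cl m)

/-- `Spin(m)`, with the topology induced from the Clifford algebra. -/
abbrev Spin (m : ℕ) : Type := spinGroup (negForm m)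

/-- `SO(m)`, with the topology induced from the space of matrices. -/
abbrev SO (m : ℕ) : Type := Matrix.specialOrthogonalGroup (Fin m) ℝ

/-- The standard basis vector `eᵢ` of `ℝᵐ` in the Clifford algebra. -/
def e (m : ℕ) (i : Fin m) : Cl m := CliffordAlgebra.ι (negForm m) (Pi.single i 1)

/-! ## The maximal torus and the vertices of the fundamental alcove -/

/-- The element `E_{j+1}` of the Lie algebra of the maximal torus of `Spin(2n+1)`, as an element of
the Clifford algebra (the coordinates are numbered from `0`). Under the differential
`X ↦ (x ↦ X x - x X)` of the double cover `Spin(2n+1) → SO(2n+1)` it corresponds to the matrix with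
entry `1` at `(2j, 2j+1)`, entry `-1` at `(2j+1, 2j)` and zeros elsewhere. -/
def torusBasis (n : ℕ) (j : Fin n) : Cl (2 * n + 1) :=
  (-(1 / 2) : ℝ) • (e (2 * n + 1) ⟨2 * j, by omega⟩ * e (2 * n + 1) ⟨2 * j + 1, by omega⟩)

/-- The element `∑ θⱼ Eⱼ` of the Lie algebra of the maximal torus. -/
def torusElement (n : ℕ) (θ : Fin n → ℝ) : Cl (2 * n + 1) := ∑ j, θ j • torusBasis n j

/-- The simple roots of `Spin(2n+1)`, divided by the imaginary unit, as functions of the coordinates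
`θ` on the torus Lie algebra: `ε_j - ε_{j+1}` for `j < n`, and `ε_n` for `j = n`; the root `α_{j+1}`
has index `j`. -/
def simpleRoot (n : ℕ) (j : Fin n) (θ : Fin n → ℝ) : ℝ :=
  if h : (j : ℕ) + 1 < n then θ j - θ ⟨j + 1, h⟩ else θ j

/-- The highest root `ε_1 + ε_2` of `Spin(2n+1)`, `n ≥ 2`, divided by the imaginary unit. -/
def highestRoot (n : ℕ) (hn : 2 ≤ n) (θ : Fin n → ℝ) : ℝ :=
  θ ⟨0, by omega⟩ + θ ⟨1, by omega⟩

/-- The equations that define, for `1 ≤ k ≤ n`, the vertex `v_k` of the fundamental alcove: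
`α₀(v_k) = 2πi` and `α_j(v_k) = 0` for `1 ≤ j ≤ n`, `j ≠ k`. -/
def IsAlcoveVertex (n : ℕ) (hn : 2 ≤ n) (k : ℕ) (θ : Fin n → ℝ) : Prop :=
  highestRoot n hn θ = 2 * Real.pi ∧ ∀ j : Fin n, (j : ℕ) + 1 ≠ k → simpleRoot n j θ = 0

/-- For `2 ≤ k ≤ n` the equations have the unique solution `v_k = π (E_1 + ⋯ + E_k)`. -/
theorem isAlcoveVertex_iff (n : ℕ) (hn : 2 ≤ n) (k : ℕ) (hk : 2 ≤ k) (hkn : k ≤ n)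
    (θ : Fin n → ℝ) :
    IsAlcoveVertex n hn k θ ↔ θ = fun j : Fin n => if (j : ℕ) < k then Real.pi else 0 := by
  constructor
  · rintro ⟨h0, h1⟩
    have step : ∀ (i : ℕ) (hi : i + 1 < n), i + 1 ≠ k → θ ⟨i, by omega⟩ = θ ⟨i + 1, hi⟩ := by
      intro i hi hik
      have := h1 ⟨i, by omega⟩ hik
      simp only [simpleRoot, hi, dif_pos] at this
      linarith
    have h01 := step 0 (by omega) (by omega)
    have hpi : θ ⟨0, by omega⟩ = Real.pi := by
      simp only [highestRoot] at h0
      simp only [zero_add] at h01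
      linarith
    have low : ∀ (i : ℕ) (hi : i < k), θ ⟨i, by omega⟩ = Real.pi := by
      intro i
      induction i with
      | zero => intro _; exact hpi
      | succ i ih =>
        intro hi
        rw [← step i (by omega) (by omega)]
        exact ih (by omega)
    have high : ∀ (d i : ℕ) (hi : i < n), i + d + 1 = n → k ≤ i → θ ⟨i, hi⟩ = 0 := by
      intro d
      induction d with
      | zero =>
        intro i hi hid hki
        have := h1 ⟨i, hi⟩ (by simp only; omega)
        simpa only [simpleRoot, show ¬ (i + 1 < n) by omega, dif_neg, not_false_eq_true] using this
      | succ d ih =>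
        intro i hi hid hki
        rw [step i (by omega) (by omega)]
        exact ih (i + 1) (by omega) (by omega) (by omega)
    funext j
    by_cases hj : (j : ℕ) < k
    · simp only [hj, if_true]
      exact low j hj
    · simp only [hj, if_false]
      exact high (n - 1 - j) j j.2 (by omega) (by omega)
  · rintro rfl
    refine ⟨?_, ?_⟩
    · simp only [highestRoot, show 0 < k by omega, show 1 < k by omega, if_true]
      ring
    · intro j hj
      have := j.2
      unfold simpleRoot
      by_cases h1 : (j : ℕ) + 1 < n
      · rw [dif_pos h1]
        by_cases h2 : (j : ℕ) < k
        · simp only [h2, show (j : ℕ) + 1 < k by omega, if_true, sub_self]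
        · simp only [h2, show ¬ ((j : ℕ) + 1 < k) by omega, if_false, sub_self]
      · rw [dif_neg h1]
        simp only [show ¬ ((j : ℕ) < k) by omega, if_false]

/-! ## Subgroups -/

/-- The splitting `{0, …, 2n} = {0, …, 2k-1} ⊔ {2k, …, 2n}` of the set of coordinates. -/
def splitEquiv (n k : ℕ) (h : k ≤ n) :
    Fin (2 * k) ⊕ Fin (2 * n + 1 - 2 * k) ≃ Fin (2 * n + 1) :=
  finSumFinEquiv.trans (finCongr (by omega))

/-- The block-diagonal matrix with blocks `A` and `B`. -/
def blockDiag {a b m : ℕ} (σ : Fin a ⊕ Fin b ≃ Fin m)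
    (A : Matrix (Fin a) (Fin a) ℝ) (B : Matrix (Fin b) (Fin b) ℝ) : Matrix (Fin m) (Fin m) ℝ :=
  (Matrix.fromBlocks A 0 0 B).submatrix σ.symm σ.symm

/-- `S(O(a) × O(b))`, as a subset of `SO(m)`. -/
def SOO {a b m : ℕ} (σ : Fin a ⊕ Fin b ≃ Fin m) : Set (SO m) :=
  {R | ∃ A ∈ Matrix.orthogonalGroup (Fin a) ℝ, ∃ B ∈ Matrix.orthogonalGroup (Fin b) ℝ,
    (R : Matrix (Fin m) (Fin m) ℝ) = blockDiag σ A B}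

theorem blockDiag_one {a b m : ℕ} (σ : Fin a ⊕ Fin b ≃ Fin m) : blockDiag σ 1 1 = 1 := by
  simp [blockDiag]

theorem blockDiag_mul {a b m : ℕ} (σ : Fin a ⊕ Fin b ≃ Fin m)
    (A A' : Matrix (Fin a) (Fin a) ℝ) (B B' : Matrix (Fin b) (Fin b) ℝ) :
    blockDiag σ (A * A') (B * B') = blockDiag σ A B * blockDiag σ A' B' := by
  simp [blockDiag, Matrix.submatrix_mul_equiv, Matrix.fromBlocks_multiply]

theorem blockDiag_star {a b m : ℕ} (σ : Fin a ⊕ Fin b ≃ Fin m)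
    (A : Matrix (Fin a) (Fin a) ℝ) (B : Matrix (Fin b) (Fin b) ℝ) :
    blockDiag σ (star A) (star B) = star (blockDiag σ A B) := by
  simp [blockDiag, Matrix.star_eq_conjTranspose, Matrix.fromBlocks_transpose]

/-- `SO(a) × SO(b)`, as a subgroup of `SO(m)`. -/
def SOSO {a b m : ℕ} (σ : Fin a ⊕ Fin b ≃ Fin m) : Subgroup (SO m) where
  carrier := {R | ∃ (A : SO a) (B : SO b), (R : Matrix (Fin m) (Fin m) ℝ) = blockDiag σ A B}
  one_mem' := ⟨1, 1, (blockDiag_one σ).symm⟩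
  mul_mem' := by
    rintro R R' ⟨A, B, h⟩ ⟨A', B', h'⟩
    refine ⟨A * A', B * B', ?_⟩
    change (R : Matrix (Fin m) (Fin m) ℝ) * R' = _
    rw [h, h', ← blockDiag_mul]
    rfl
  inv_mem' := by
    rintro R ⟨A, B, h⟩
    refine ⟨A⁻¹, B⁻¹, ?_⟩
    change star (R : Matrix (Fin m) (Fin m) ℝ) = _
    rw [h, ← blockDiag_star]
    rfl

/-- The double cover `𝒜 : Spin(m) → SO(m)`, `(𝒜 g) x = g x g*`, given by its graph:
`Covers g R` says that `𝒜 g = R`. -/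
def Covers {m : ℕ} (g : Spin m) (R : SO m) : Prop :=
  ∀ x : Fin m → ℝ, (g : Cl m) * CliffordAlgebra.ι (negForm m) x * star (g : Cl m) =
    CliffordAlgebra.ι (negForm m) ((R : Matrix (Fin m) (Fin m) ℝ) *ᵥ x)

/-- The preimage `𝒜⁻¹(K)` of a subset of `SO(m)` in `Spin(m)`. -/
def coverPreimage {m : ℕ} (K : Set (SO m)) : Set (Spin m) := {g | ∃ R ∈ K, Covers g R}

/-- The isometric embedding `ℝᵃ → ℝᵐ`, `eᵢ ↦ e_{σ i}`. -/
def coordEmbedding {a m : ℕ} (σ : Fin a ↪ Fin m) : negForm a →qᵢ negForm m where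
  toLinearMap := Function.ExtendByZero.linearMap ℝ σ
  map_app' x := by
    change negForm m (Function.extend σ x 0) = negForm a x
    rw [negForm_apply, negForm_apply, neg_inj]
    have h : ∀ i ∉ Finset.univ.map σ, (Function.extend σ x 0 i) ^ 2 = 0 := by
      intro i hi
      rw [Function.extend_apply']
      · simp
      · rintro ⟨j, rfl⟩
        exact hi (Finset.mem_map_of_mem σ (Finset.mem_univ j))
    rw [← Finset.sum_subset (Finset.subset_univ (Finset.univ.map σ)) fun i _ => h i,
      Finset.sum_map]
    simp [σ.injective.extend_apply]

theorem map_star {a m : ℕ} (f : negForm a →qᵢ negForm m) (x : Cl a) :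
    CliffordAlgebra.map f (star x) = star (CliffordAlgebra.map f x) := by
  induction x using CliffordAlgebra.induction with
  | algebraMap r => simp [CliffordAlgebra.star_algebraMap]
  | ι v => simp [CliffordAlgebra.star_ι]
  | mul x y hx hy => simp [hx, hy]
  | add x y hx hy => simp [hx, hy]

/-- The group `Spin(a)` of the coordinate subspace `ℝᵃ ⊆ ℝᵐ` with coordinates `σ`, as a subgroup of
`Spin(m)`: the image of `Spin(a)` under `Cl(ℝᵃ) → Cl(ℝᵐ)`. -/
def spinSubgroup {a m : ℕ} (σ : Fin a ↪ Fin m) : Subgroup (Spin m) where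
  carrier := {g | ∃ h : Spin a, (g : Cl m) = CliffordAlgebra.map (coordEmbedding σ) h}
  one_mem' := ⟨1, by simp⟩
  mul_mem' := by
    rintro g g' ⟨h, hg⟩ ⟨h', hg'⟩
    exact ⟨h * h', by simp [hg, hg']⟩
  inv_mem' := by
    rintro g ⟨h, hg⟩
    refine ⟨h⁻¹, ?_⟩
    change star (g : Cl m) = CliffordAlgebra.map (coordEmbedding σ) (star (h : Cl a))
    rw [map_star, hg]

/-- The subgroup `Spin(2k) ⊆ Spin(2n+1)` of the first `2k` coordinates. -/
def spinFirst (n k : ℕ) (h : k ≤ n) : Subgroup (Spin (2 * n + 1)) :=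
  spinSubgroup (Function.Embedding.inl.trans (splitEquiv n k h).toEmbedding)

/-- The subgroup `Spin(2n+1-2k) ⊆ Spin(2n+1)` of the last `2n+1-2k` coordinates. -/
def spinLast (n k : ℕ) (h : k ≤ n) : Subgroup (Spin (2 * n + 1)) :=
  spinSubgroup (Function.Embedding.inr.trans (splitEquiv n k h).toEmbedding)

/-! ## Smooth structures

The smooth structure of a subset of a vector space, and of a quotient of such a subset, is described
by its smooth functions: a predicate `S U f` that says which functions `f` are smooth on the open
set `U`. -/

/-- The smooth real functions on a finite-dimensional real vector space. -/
def IsSmoothFunction {V : Type} [AddCommGroup V] [Module ℝ V] (F : V → ℝ) : Prop :=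
  ∃ (N : ℕ) (L : V →ₗ[ℝ] (Fin N → ℝ)) (G : (Fin N → ℝ) → ℝ), ContDiff ℝ ∞ G ∧ F = G ∘ L

/-- The functions that are smooth on the open set `U` of a space `X` embedded by `i` in a
finite-dimensional real vector space `V`: those which are locally restrictions of smooth functions
on `V`. -/
def smoothOfEmbedding {X V : Type} [TopologicalSpace X] [AddCommGroup V] [Module ℝ V]
    (i : X → V) (U : Set X) (f : X → ℝ) : Prop :=
  ∀ x ∈ U, ∃ F : V → ℝ, IsSmoothFunction F ∧ ∀ᶠ y in 𝓝 x, f y = F (i y)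

/-- The functions that are smooth on the open set `U` of a quotient `q : Y → X`: those which are
smooth after composition with `q`. -/
def smoothOfQuotient {X Y : Type} (q : Y → X) (S : Set Y → (Y → ℝ) → Prop)
    (U : Set X) (f : X → ℝ) : Prop :=
  S (q ⁻¹' U) (f ∘ q)

/-- The charted space structure on `X` makes it a smooth manifold of dimension `d` whose smooth
functions are those given by `S`. This determines the maximal atlas. -/
def IsSmoothManifoldWith {X : Type} [TopologicalSpace X] (d : ℕ)
    (c : ChartedSpace (EuclideanSpace ℝ (Fin d)) X) (S : Set X → (X → ℝ) → Prop) : Prop :=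
  IsManifold (𝓡 d) ∞ X ∧
    ∀ (U : Set X), IsOpen U → ∀ f : X → ℝ, ContMDiffOn (𝓡 d) 𝓘(ℝ, ℝ) ∞ f U ↔ S U f

/-- The smooth functions on `Spin(m)`, a submanifold of the Clifford algebra. -/
def smoothSpin (m : ℕ) : Set (Spin m) → (Spin m → ℝ) → Prop :=
  smoothOfEmbedding (fun g : Spin m => (g : Cl m))

/-- The smooth functions on `SO(m)`, a submanifold of the space of matrices. -/
def smoothSO (m : ℕ) : Set (SO m) → (SO m → ℝ) → Prop :=
  smoothOfEmbedding (fun R : SO m => (R : Matrix (Fin m) (Fin m) ℝ))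

/-- The smooth functions on a conjugacy class in `Spin(m)`, as a submanifold. -/
def smoothConjugacyClass {m : ℕ} (x : Spin m) :
    Set (conjugatesOf x) → (conjugatesOf x → ℝ) → Prop :=
  smoothOfEmbedding (fun y : conjugatesOf x => ((y : Spin m) : Cl m))

/-- The smooth functions on a homogeneous space `Spin(m)/H`. -/
def smoothSpinQuotient {m : ℕ} (H : Subgroup (Spin m)) :
    Set (Spin m ⧸ H) → (Spin m ⧸ H → ℝ) → Prop :=
  smoothOfQuotient (QuotientGroup.mk : Spin m → Spin m ⧸ H) (smoothSpin m)

/-- The smooth functions on a homogeneous space `SO(m)/H`. -/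
def smoothSOQuotient {m : ℕ} (H : Subgroup (SO m)) :
    Set (SO m ⧸ H) → (SO m ⧸ H → ℝ) → Prop :=
  smoothOfQuotient (QuotientGroup.mk : SO m → SO m ⧸ H) (smoothSO m)

/-! ## The Grassmannian of oriented planes -/

/-- The Grassmannian of oriented `r`-planes in `ℝᵐ`: the linear subspaces of dimension `r` with an
orientation. -/
structure OrientedGrassmannian (r m : ℕ) : Type where
  plane : Submodule ℝ (Fin m → ℝ)
  finrank_plane : Module.finrank ℝ plane = r
  orientation : Orientation ℝ plane (Fin r)

/-- The `r`-frames in `ℝᵐ`, an open subset of the space of `r`-tuples of vectors. -/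
abbrev Frame (r m : ℕ) : Type := {b : Fin r → Fin m → ℝ // LinearIndependent ℝ b}

/-- The span of a frame, with the orientation for which the frame is positive. -/
def Frame.toPlane {r m : ℕ} (b : Frame r m) : OrientedGrassmannian r m where
  plane := Submodule.span ℝ (Set.range b.1)
  finrank_plane := by simpa using finrank_span_eq_card b.2
  orientation := (Module.Basis.span b.2).orientation

/-- The topology of the oriented Grassmannian, as a quotient of the space of frames. -/
instance (r m : ℕ) : TopologicalSpace (OrientedGrassmannian r m) :=
  TopologicalSpace.coinduced Frame.toPlane inferInstance

/-- The smooth functions on the oriented Grassmannian, as a quotient of the space of frames. -/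
def smoothGrassmannian (r m : ℕ) :
    Set (OrientedGrassmannian r m) → (OrientedGrassmannian r m → ℝ) → Prop :=
  smoothOfQuotient Frame.toPlane (smoothOfEmbedding (fun b : Frame r m => b.1))

end SpinOrbit

end

namespace SpinOrbit

open CliffordAlgebra

noncomputable section

/-! ## Smooth functions on embedded spaces -/

/-! The vertex is `v_k = π (E_1 + ⋯ + E_k)`. The elements `J_j = -e_{2j-1} e_{2j}` commute and
square to `-1`, so `exp (π E_j) = exp ((π/2) J_j) = J_j` and `x = exp v_k = (-1)^k e_1 ⋯ e_{2k}`
(`exp_torusElement_vertex`). Up to this sign, `x` is the unit multivector of the oriented plane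
spanned by `e_1, …, e_{2k}`. If `g` covers the rotation `R`, then `g x g*` is the product of the
vectors `R e_i` with the same sign, so the conjugacy class is the set of signed unit multivectors of
all oriented `2k`-planes.

Stabilizer. As `2k` is even, `x` anticommutes with the vectors of the first block and commutes with
those of the second. A rotation covered by an element of the stabilizer therefore preserves both
blocks. For a block diagonal rotation with blocks `A` and `B`, conjugation multiplies `x` by `det
A`, hence `det A = 1` and then `det B = 1`. Lifting `A` and `B` separately, with kernel `±1` of the
cover, gives the product of the two spin groups (`mem_coordUnitPairs_mul`). On the preimage of `S(O
× O)` conjugation takes `x` to `±x`, so the component of `1` stays in the stabilizer. Conversely the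
stabilizer is connected, as it is generated by products `u v` of unit vectors in one block, and `v`
can be moved to `-u` along the sphere, where the product is `1` (a block of dimension at most one is
treated separately).

Diffeomorphisms. A smooth structure is recorded by its smooth functions, and a homeomorphism
matching these is a diffeomorphism. The conjugacy class gets explicit charts: near `x` its points
are multivectors of graphs, and ratios of Plücker coordinates recover the matrix of the linear map
(`orbitChart`); conjugation moves this chart to all points. Each of the other three spaces is a
quotient of `Spin`, `SO` or the space of frames, with the same fibres as a smooth map to the
conjugacy class. Such a quotient is equivalent to the class as soon as the map has smooth local
sections (`smoothlyEquivalent_of_quotient`). One section into `Spin`, composed with `Spin → SO →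
frames`, serves all three. It comes from Gram–Schmidt orthogonalization carried out by explicit
rotors, which depend analytically on the graph (`exists_triangular`). -/

theorem IsSmoothFunction.of_comp_linear {V W : Type} [AddCommGroup V] [Module ℝ V]
    [NormedAddCommGroup W] [NormedSpace ℝ W] [FiniteDimensional ℝ W]
    (L : V →ₗ[ℝ] W) {G : W → ℝ} (hG : ContDiff ℝ ∞ G) : IsSmoothFunction (G ∘ L) := by
  let T := (Module.finBasis ℝ W).equivFunL
  refine ⟨Module.finrank ℝ W, T.toLinearMap ∘ₗ L, G ∘ T.symm, hG.comp T.symm.contDiff, ?_⟩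
  funext v
  simp

/-- Finitely many smooth functions factor through one common linear map, the product of the linear
maps belonging to each of them. -/
theorem IsSmoothFunction.comp {V ι : Type} [AddCommGroup V] [Module ℝ V] [Fintype ι]
    {F : ι → V → ℝ} (hF : ∀ a, IsSmoothFunction (F a)) {G : (ι → ℝ) → ℝ} (hG : ContDiff ℝ ∞ G) :
    IsSmoothFunction (fun v => G (fun a => F a v)) := by
  choose N L H hH hFH using hF
  have := IsSmoothFunction.of_comp_linear (LinearMap.pi L)
    (G := fun w : (a : ι) → Fin (N a) → ℝ => G (fun a => H a (w a)))
    (hG.comp (contDiff_pi.2 fun a => (hH a).comp (ContinuousLinearMap.proj (R := ℝ) (φ := fun a => Fin (N a) → ℝ) a).contDiff))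
  convert this using 1
  funext v
  simp [hFH]

/-- A smooth function on an open set agrees near each point with a globally smooth function. -/
theorem exists_contDiff_eventuallyEq {E : Type*} [NormedAddCommGroup E] [NormedSpace ℝ E]
    [FiniteDimensional ℝ E] {G : E → ℝ} {Ω : Set E} (hΩ : IsOpen Ω) (hG : ContDiffOn ℝ ∞ G Ω)
    {p : E} (hp : p ∈ Ω) : ∃ H : E → ℝ, ContDiff ℝ ∞ H ∧ H =ᶠ[𝓝 p] G := by
  obtain ⟨r, hr, hrΩ⟩ := Metric.isOpen_iff.1 hΩ p hp
  -- The closed ball of radius `r / 2` lies in `Ω`. The product of `G` with this bump is smooth on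
  -- `Ω` and vanishes near every point outside `Ω`.
  let f : ContDiffBump p := ⟨r / 4, r / 2, by positivity, by linarith⟩
  refine ⟨fun x => f x * G x, contDiff_iff_contDiffAt.2 fun y => ?_, ?_⟩
  · by_cases hy : y ∈ Ω
    · exact f.contDiff.contDiffAt.mul (hG.contDiffAt (hΩ.mem_nhds hy))
    · have h0 : (fun x => f x * G x) =ᶠ[𝓝 y] fun _ => 0 := by
        have hcl : y ∈ (Metric.closedBall p (r / 2))ᶜ := fun h =>
          hy (hrΩ (Metric.closedBall_subset_ball (by linarith) h))
        filter_upwards [Metric.isClosed_closedBall.isOpen_compl.mem_nhds hcl] with x hx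
        have : f x = 0 := f.zero_of_le_dist (by
          have := Metric.mem_closedBall.not.1 hx
          exact (not_le.1 this).le)
        simp [this]
      exact contDiffAt_const.congr_of_eventuallyEq h0
  · filter_upwards [f.eventuallyEq_one] with x hx
    simp [hx]

section Embedding

variable {X V : Type} [TopologicalSpace X] [AddCommGroup V] [Module ℝ V] {i : X → V}

/-- All the linear functionals of the ambient space are continuous on the embedded space. -/
def WeaklyContinuous (i : X → V) : Prop := ∀ l : V →ₗ[ℝ] ℝ, Continuous (l ∘ i)

theorem smoothOfEmbedding_linear (l : V →ₗ[ℝ] ℝ) (U : Set X) :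
    smoothOfEmbedding i U (fun y => l (i y)) := fun _ _ =>
  ⟨l, IsSmoothFunction.of_comp_linear l contDiff_id, Filter.Eventually.of_forall fun _ => rfl⟩

theorem smoothOfEmbedding.mono {U U' : Set X} {f : X → ℝ} (h : smoothOfEmbedding i U f)
    (hU : U' ⊆ U) : smoothOfEmbedding i U' f := fun x hx => h x (hU hx)

theorem smoothOfEmbedding.congr {U : Set X} (hU : IsOpen U) {f f' : X → ℝ}
    (h : smoothOfEmbedding i U f) (hf : ∀ x ∈ U, f' x = f x) : smoothOfEmbedding i U f' := by
  intro x hx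
  obtain ⟨F, hF, hFf⟩ := h x hx
  refine ⟨F, hF, ?_⟩
  filter_upwards [hFf, hU.mem_nhds hx] with y hy hyU
  rw [hf y hyU, hy]

theorem IsSmoothFunction.continuous_comp (hi : WeaklyContinuous i) {F : V → ℝ}
    (hF : IsSmoothFunction F) : Continuous (F ∘ i) := by
  obtain ⟨N, L, G, hG, rfl⟩ := hF
  refine hG.continuous.comp (continuous_pi fun a => ?_)
  exact hi (LinearMap.proj a ∘ₗ L)

theorem smoothOfEmbedding.continuousAt (hi : WeaklyContinuous i) {U : Set X} {f : X → ℝ}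
    (h : smoothOfEmbedding i U f) {x : X} (hx : x ∈ U) : ContinuousAt f x := by
  obtain ⟨F, hF, hFf⟩ := h x hx
  exact (hF.continuous_comp hi).continuousAt.congr (hFf.mono fun y hy => hy.symm)

/-- Smoothness on an embedded space asks for extensions defined on all of `V`, so `G` is first
replaced near the point by a globally smooth function. Weak continuity keeps nearby points where the
two agree. -/
theorem smoothOfEmbedding.comp (hi : WeaklyContinuous i) {ι : Type} [Fintype ι]
    {U : Set X} {f : ι → X → ℝ} (hf : ∀ a, smoothOfEmbedding i U (f a))
    {Ω : Set (ι → ℝ)} (hΩ : IsOpen Ω) {G : (ι → ℝ) → ℝ} (hG : ContDiffOn ℝ ∞ G Ω)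
    (hU : ∀ x ∈ U, (fun a => f a x) ∈ Ω) : smoothOfEmbedding i U (fun x => G (fun a => f a x)) := by
  intro x hx
  obtain ⟨H, hH, hHG⟩ := exists_contDiff_eventuallyEq hΩ hG (hU x hx)
  choose F hF hFf using fun a => hf a x hx
  refine ⟨_, IsSmoothFunction.comp hF hH, ?_⟩
  have hc : ContinuousAt (fun y a => f a y) x :=
    continuousAt_pi.2 fun a => (hf a).continuousAt hi hx
  filter_upwards [hc.eventually hHG, Filter.eventually_all.2 hFf] with y hy hyF
  rw [← hy]
  simp only [hyF]

theorem smoothOfEmbedding.contDiff_comp (hi : WeaklyContinuous i) {ι : Type} [Fintype ι]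
    {U : Set X} {f : ι → X → ℝ} (hf : ∀ a, smoothOfEmbedding i U (f a))
    {G : (ι → ℝ) → ℝ} (hG : ContDiff ℝ ∞ G) :
    smoothOfEmbedding i U (fun x => G (fun a => f a x)) :=
  smoothOfEmbedding.comp hi hf isOpen_univ hG.contDiffOn fun _ _ => trivial

theorem smoothOfEmbedding.mul (hi : WeaklyContinuous i) {U : Set X} {f g : X → ℝ}
    (hf : smoothOfEmbedding i U f) (hg : smoothOfEmbedding i U g) :
    smoothOfEmbedding i U (fun x => f x * g x) := by
  have := smoothOfEmbedding.contDiff_comp hi (ι := Fin 2) (f := ![f, g]) (U := U)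
    (by intro a; fin_cases a <;> simpa) (G := fun v => v 0 * v 1)
    ((contDiff_apply ℝ ℝ 0).mul (contDiff_apply ℝ ℝ 1))
  simpa using this

theorem smoothOfEmbedding.sum (hi : WeaklyContinuous i) {ι : Type} [Fintype ι] {U : Set X}
    {f : ι → X → ℝ} (hf : ∀ a, smoothOfEmbedding i U (f a)) :
    smoothOfEmbedding i U (fun x => ∑ a, f a x) :=
  smoothOfEmbedding.contDiff_comp hi hf (G := fun v => ∑ a, v a)
    (ContDiff.sum fun a _ => contDiff_apply ℝ ℝ a)

theorem smoothOfEmbedding_const (c : ℝ) (U : Set X) :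
    smoothOfEmbedding i U (fun _ => c) := fun _ _ =>
  ⟨fun _ => c, IsSmoothFunction.of_comp_linear (0 : V →ₗ[ℝ] ℝ) (contDiff_const (c := c)),
    Filter.Eventually.of_forall fun _ => rfl⟩

theorem smoothOfEmbedding.div (hi : WeaklyContinuous i) {U : Set X} {f g : X → ℝ}
    (hf : smoothOfEmbedding i U f) (hg : smoothOfEmbedding i U g) (hg0 : ∀ x ∈ U, g x ≠ 0) :
    smoothOfEmbedding i U (fun x => f x / g x) := by
  have := smoothOfEmbedding.comp hi (ι := Fin 2) (f := ![f, g]) (U := U)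
    (by intro a; fin_cases a <;> simpa) (Ω := {v | v 1 ≠ 0})
    (isOpen_ne_fun (continuous_apply 1) continuous_const) (G := fun v => v 0 / v 1)
    ((contDiff_apply ℝ ℝ 0).contDiffOn.div (contDiff_apply ℝ ℝ 1).contDiffOn fun x hx => hx)
    (by simpa using hg0)
  simpa using this

/-- Smoothness of functions is a local property. -/
def IsLocalSmoothness (S : Set X → (X → ℝ) → Prop) : Prop :=
  (∀ U U' f, S U f → U' ⊆ U → IsOpen U → IsOpen U' → S U' f) ∧
  (∀ U f f', IsOpen U → S U f → (∀ x ∈ U, f' x = f x) → S U f') ∧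
  (∀ U f, IsOpen U → (∀ x ∈ U, ∃ U', IsOpen U' ∧ x ∈ U' ∧ U' ⊆ U ∧ S U' f) → S U f)

theorem isLocalSmoothness_smoothOfEmbedding (i : X → V) :
    IsLocalSmoothness (smoothOfEmbedding i) := by
  refine ⟨fun U U' f h hU _ _ => h.mono hU, fun U f f' hU h hf => h.congr hU hf, ?_⟩
  intro U f _ h x hx
  obtain ⟨U', _, hx', _, hS⟩ := h x hx
  exact hS x hx'

theorem IsLocalSmoothness.quotient {Y : Type} [TopologicalSpace Y]
    {S : Set Y → (Y → ℝ) → Prop} (hS : IsLocalSmoothness S) {q : Y → X} (hq : Continuous q) :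
    IsLocalSmoothness (smoothOfQuotient q S) := by
  refine ⟨fun U U' f h hU h1 h2 =>
      hS.1 _ _ _ h (Set.preimage_mono hU) (h1.preimage hq) (h2.preimage hq),
    fun U f f' hU h hf => hS.2.1 _ _ _ (hU.preimage hq) h fun x hx => hf _ hx, ?_⟩
  intro U f hU h
  refine hS.2.2 _ _ (hU.preimage hq) fun y hy => ?_
  obtain ⟨U', h1, h2, h3, h4⟩ := h (q y) hy
  exact ⟨q ⁻¹' U', h1.preimage hq, h2, Set.preimage_mono h3, h4⟩

end Embedding

/-! ## Smooth maps -/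

section Maps

variable {X Y Z : Type} [TopologicalSpace X] [TopologicalSpace Y] [TopologicalSpace Z]

/-- The map `t` is continuous on `N` and pulls smooth functions back to smooth functions. -/
def PullsBack (SX : Set X → (X → ℝ) → Prop) (SY : Set Y → (Y → ℝ) → Prop) (N : Set X)
    (t : X → Y) : Prop :=
  ContinuousOn t N ∧ ∀ U f, IsOpen U → SY U f → SX (N ∩ t ⁻¹' U) (f ∘ t)

theorem PullsBack.comp {SX : Set X → (X → ℝ) → Prop} {SY : Set Y → (Y → ℝ) → Prop}
    {SZ : Set Z → (Z → ℝ) → Prop} {N : Set X} {s : X → Y} {t : Y → Z}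
    (ht : PullsBack SY SZ Set.univ t) (hs : PullsBack SX SY N s) : PullsBack SX SZ N (t ∘ s) := by
  have htc := continuousOn_univ.1 ht.1
  refine ⟨htc.comp_continuousOn hs.1, fun U f hU hf => ?_⟩
  have := hs.2 _ _ (by simpa using hU.preimage htc) (ht.2 U f hU hf)
  simpa [Set.preimage_comp, Function.comp_assoc] using this

theorem PullsBack.comp' {SX : Set X → (X → ℝ) → Prop} {SY : Set Y → (Y → ℝ) → Prop}
    {SZ : Set Z → (Z → ℝ) → Prop} {N : Set Y} {s : X → Y} {t : Y → Z}
    (ht : PullsBack SY SZ N t) (hN : IsOpen N) (hs : PullsBack SX SY Set.univ s) :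
    PullsBack SX SZ (s ⁻¹' N) (t ∘ s) := by
  have hsc := continuousOn_univ.1 hs.1
  refine ⟨ht.1.comp hsc.continuousOn (Set.mapsTo_preimage s N), fun U f hU hf => ?_⟩
  have := hs.2 _ _ (ht.1.isOpen_inter_preimage hN hU) (ht.2 U f hU hf)
  simpa [Set.preimage_comp, Function.comp_assoc] using this

/-- A smooth function on `V'` is a smooth function of finitely many linear functionals, so these are
the only functions that need testing. -/
theorem pullsBack_of_linear {V V' : Type} [AddCommGroup V] [Module ℝ V] [AddCommGroup V']
    [Module ℝ V'] {i : X → V} {j : Y → V'} (hi : WeaklyContinuous i) {N : Set X} (hN : IsOpen N)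
    {t : X → Y} (ht : ContinuousOn t N)
    (h : ∀ l : V' →ₗ[ℝ] ℝ, smoothOfEmbedding i N (fun x => l (j (t x)))) :
    PullsBack (smoothOfEmbedding i) (smoothOfEmbedding j) N t := by
  refine ⟨ht, fun U f hU hf x hx => ?_⟩
  obtain ⟨F, ⟨M, L, G, hG, rfl⟩, hFf⟩ := hf (t x) hx.2
  obtain ⟨F', hF', hFF'⟩ := smoothOfEmbedding.contDiff_comp hi
    (fun a : Fin M => h (LinearMap.proj a ∘ₗ L)) hG x hx.1
  refine ⟨F', hF', ?_⟩
  filter_upwards [hFF', (ht.continuousAt (hN.mem_nhds hx.1)).eventually hFf] with y hy hy'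
  rw [← hy, Function.comp_apply, hy']
  rfl

end Maps

/-! ## Manifolds with a prescribed sheaf of smooth functions -/

section Manifold

variable {X Y Z : Type} [TopologicalSpace X] [TopologicalSpace Y] [TopologicalSpace Z]

/-- The open partial homeomorphism `φ` identifies the functions that are smooth in the sense of `S`
with the smooth functions on open subsets of `E`. -/
def IsSmoothChart {E : Type*} [NormedAddCommGroup E] [NormedSpace ℝ E]
    (S : Set X → (X → ℝ) → Prop) (φ : OpenPartialHomeomorph X E) : Prop :=
  ∀ U f, IsOpen U → U ⊆ φ.source → (S U f ↔ ContDiffOn ℝ ∞ (f ∘ φ.symm) (φ '' U))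

theorem IsSmoothChart.trans_equiv {E E' : Type*} [NormedAddCommGroup E] [NormedSpace ℝ E]
    [NormedAddCommGroup E'] [NormedSpace ℝ E'] {S : Set X → (X → ℝ) → Prop}
    {φ : OpenPartialHomeomorph X E} (h : IsSmoothChart S φ) (T : E ≃L[ℝ] E') :
    IsSmoothChart S (φ.transHomeomorph T.toHomeomorph) := by
  intro U f hU hUs
  rw [h U f hU hUs]
  constructor
  · intro hf
    refine hf.comp T.symm.contDiff.contDiffOn ?_
    rintro _ ⟨x, hx, rfl⟩
    exact ⟨x, hx, by simp⟩
  · intro hf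
    have := hf.comp (s := φ '' U) T.contDiff.contDiffOn (by
      rintro _ ⟨x, hx, rfl⟩
      exact ⟨x, hx, by simp⟩)
    refine this.congr fun y _ => ?_
    simp

theorem IsSmoothChart.of_homeomorph {E : Type*} [NormedAddCommGroup E] [NormedSpace ℝ E]
    {S : Set X → (X → ℝ) → Prop} {S' : Set Z → (Z → ℝ) → Prop} (h : X ≃ₜ Z)
    (hS : ∀ U f, IsOpen U → (S' U f ↔ S (h ⁻¹' U) (f ∘ h)))
    {φ : OpenPartialHomeomorph Z E} (hφ : IsSmoothChart S' φ) :
    IsSmoothChart S (h.transOpenPartialHomeomorph φ) := by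
  intro U f hU hUs
  have h1 : h ⁻¹' (h '' U) = U := h.injective.preimage_image U
  have h2 : (f ∘ h.symm) ∘ h = f := by funext x; simp
  have h3 := hS (h '' U) (f ∘ h.symm) (h.isOpenMap U hU)
  rw [h1, h2] at h3
  rw [← h3, hφ _ _ (h.isOpenMap U hU) (by rintro _ ⟨x, hx, rfl⟩; exact hUs hx)]
  rw [show (h.transOpenPartialHomeomorph φ) '' U = φ '' (h '' U) by
    rw [← Set.image_comp]; rfl]
  rfl

/-- Charts that both identify `S` with ordinary smoothness are automatically compatible, and
locality of `S` glues the comparison over all charts. -/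
theorem exists_isSmoothManifoldWith {d : ℕ} {S : Set X → (X → ℝ) → Prop}
    (hS : IsLocalSmoothness S)
    (hch : ∀ p : X, ∃ φ : OpenPartialHomeomorph X (EuclideanSpace ℝ (Fin d)),
      p ∈ φ.source ∧ IsSmoothChart S φ) :
    ∃ c : ChartedSpace (EuclideanSpace ℝ (Fin d)) X, IsSmoothManifoldWith d c S := by
  choose φ hp hφ using hch
  let c : ChartedSpace (EuclideanSpace ℝ (Fin d)) X :=
    { atlas := Set.range φ
      chartAt := φ
      mem_chart_source := hp
      chart_mem_atlas := fun x => ⟨x, rfl⟩ }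
  have hman : IsManifold (𝓡 d) ∞ X := by
    refine isManifold_of_contDiffOn (𝓡 d) ∞ X ?_
    rintro _ _ ⟨p, rfl⟩ ⟨q, rfl⟩
    have hU : IsOpen ((φ p).source ∩ (φ q).source) := (φ p).open_source.inter (φ q).open_source
    -- A coordinate of the chart at `q` is smooth when read in that chart, hence smooth for `S`,
    -- hence smooth when read in the chart at `p`.
    have hco : ∀ l, ContDiffOn ℝ ∞ ((fun x => φ q x l) ∘ (φ p).symm)
        (φ p '' ((φ p).source ∩ (φ q).source)) := by
      intro l
      rw [← hφ p _ _ hU Set.inter_subset_left, hφ q _ _ hU Set.inter_subset_right]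
      have : ContDiff ℝ ∞ fun y : EuclideanSpace ℝ (Fin d) => y l :=
        (EuclideanSpace.proj (𝕜 := ℝ) l).contDiff
      refine this.contDiffOn.congr ?_
      rintro _ ⟨x, hx, rfl⟩
      simp [(φ q).left_inv hx.2]
    simp only [modelWithCornersSelf_coe, modelWithCornersSelf_coe_symm, Function.comp_id,
      Function.id_comp, Set.preimage_id, Set.range_id, Set.inter_univ]
    rw [contDiffOn_euclidean]
    intro l
    refine (hco l).mono ?_
    rintro y ⟨hy1, hy2⟩
    exact ⟨(φ p).symm y, ⟨(φ p).map_target hy1, hy2⟩, (φ p).right_inv hy1⟩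
  refine ⟨c, hman, fun U hU f => ?_⟩
  have key : ∀ p : X, ∀ U' : Set X, IsOpen U' → U' ⊆ (φ p).source →
      (ContMDiffOn (𝓡 d) 𝓘(ℝ, ℝ) ∞ f U' ↔ S U' f) := by
    intro p U' hU' hs
    rw [hφ p U' f hU' hs, contMDiffOn_iff_of_subset_source' (x := p) (y := (0 : ℝ))
      (by rw [extChartAt_source]; exact hs) (by intro x _; simp [chartAt_self_eq])]
    rfl
  constructor
  · intro hf
    refine hS.2.2 U f hU fun x hx => ⟨U ∩ (φ x).source, hU.inter (φ x).open_source,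
      ⟨hx, hp x⟩, Set.inter_subset_left, ?_⟩
    exact (key x _ (hU.inter (φ x).open_source) Set.inter_subset_right).1
      (hf.mono Set.inter_subset_left)
  · intro hf
    refine contMDiffOn_of_locally_contMDiffOn fun x hx =>
      ⟨(φ x).source, (φ x).open_source, hp x, ?_⟩
    exact (key x _ (hU.inter (φ x).open_source) Set.inter_subset_right).2
      (hS.1 _ _ _ hf Set.inter_subset_left hU (hU.inter (φ x).open_source))

/-- It suffices to pull back the coordinate functions of a chart of the target, which are smooth
functions on the source of that chart. -/
theorem IsSmoothManifoldWith.contMDiff {d : ℕ} {SX : Set X → (X → ℝ) → Prop}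
    {SY : Set Y → (Y → ℝ) → Prop} {cX : ChartedSpace (EuclideanSpace ℝ (Fin d)) X}
    {cY : ChartedSpace (EuclideanSpace ℝ (Fin d)) Y} (hX : IsSmoothManifoldWith d cX SX)
    (hY : IsSmoothManifoldWith d cY SY) {h : X → Y} (hc : Continuous h)
    (hS : ∀ U f, IsOpen U → SY U f → SX (h ⁻¹' U) (f ∘ h)) :
    ContMDiff (𝓡 d) (𝓡 d) ∞ h := by
  have := hX.1
  have := hY.1
  intro x
  rw [contMDiffAt_iff_target]
  refine ⟨hc.continuousAt, ?_⟩
  set s := (chartAt (EuclideanSpace ℝ (Fin d)) (h x)).source with hs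
  have hso : IsOpen s := (chartAt _ (h x)).open_source
  have hco : ∀ l : Fin d, ContMDiffOn (𝓡 d) 𝓘(ℝ, ℝ) ∞
      ((fun y => extChartAt (𝓡 d) (h x) y l) ∘ h) (h ⁻¹' s) := by
    intro l
    rw [hX.2 _ (hso.preimage hc)]
    refine hS _ _ hso ?_
    rw [← hY.2 _ hso]
    have h1 : ContMDiffOn (𝓡 d) 𝓘(ℝ, EuclideanSpace ℝ (Fin d)) ∞ (extChartAt (𝓡 d) (h x)) s :=
      contMDiffOn_extChartAt
    exact ((EuclideanSpace.proj (𝕜 := ℝ) l).contMDiff (n := ∞)).comp_contMDiffOn h1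
  have hpi : ContMDiffOn (𝓡 d) 𝓘(ℝ, Fin d → ℝ) ∞
      (fun z l => extChartAt (𝓡 d) (h x) (h z) l) (h ⁻¹' s) :=
    contMDiffOn_pi_space.2 hco
  have hE := (((EuclideanSpace.equiv (Fin d) ℝ).symm.contDiff (n := ∞)).contMDiff).comp_contMDiffOn
    hpi
  exact hE.contMDiffAt ((hso.preimage hc).mem_nhds (mem_chart_source _ (h x)))

theorem IsSmoothManifoldWith.diffeomorph {d : ℕ} {SX : Set X → (X → ℝ) → Prop}
    {SY : Set Y → (Y → ℝ) → Prop} {cX : ChartedSpace (EuclideanSpace ℝ (Fin d)) X}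
    {cY : ChartedSpace (EuclideanSpace ℝ (Fin d)) Y} (hX : IsSmoothManifoldWith d cX SX)
    (hY : IsSmoothManifoldWith d cY SY) (h : X ≃ₜ Y)
    (hS : ∀ U f, IsOpen U → (SY U f ↔ SX (h ⁻¹' U) (f ∘ h))) :
    Nonempty (Diffeomorph (𝓡 d) (𝓡 d) X Y ∞) := by
  refine ⟨⟨h.toEquiv, hX.contMDiff hY h.continuous fun U f hU => (hS U f hU).1,
    hY.contMDiff hX h.symm.continuous fun U f hU hf => ?_⟩⟩
  refine (hS _ _ (hU.preimage h.symm.continuous)).2 ?_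
  convert hf using 1
  · ext x
    simp
  · funext x
    exact congrArg f (h.symm_apply_apply x)

/-- A homeomorphism that identifies two smoothness predicates. -/
def SmoothlyEquivalent (SX : Set X → (X → ℝ) → Prop) (SZ : Set Z → (Z → ℝ) → Prop) : Prop :=
  ∃ h : X ≃ₜ Z, ∀ U f, IsOpen U → (SZ U f ↔ SX (h ⁻¹' U) (f ∘ h))

theorem SmoothlyEquivalent.symm {SX : Set X → (X → ℝ) → Prop} {SZ : Set Z → (Z → ℝ) → Prop}
    (H : SmoothlyEquivalent SX SZ) : SmoothlyEquivalent SZ SX := by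
  obtain ⟨h, hS⟩ := H
  refine ⟨h.symm, fun U f hU => ?_⟩
  rw [hS _ _ (hU.preimage h.symm.continuous)]
  have h1 : h ⁻¹' (h.symm ⁻¹' U) = U := by ext; simp
  have h2 : (f ∘ h.symm) ∘ h = f := by funext; simp
  rw [h1, h2]

theorem SmoothlyEquivalent.trans {SX : Set X → (X → ℝ) → Prop} {SY : Set Y → (Y → ℝ) → Prop}
    {SZ : Set Z → (Z → ℝ) → Prop} (H : SmoothlyEquivalent SX SY) (H' : SmoothlyEquivalent SY SZ) :
    SmoothlyEquivalent SX SZ := by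
  obtain ⟨h, hS⟩ := H
  obtain ⟨h', hS'⟩ := H'
  exact ⟨h.trans h', fun U f hU =>
    (hS' U f hU).trans (hS _ _ (hU.preimage h'.continuous))⟩

theorem SmoothlyEquivalent.exists_isSmoothManifoldWith {d : ℕ} {SX : Set X → (X → ℝ) → Prop}
    {SZ : Set Z → (Z → ℝ) → Prop} (hloc : IsLocalSmoothness SX) (H : SmoothlyEquivalent SX SZ)
    (hch : ∀ p : Z, ∃ φ : OpenPartialHomeomorph Z (EuclideanSpace ℝ (Fin d)),
      p ∈ φ.source ∧ IsSmoothChart SZ φ) :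
    ∃ c : ChartedSpace (EuclideanSpace ℝ (Fin d)) X, IsSmoothManifoldWith d c SX := by
  obtain ⟨h, hS⟩ := H
  refine SpinOrbit.exists_isSmoothManifoldWith hloc fun p => ?_
  obtain ⟨φ, hφ, hc⟩ := hch (h p)
  exact ⟨h.transOpenPartialHomeomorph φ, by simpa using hφ, hc.of_homeomorph h hS⟩

/-- A quotient map and a smooth map with smooth local sections that have the same fibres have
smoothly equivalent targets. -/
theorem smoothlyEquivalent_of_quotient {SY : Set Y → (Y → ℝ) → Prop}
    {SZ : Set Z → (Z → ℝ) → Prop} (hSZ : IsLocalSmoothness SZ) {q : Y → X}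
    (hq : Topology.IsQuotientMap q) {w : Y → Z} (hw : PullsBack SY SZ Set.univ w)
    (hfib : ∀ y y', q y = q y' ↔ w y = w y')
    (hsec : ∀ z, ∃ N, IsOpen N ∧ z ∈ N ∧ ∃ s : Z → Y, PullsBack SZ SY N s ∧ ∀ z ∈ N, w (s z) = z) :
    SmoothlyEquivalent (smoothOfQuotient q SY) SZ := by
  have hwc : Continuous w := continuousOn_univ.1 hw.1
  have hws : Function.Surjective w := fun z => by
    obtain ⟨N, _, hz, s, _, hs⟩ := hsec z
    exact ⟨s z, hs z hz⟩
  have hwq : Topology.IsQuotientMap w := by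
    -- Local sections make `w` a quotient map: on `N` the set `U` is the preimage of `w ⁻¹' U` under
    -- the continuous section.
    refine ⟨Topology.isCoinducing_iff.2 fun U => ⟨fun h => ?_, fun h => h.preimage hwc⟩, hws⟩
    refine isOpen_iff_mem_nhds.2 fun z hz => ?_
    obtain ⟨N, hN, hzN, s, hsN, hs⟩ := hsec z
    refine Filter.mem_of_superset ((hsN.1.isOpen_inter_preimage hN h).mem_nhds ⟨hzN, ?_⟩) ?_
    · simpa [hs z hzN] using hz
    · rintro z' ⟨h1, h2⟩
      simpa [hs z' h1] using h2
  let a := hq.lift (f := ⟨q, hq.continuous⟩) ⟨w, hwc⟩ fun y y' h => (hfib y y').1 h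
  let b := hwq.lift (f := ⟨w, hwc⟩) ⟨q, hq.continuous⟩ fun y y' h => (hfib y y').2 h
  have ha : ∀ y, a (q y) = w y := fun y =>
    congrArg (fun g : C(Y, Z) => g y) (hq.lift_comp (f := ⟨q, hq.continuous⟩) ⟨w, hwc⟩
      fun y y' h => (hfib y y').1 h)
  have hb : ∀ y, b (w y) = q y := fun y =>
    congrArg (fun g : C(Y, X) => g y) (hwq.lift_comp (f := ⟨w, hwc⟩) ⟨q, hq.continuous⟩
      fun y y' h => (hfib y y').2 h)
  let h : X ≃ₜ Z :=
    { toFun := a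
      invFun := b
      left_inv := fun x => by
        obtain ⟨y, rfl⟩ := hq.surjective x
        rw [ha, hb]
      right_inv := fun z => by
        obtain ⟨y, rfl⟩ := hws z
        rw [hb, ha]
      continuous_toFun := a.continuous
      continuous_invFun := b.continuous }
  have hhq : ∀ y, h (q y) = w y := ha
  refine ⟨h, fun U f hU => ?_⟩
  have h1 : q ⁻¹' (h ⁻¹' U) = w ⁻¹' U := by ext y; simp [hhq]
  have h2 : (f ∘ h) ∘ q = f ∘ w := by funext y; simp [hhq]
  rw [smoothOfQuotient, h1, h2]
  constructor
  · intro hf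
    simpa using hw.2 U f hU hf
  · intro hf
    -- Locally `f = (f ∘ w) ∘ s`, so smoothness upstairs descends along the section.
    refine hSZ.2.2 U f hU fun z hz => ?_
    obtain ⟨N, hN, hzN, s, hsN, hs⟩ := hsec z
    have hopen : IsOpen (N ∩ s ⁻¹' (w ⁻¹' U)) := hsN.1.isOpen_inter_preimage hN (hU.preimage hwc)
    have hsub : N ∩ s ⁻¹' (w ⁻¹' U) ⊆ U := by
      rintro z' ⟨h1, h2⟩
      simpa [hs z' h1] using h2
    refine ⟨_, hopen, ⟨hzN, by simpa [hs z hzN] using hz⟩, hsub, ?_⟩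
    refine hSZ.2.1 _ _ _ hopen (hsN.2 _ _ (hU.preimage hwc) hf) fun z' hz' => ?_
    simp [hs z' hz'.1]

end Manifold

/-! ## Products of orthogonal vectors in the Clifford algebra -/

section Clifford

variable {m : ℕ}

theorem negForm_eq_neg_dotProduct (v : Fin m → ℝ) : negForm m v = -(v ⬝ᵥ v) := by
  rw [negForm_apply]
  simp [dotProduct, pow_two]

theorem polar_negForm (v u : Fin m → ℝ) :
    QuadraticMap.polar (negForm m) v u = -2 * (v ⬝ᵥ u) := by
  simp only [QuadraticMap.polar, negForm_eq_neg_dotProduct, add_dotProduct, dotProduct_add]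
  rw [dotProduct_comm u v]
  ring

/-- The inclusion of `ℝᵐ` in its Clifford algebra. -/
abbrev vec : (Fin m → ℝ) →ₗ[ℝ] Cl m := ι (negForm m)

theorem vec_mul_self (v : Fin m → ℝ) : vec v * vec v = algebraMap ℝ (Cl m) (-(v ⬝ᵥ v)) := by
  rw [ι_sq_scalar, negForm_eq_neg_dotProduct]

theorem vec_mul_self_of_unit {v : Fin m → ℝ} (hv : v ⬝ᵥ v = 1) : vec v * vec v = -1 := by
  rw [vec_mul_self, hv]
  simp

theorem vec_mul_vec_add (v u : Fin m → ℝ) :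
    vec v * vec u + vec u * vec v = algebraMap ℝ (Cl m) (-2 * (v ⬝ᵥ u)) := by
  rw [ι_mul_ι_add_swap, polar_negForm]

theorem vec_mul_vec_of_orthogonal {v u : Fin m → ℝ} (h : v ⬝ᵥ u = 0) :
    vec v * vec u = -(vec u * vec v) := by
  have := vec_mul_vec_add v u
  rw [h] at this
  simp only [mul_zero, map_zero] at this
  exact eq_neg_of_add_eq_zero_left this

theorem vec_injective : Function.Injective (vec (m := m)) := by
  intro v u h
  have hw : vec (v - u) = (0 : Cl m) := by rw [map_sub]; exact sub_eq_zero.2 h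
  have h0 := vec_mul_vec_add (v - u) (v - u)
  rw [hw] at h0
  have h1 := (algebraMap ℝ (Cl m)).injective ((h0.symm.trans (by simp)).trans (map_zero _).symm)
  exact sub_eq_zero.1 (dotProduct_self_eq_zero.1 (by linarith))

/-- The exterior product, as an alternating map into the Clifford algebra. -/
def wedge (r m : ℕ) : (Fin m → ℝ) [⋀^Fin r]→ₗ[ℝ] Cl m :=
  (equivExterior (negForm m)).symm.toLinearMap.compAlternatingMap (ExteriorAlgebra.ιMulti ℝ r)

theorem contractLeft_list_prod (d : Module.Dual ℝ (Fin m → ℝ)) (l : List (Fin m → ℝ))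
    (h : ∀ v ∈ l, d v = 0) :
    contractLeft (Q := (0 : QuadraticForm ℝ (Fin m → ℝ))) d
      (l.map (ι (0 : QuadraticForm ℝ (Fin m → ℝ)))).prod = 0 := by
  induction l with
  | nil => simp
  | cons v l ih =>
    rw [List.map_cons, List.prod_cons, contractLeft_ι_mul, h v (by simp),
      ih fun u hu => h u (by simp [hu])]
    simp

/-- Under the isomorphism, left Clifford multiplication by `v` is exterior multiplication by `v`
corrected by a contraction with the bilinear form at `v`. The contraction kills a product of vectors
orthogonal to `v`. -/
theorem equivExterior_list_prod (l : List (Fin m → ℝ)) (h : l.Pairwise fun u v => u ⬝ᵥ v = 0) :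
    equivExterior (negForm m) (l.map vec).prod =
      (l.map (ι (0 : QuadraticForm ℝ (Fin m → ℝ)))).prod := by
  induction l with
  | nil => simp [equivExterior]
  | cons v l ih =>
    rw [List.pairwise_cons] at h
    have h1 := changeForm_ι_mul (changeForm.associated_neg_proof (Q := negForm m)) v
      (l.map vec).prod
    rw [List.map_cons, List.prod_cons]
    refine h1.trans ?_
    have h2 : changeForm (changeForm.associated_neg_proof (Q := negForm m)) (l.map vec).prod =
      (l.map (ι (0 : QuadraticForm ℝ (Fin m → ℝ)))).prod := ih h.2
    rw [h2, contractLeft_list_prod]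
    · simp
    · intro u hu
      have h3 := polar_negForm v u
      rw [h.1 u hu, QuadraticMap.polar] at h3
      rw [QuadraticMap.associated_apply]
      simp only [neg_apply]
      rw [sub_eq_zero.1 (by rw [← sub_sub] at *; linarith : negForm m (v + u) - (negForm m v + negForm m u) = 0)]
      simp

theorem wedge_of_orthogonal {r : ℕ} (b : Fin r → Fin m → ℝ)
    (h : ∀ i j, i ≠ j → b i ⬝ᵥ b j = 0) : wedge r m b = (List.ofFn fun i => vec (b i)).prod := by
  have h1 := equivExterior_list_prod (List.ofFn b) (List.pairwise_ofFn.2 fun i j hij =>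
    h i j hij.ne)
  rw [wedge, LinearMap.compAlternatingMap_apply, ExteriorAlgebra.ιMulti_apply]
  simp only [LinearEquiv.coe_coe]
  rw [LinearEquiv.symm_apply_eq]
  simpa [List.map_ofFn, Function.comp_def] using h1.symm

/-- The linear functional on the Clifford algebra given by an alternating form. -/
def wedgeFunctional {r : ℕ} (f : (Fin m → ℝ) [⋀^Fin r]→ₗ[ℝ] ℝ) : Cl m →ₗ[ℝ] ℝ :=
  ExteriorAlgebra.liftAlternating (Pi.single r f) ∘ₗ (equivExterior (negForm m)).toLinearMap

theorem wedgeFunctional_wedge {r : ℕ} (f : (Fin m → ℝ) [⋀^Fin r]→ₗ[ℝ] ℝ)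
    (b : Fin r → Fin m → ℝ) : wedgeFunctional f (wedge r m b) = f b := by
  rw [wedgeFunctional, wedge, LinearMap.compAlternatingMap_apply]
  simp only [LinearMap.comp_apply, LinearEquiv.coe_coe, LinearEquiv.apply_symm_apply]
  rw [ExteriorAlgebra.liftAlternating_apply_ιMulti, Pi.single_eq_same]

theorem vec_mul_list_prod (v : Fin m → ℝ) (l : List (Fin m → ℝ)) (h : ∀ u ∈ l, v ⬝ᵥ u = 0) :
    vec v * (l.map vec).prod = (-1 : ℝ) ^ l.length • ((l.map vec).prod * vec v) := by
  induction l with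
  | nil => simp
  | cons u l ih =>
    rw [List.map_cons, List.prod_cons, ← mul_assoc, vec_mul_vec_of_orthogonal (h u (by simp)),
      neg_mul, mul_assoc, ih fun w hw => h w (by simp [hw])]
    rw [List.length_cons, pow_succ, mul_smul_comm, mul_assoc]
    simp

/-- Moving `v` through the product costs a sign at each other factor and none at the factor `v`
itself. -/
theorem vec_mul_list_prod_of_mem (v : Fin m → ℝ) (l : List (Fin m → ℝ)) (hv : v ∈ l)
    (h : l.Pairwise fun u v => u ⬝ᵥ v = 0) :
    vec v * (l.map vec).prod = (-1 : ℝ) ^ (l.length - 1) • ((l.map vec).prod * vec v) := by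
  obtain ⟨l₁, l₂, rfl⟩ := List.append_of_mem hv
  rw [List.pairwise_append, List.pairwise_cons] at h
  have h1 := vec_mul_list_prod v l₁ fun u hu => by
    rw [dotProduct_comm]
    exact h.2.2 u hu v (by simp)
  have h2 := vec_mul_list_prod v l₂ h.2.1.1
  simp only [List.map_append, List.map_cons, List.prod_append, List.prod_cons, List.length_append,
    List.length_cons]
  have h3 : (l₁.map vec).prod * (vec v * (l₂.map vec).prod) * vec v =
      (-1 : ℝ) ^ l₂.length • ((l₁.map vec).prod * (vec v * (vec v * (l₂.map vec).prod))) := by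
    conv_rhs => rw [h2]
    rw [mul_smul_comm, mul_smul_comm, smul_smul, ← mul_pow]
    simp [mul_assoc]
  rw [h3, smul_smul, ← mul_assoc, h1, smul_mul_assoc, mul_assoc, show
    l₁.length + (l₂.length + 1) - 1 = l₁.length + l₂.length by omega, pow_add, mul_assoc,
    ← mul_pow]
  simp

/-- The product of the vectors of a finite family. -/
def vecProd {r : ℕ} (b : Fin r → Fin m → ℝ) : Cl m := (List.ofFn fun i => vec (b i)).prod

theorem vecProd_eq {r : ℕ} (b : Fin r → Fin m → ℝ) :
    vecProd b = ((List.ofFn b).map vec).prod := by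
  rw [vecProd, List.map_ofFn]
  rfl

theorem vec_mul_vecProd_of_mem {r : ℕ} {b : Fin r → Fin m → ℝ}
    (h : ∀ i j, i ≠ j → b i ⬝ᵥ b j = 0) (i : Fin r) :
    vec (b i) * vecProd b = (-1 : ℝ) ^ (r - 1) • (vecProd b * vec (b i)) := by
  have := vec_mul_list_prod_of_mem (b i) (List.ofFn b) (by simp)
    (List.pairwise_ofFn.2 fun i j hij => h i j hij.ne)
  rwa [← vecProd_eq, List.length_ofFn] at this

theorem vec_mul_vecProd_of_orthogonal {r : ℕ} {b : Fin r → Fin m → ℝ} {v : Fin m → ℝ}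
    (h : ∀ i, v ⬝ᵥ b i = 0) :
    vec v * vecProd b = (-1 : ℝ) ^ r • (vecProd b * vec v) := by
  have := vec_mul_list_prod v (List.ofFn b) (by simpa [List.mem_ofFn] using h)
  rwa [← vecProd_eq, List.length_ofFn] at this

/-! ## The even elements that commute with all vectors -/

/-- The standard basis vectors. -/
abbrev stdVec (m : ℕ) (i : Fin m) : Fin m → ℝ := Pi.single i 1

theorem stdVec_orthogonal {i j : Fin m} (h : i ≠ j) : stdVec m i ⬝ᵥ stdVec m j = 0 := by
  simp [stdVec, h.symm]

theorem stdVec_unit (i : Fin m) : stdVec m i ⬝ᵥ stdVec m i = 1 := by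
  simp [stdVec]

theorem vec_sum_stdVec (v : Fin m → ℝ) : vec v = ∑ i, v i • vec (stdVec m i) := by
  conv_lhs => rw [pi_eq_sum_univ' v]
  simp [vec, stdVec, map_sum, map_smul]

/-- The subalgebra generated by the basis vectors with index in `s`. -/
def coordSubalgebra (s : Finset (Fin m)) : Subalgebra ℝ (Cl m) :=
  Algebra.adjoin ℝ ((fun i => vec (stdVec m i)) '' s)

theorem coordSubalgebra_univ : coordSubalgebra (Finset.univ : Finset (Fin m)) = ⊤ := by
  rw [eq_top_iff, ← adjoin_range_ι, Algebra.adjoin_le_iff]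
  rintro _ ⟨v, rfl⟩
  change vec v ∈ _
  rw [vec_sum_stdVec]
  exact Subalgebra.sum_mem _ fun i _ => Subalgebra.smul_mem _
    (Algebra.subset_adjoin (Set.mem_image_of_mem _ (by simp))) _

theorem involute_mem_coordSubalgebra {s : Finset (Fin m)} {z : Cl m}
    (hz : z ∈ coordSubalgebra s) : involute z ∈ coordSubalgebra s := by
  induction hz using Algebra.adjoin_induction with
  | mem x hx =>
    obtain ⟨i, hi, rfl⟩ := hx
    simp only [involute_ι]
    exact Subalgebra.neg_mem _ (Algebra.subset_adjoin ⟨i, hi, rfl⟩)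
  | algebraMap r => simp
  | add x y _ _ hx hy => simpa using Subalgebra.add_mem _ hx hy
  | mul x y _ _ hx hy => simpa using Subalgebra.mul_mem _ hx hy

theorem vec_mul_of_mem_coordSubalgebra {s : Finset (Fin m)} {z : Cl m}
    (hz : z ∈ coordSubalgebra s) {i : Fin m} (hi : i ∉ s) :
    vec (stdVec m i) * z = involute z * vec (stdVec m i) := by
  induction hz using Algebra.adjoin_induction with
  | mem x hx =>
    obtain ⟨j, hj, rfl⟩ := hx
    simp only [involute_ι, neg_mul]
    exact vec_mul_vec_of_orthogonal (stdVec_orthogonal (by rintro rfl; exact hi hj))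
  | algebraMap r => simp [Algebra.commutes]
  | add x y _ _ hx hy => simp [mul_add, add_mul, hx, hy]
  | mul x y _ _ hx hy => rw [← mul_assoc, hx, mul_assoc, hy, map_mul, mul_assoc]

theorem mul_vec_of_mem_coordSubalgebra {s : Finset (Fin m)} {z : Cl m}
    (hz : z ∈ coordSubalgebra s) {i : Fin m} (hi : i ∉ s) :
    z * vec (stdVec m i) = vec (stdVec m i) * involute z := by
  rw [vec_mul_of_mem_coordSubalgebra (involute_mem_coordSubalgebra hz) hi, involute_involute]

theorem exists_of_mem_coordSubalgebra_insert {s : Finset (Fin m)} {i : Fin m} (hi : i ∉ s)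
    {z : Cl m} (hz : z ∈ coordSubalgebra (insert i s)) :
    ∃ a ∈ coordSubalgebra s, ∃ b ∈ coordSubalgebra s, z = a + vec (stdVec m i) * b := by
  induction hz using Algebra.adjoin_induction with
  | mem x hx =>
    obtain ⟨j, hj, rfl⟩ := hx
    rw [Finset.coe_insert, Set.mem_insert_iff] at hj
    rcases hj with rfl | hj
    · exact ⟨0, Subalgebra.zero_mem _, 1, Subalgebra.one_mem _, by simp⟩
    · exact ⟨_, Algebra.subset_adjoin ⟨j, hj, rfl⟩, 0, Subalgebra.zero_mem _, by simp⟩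
  | algebraMap r => exact ⟨_, Subalgebra.algebraMap_mem _ r, 0, Subalgebra.zero_mem _, by simp⟩
  | add x y _ _ hx hy =>
    obtain ⟨a, ha, b, hb, rfl⟩ := hx
    obtain ⟨a', ha', b', hb', rfl⟩ := hy
    exact ⟨a + a', Subalgebra.add_mem _ ha ha', b + b', Subalgebra.add_mem _ hb hb', by
      rw [mul_add]; abel⟩
  | mul x y _ _ hx hy =>
    obtain ⟨a, ha, b, hb, rfl⟩ := hx
    obtain ⟨a', ha', b', hb', rfl⟩ := hy
    refine ⟨a * a' - involute b * b', Subalgebra.sub_mem _ (Subalgebra.mul_mem _ ha ha')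
      (Subalgebra.mul_mem _ (involute_mem_coordSubalgebra hb) hb'),
      b * a' + involute a * b', Subalgebra.add_mem _ (Subalgebra.mul_mem _ hb ha')
      (Subalgebra.mul_mem _ (involute_mem_coordSubalgebra ha) hb'), ?_⟩
    have h1 := mul_vec_of_mem_coordSubalgebra ha hi
    have h2 := mul_vec_of_mem_coordSubalgebra hb hi
    have h3 := vec_mul_self_of_unit (stdVec_unit i)
    calc (a + vec (stdVec m i) * b) * (a' + vec (stdVec m i) * b')
        = a * a' + (a * vec (stdVec m i)) * b' + vec (stdVec m i) * (b * a') +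
          vec (stdVec m i) * (b * vec (stdVec m i)) * b' := by noncomm_ring
      _ = a * a' + vec (stdVec m i) * involute a * b' + vec (stdVec m i) * (b * a') +
          (vec (stdVec m i) * vec (stdVec m i)) * involute b * b' := by
            rw [h1, h2]; noncomm_ring
      _ = _ := by rw [h3]; noncomm_ring

/-- Write `z = a + e_i b` with `a`, `b` free of `e_i`. The `a` terms agree on both sides, while the
`b` terms are `-b` and `b`, so `b = 0`. -/
theorem mem_coordSubalgebra_of_vec_mul {s : Finset (Fin m)} {i : Fin m} (hi : i ∉ s) {z : Cl m}
    (hz : z ∈ coordSubalgebra (insert i s))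
    (h : vec (stdVec m i) * z = involute z * vec (stdVec m i)) : z ∈ coordSubalgebra s := by
  obtain ⟨a, ha, b, hb, rfl⟩ := exists_of_mem_coordSubalgebra_insert hi hz
  have h1 := vec_mul_of_mem_coordSubalgebra ha hi
  have h2 := vec_mul_of_mem_coordSubalgebra hb hi
  have h3 := vec_mul_self_of_unit (stdVec_unit i)
  rw [map_add, map_mul, involute_ι, mul_add, add_mul, h1, mul_assoc, ← h2, ← mul_assoc, h3,
    neg_mul, neg_mul, ← mul_assoc, h3] at h
  have h4 : (2 : ℝ) • b = 0 := by
    have := add_left_cancel h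
    simp only [neg_mul, one_mul, neg_neg] at this
    rw [two_smul]
    nth_rewrite 1 [← this]
    simp
  have h5 : b = 0 := (smul_eq_zero.1 h4).resolve_left two_ne_zero
  simpa [h5] using ha

/-- For an even element, twisted commutation is ordinary commutation. The basis vectors can thus be
removed one by one, until only scalars remain. -/
theorem exists_algebraMap_of_commute_vec {z : Cl m} (hz : involute z = z)
    (h : ∀ v, Commute (vec v) z) : ∃ r : ℝ, z = algebraMap ℝ (Cl m) r := by
  have key : ∀ s : Finset (Fin m), z ∈ coordSubalgebra s → z ∈ coordSubalgebra (∅ : Finset (Fin m)) := by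
    intro s
    induction s using Finset.induction_on with
    | empty => exact id
    | insert i s hi ih =>
      intro hzs
      exact ih (mem_coordSubalgebra_of_vec_mul hi hzs (by rw [hz]; exact h _))
  have h0 := key Finset.univ (by rw [coordSubalgebra_univ]; trivial)
  rw [coordSubalgebra, Finset.coe_empty, Set.image_empty, Algebra.adjoin_empty] at h0
  obtain ⟨r, hr⟩ := Algebra.mem_bot.1 h0
  exact ⟨r, hr.symm⟩

end Clifford

/-! ### The covering of `SO(m)` by `Spin(m)` and its kernel -/

section Covering

variable {m : ℕ}

/-- An alternating map is multiplied by the determinant under a change of the arguments. -/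
theorem map_sum_smul_eq_det_smul {V N : Type*} [AddCommGroup V] [Module ℝ V] [AddCommGroup N]
    [Module ℝ N] {r : ℕ} (f : V [⋀^Fin r]→ₗ[ℝ] N) (b : Fin r → V)
    (A : Matrix (Fin r) (Fin r) ℝ) : f (fun i => ∑ j, A i j • b j) = A.det • f b := by
  let L : (Fin r → ℝ) →ₗ[ℝ] V := Fintype.linearCombination ℝ b
  have h : f.compLinearMap L =
      (LinearMap.toSpanSingleton ℝ N (f b)).compAlternatingMap Matrix.detRowAlternating := by
    refine Module.Basis.ext_alternating (Pi.basisFun ℝ (Fin r)) fun v hv => ?_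
    let σ : Equiv.Perm (Fin r) := Equiv.ofBijective v (Finite.injective_iff_bijective.1 hv)
    have h1 : (f.compLinearMap L) (fun i => Pi.basisFun ℝ (Fin r) (v i)) =
        f.compLinearMap L ((Pi.basisFun ℝ (Fin r)) ∘ σ) := rfl
    have h2 : ((LinearMap.toSpanSingleton ℝ N (f b)).compAlternatingMap Matrix.detRowAlternating)
        (fun i => Pi.basisFun ℝ (Fin r) (v i)) =
        ((LinearMap.toSpanSingleton ℝ N (f b)).compAlternatingMap Matrix.detRowAlternating)
        ((Pi.basisFun ℝ (Fin r)) ∘ σ) := rfl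
    rw [h1, h2, AlternatingMap.map_perm, AlternatingMap.map_perm]
    congr 1
    have h3 : Matrix.detRowAlternating (R := ℝ) (fun i => Pi.basisFun ℝ (Fin r) i) = 1 := by
      have : (fun i => Pi.basisFun ℝ (Fin r) i) = (1 : Matrix (Fin r) (Fin r) ℝ) := by
        ext i j
        simp [Matrix.one_apply, Pi.single_apply, eq_comm]
      rw [this]
      exact Matrix.det_one
    simp only [AlternatingMap.compLinearMap_apply, LinearMap.compAlternatingMap_apply]
    rw [h3]
    simp [L, Fintype.linearCombination_apply, Pi.single_apply]
  exact congrArg (fun g : (Fin r → ℝ) [⋀^Fin r]→ₗ[ℝ] N => g A) h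

theorem Spin.star_mul (g : Spin m) : star (g : Cl m) * g = 1 := spinGroup.star_mul_self_of_mem g.2

theorem Spin.mul_star (g : Spin m) : (g : Cl m) * star (g : Cl m) = 1 :=
  spinGroup.mul_star_self_of_mem g.2

theorem Spin.coe_inv (g : Spin m) : ((g⁻¹ : Spin m) : Cl m) = star (g : Cl m) := rfl

theorem Spin.conj_mul (g : Spin m) (x y : Cl m) :
    (g : Cl m) * (x * y) * star (g : Cl m) =
      ((g : Cl m) * x * star (g : Cl m)) * ((g : Cl m) * y * star (g : Cl m)) := by
  calc (g : Cl m) * (x * y) * star (g : Cl m)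
      = (g : Cl m) * x * 1 * y * star (g : Cl m) := by noncomm_ring
    _ = _ := by rw [← Spin.star_mul g]; noncomm_ring

theorem Spin.conj_algebraMap (g : Spin m) (r : ℝ) :
    (g : Cl m) * algebraMap ℝ (Cl m) r * star (g : Cl m) = algebraMap ℝ (Cl m) r := by
  rw [← Algebra.commutes, mul_assoc, Spin.mul_star, mul_one]

theorem Covers.conj {g : Spin m} {R : SO m} (h : Covers g R) (v : Fin m → ℝ) :
    (g : Cl m) * vec v * star (g : Cl m) = vec ((R : Matrix (Fin m) (Fin m) ℝ) *ᵥ v) := h v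

theorem Spin.conj_vecProd (g : Spin m) {r : ℕ} {b b' : Fin r → Fin m → ℝ}
    (h : ∀ i, (g : Cl m) * vec (b i) * star (g : Cl m) = vec (b' i)) :
    (g : Cl m) * vecProd b * star (g : Cl m) = vecProd b' := by
  induction r with
  | zero => simp [vecProd]
  | succ r ih =>
    have h1 := ih (b := fun i => b i.succ) (b' := fun i => b' i.succ) fun i => h _
    simp only [vecProd] at h1 ⊢
    rw [List.ofFn_succ, List.ofFn_succ, List.prod_cons, List.prod_cons, Spin.conj_mul, h, h1]

/-- Even elements are built from products of two vectors, and the two factors `c` cancel. -/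
theorem commute_of_mem_even {a : ℕ} (φ : Cl a →ₐ[ℝ] Cl m) {u : Cl m} {c : ℝ} (hc : c * c = 1)
    (h : ∀ v, φ (vec v) * u = c • (u * φ (vec v))) {z : Cl a} (hz : z ∈ even (negForm a)) :
    Commute (φ z) u := by
  have hz' : z ∈ evenOdd (negForm a) 0 := by rwa [← even_toSubmodule]
  clear hz
  induction z, hz' using even_induction with
  | algebraMap r =>
    rw [AlgHom.commutes]
    exact Algebra.commutes r u
  | add x y _ _ hx hy => rw [map_add]; exact hx.add_left hy
  | ι_mul_ι_mul v w x _ hx =>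
    rw [map_mul]
    refine Commute.mul_left ?_ hx
    rw [map_mul]
    change _ * _ = _ * _
    calc φ (vec v) * φ (vec w) * u = φ (vec v) * (φ (vec w) * u) := mul_assoc _ _ _
      _ = u * (φ (vec v) * φ (vec w)) := by
        rw [h w, mul_smul_comm, ← mul_assoc, h v, smul_mul_assoc, smul_smul, hc, one_smul,
          mul_assoc]

theorem Spin.mem_even (g : Spin m) : (g : Cl m) ∈ even (negForm m) := spinGroup.mem_even g.2

theorem commute_vecProd_stdVec {z : Cl m} (hz : z ∈ even (negForm m)) :
    Commute z (vecProd (stdVec m)) := by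
  refine commute_of_mem_even (AlgHom.id ℝ (Cl m)) (c := (-1) ^ (m - 1)) ?_ ?_ hz
  · rw [← mul_pow]; simp
  · intro v
    simp only [AlgHom.coe_id, id_eq]
    rw [vec_sum_stdVec, Finset.sum_mul, Finset.mul_sum, Finset.smul_sum]
    refine Finset.sum_congr rfl fun i _ => ?_
    rw [smul_mul_assoc, vec_mul_vecProd_of_mem fun i j => stdVec_orthogonal, mul_smul_comm,
      smul_comm]

theorem mulVec_eq_sum_stdVec {r : ℕ} (A : Matrix (Fin r) (Fin m) ℝ) (i : Fin m) :
    A *ᵥ stdVec m i = ∑ j, A j i • stdVec r j := by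
  funext l
  simp [stdVec, Finset.sum_apply, Pi.single_apply]

theorem wedge_stdVec_ne_zero : wedge m m (stdVec m) ≠ 0 := by
  intro h
  have h1 := wedgeFunctional_wedge (m := m) Matrix.detRowAlternating (stdVec m)
  rw [h, map_zero] at h1
  have h2 : stdVec m = (1 : Matrix (Fin m) (Fin m) ℝ) := by
    ext i j
    simp [Matrix.one_apply, Pi.single_apply, eq_comm]
  rw [h2] at h1
  have h3 : Matrix.detRowAlternating (1 : Matrix (Fin m) (Fin m) ℝ) = 1 := Matrix.det_one
  rw [h3] at h1
  exact zero_ne_one h1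

/-- Conjugation by `g` maps vectors to vectors and fixes the scalars `v w + w v`, so it is
orthogonal. -/
theorem exists_covers (g : Spin m) : ∃ R : SO m, Covers g R := by
  have h0 : ∀ v, ∃ w, (g : Cl m) * vec v * star (g : Cl m) = vec w := by
    intro v
    obtain ⟨w, hw⟩ := spinGroup.conjAct_smul_ι_mem_range_ι (x := spinGroup.toUnits g) g.2 v
    refine ⟨w, ?_⟩
    rw [ConjAct.units_smul_def] at hw
    exact hw.symm
  choose f hf using h0
  let F : (Fin m → ℝ) →ₗ[ℝ] (Fin m → ℝ) :=
    { toFun := f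
      map_add' := fun v w => vec_injective (by
        rw [map_add, ← hf, ← hf, ← hf, map_add]; noncomm_ring)
      map_smul' := fun c v => vec_injective (by
        rw [RingHom.id_apply, map_smul, ← hf, ← hf, map_smul]; simp) }
  let R := LinearMap.toMatrix' F
  have hR : ∀ v, R *ᵥ v = f v := fun v => LinearMap.toMatrix'_mulVec F v
  have hdot : ∀ v w, f v ⬝ᵥ f w = v ⬝ᵥ w := by
    intro v w
    have h1 := vec_mul_vec_add (f v) (f w)
    rw [← hf, ← hf, ← Spin.conj_mul, ← Spin.conj_mul, ← add_mul, ← mul_add, vec_mul_vec_add,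
      Spin.conj_algebraMap] at h1
    have := (algebraMap ℝ (Cl m)).injective h1
    linarith
  have horth : R ∈ Matrix.orthogonalGroup (Fin m) ℝ := by
    rw [Matrix.mem_orthogonalGroup_iff']
    ext i j
    have h1 := hdot (stdVec m i) (stdVec m j)
    rw [← hR, ← hR] at h1
    simp only [stdVec, Matrix.mulVec_single_one] at h1
    rw [Matrix.mul_apply', Matrix.one_apply]
    refine h1.trans ?_
    simp [Pi.single_apply, eq_comm]
  -- Conjugation multiplies the volume element `e_1 ⋯ e_m` by `det R`, but the even element `g`
  -- commutes with it.
  have hdet : R.det = 1 := by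
    have h1 := Spin.conj_vecProd g (b := stdVec m) (b' := fun i => R *ᵥ stdVec m i)
      fun i => by rw [hR, hf]
    rw [(commute_vecProd_stdVec (Spin.mem_even g)).eq, mul_assoc, Spin.mul_star, mul_one] at h1
    have h2 := wedge_of_orthogonal (fun i => R *ᵥ stdVec m i) fun i j hij => by
      rw [hR, hR, hdot, stdVec_orthogonal hij]
    have h3 := wedge_of_orthogonal (stdVec m) fun i j hij => stdVec_orthogonal hij
    have h4 := map_sum_smul_eq_det_smul (wedge m m) (stdVec m) Rᵀ
    simp only [Matrix.transpose_apply, ← mulVec_eq_sum_stdVec, Matrix.det_transpose] at h4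
    have h5 : R.det • wedge m m (stdVec m) = (1 : ℝ) • wedge m m (stdVec m) := by
      rw [← h4, one_smul, h2, h3]
      exact h1.symm
    exact smul_left_injective ℝ wedge_stdVec_ne_zero h5
  exact ⟨⟨R, Matrix.mem_specialOrthogonalGroup_iff.2 ⟨horth, hdet⟩⟩, fun v => by
    rw [show (R *ᵥ v) = f v from hR v]; exact hf v⟩

theorem Covers.unique {g : Spin m} {R R' : SO m} (h : Covers g R) (h' : Covers g R') : R = R' := by
  refine Subtype.ext (Matrix.ext_of_mulVec_single fun i => ?_)
  exact vec_injective ((h _).symm.trans (h' _))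

theorem Covers.mul {g g' : Spin m} {R R' : SO m} (h : Covers g R) (h' : Covers g' R') :
    Covers (g * g') (R * R') := by
  intro v
  have h1 := h ((R' : Matrix (Fin m) (Fin m) ℝ) *ᵥ v)
  rw [← h' v, Matrix.mulVec_mulVec] at h1
  rw [show ((R * R' : SO m) : Matrix (Fin m) (Fin m) ℝ) = R * R' from rfl, ← h1]
  simp [mul_assoc]

theorem Covers.inv {g : Spin m} {R : SO m} (h : Covers g R) : Covers g⁻¹ R⁻¹ := by
  obtain ⟨R', h'⟩ := exists_covers g⁻¹
  have h1 := h.mul h'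
  have h2 : Covers (1 : Spin m) (1 : SO m) := fun v => by simp
  rw [mul_inv_cancel] at h1
  rwa [inv_eq_of_mul_eq_one_right (h1.unique h2)]

/-- Such a `g` is even and commutes with all vectors, so it is a scalar `r`, and `g g* = 1` becomes
`r² = 1`. -/
theorem eq_one_or_neg_one_of_covers_one {g : Spin m} (h : Covers g 1) :
    (g : Cl m) = 1 ∨ (g : Cl m) = -1 := by
  have h1 : ∀ v, Commute (vec v) (g : Cl m) := by
    intro v
    have := h.conj v
    simp only [OneMemClass.coe_one, Matrix.one_mulVec] at this
    change _ * _ = _ * _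
    conv_lhs => rw [← this]
    rw [mul_assoc, Spin.star_mul, mul_one]
  obtain ⟨r, hr⟩ := exists_algebraMap_of_commute_vec (spinGroup.involute_eq g.2) h1
  have h2 := Spin.mul_star g
  rw [hr, star_algebraMap, ← map_mul] at h2
  have h3 : r * r = 1 := (algebraMap ℝ (Cl m)).injective (h2.trans (map_one _).symm)
  rcases mul_self_eq_one_iff.1 h3 with rfl | rfl
  · left; simp [hr]
  · right; simp [hr]

end Covering

/-! ### Lifting rotations to products of unit vectors -/

section Rotations

variable {m : ℕ}

theorem vec_mem_pinGroup {u : Fin m → ℝ} (hu : u ⬝ᵥ u = 1) : vec u ∈ pinGroup (negForm m) := by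
  have h1 := vec_mul_self_of_unit hu
  refine pinGroup.mem_iff.2 ⟨⟨⟨vec u, -vec u, by simp [h1], by simp [h1]⟩,
    Subgroup.subset_closure ⟨u, rfl⟩, rfl⟩, ?_⟩
  rw [Unitary.mem_iff, star_ι]
  simp [h1]

theorem vec_mul_vec_mem_spinGroup {u v : Fin m → ℝ} (hu : u ⬝ᵥ u = 1) (hv : v ⬝ᵥ v = 1) :
    vec u * vec v ∈ spinGroup (negForm m) := by
  refine spinGroup.mem_iff.2 ⟨mul_mem (vec_mem_pinGroup hu) (vec_mem_pinGroup hv), ?_⟩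
  have := ι_mul_ι_mem_evenOdd_zero (negForm m) u v
  rwa [← even_toSubmodule] at this

/-- The product of two unit vectors, as an element of the spin group. -/
def unitPair (u v : Fin m → ℝ) (hu : u ⬝ᵥ u = 1) (hv : v ⬝ᵥ v = 1) : Spin m :=
  ⟨vec u * vec v, vec_mul_vec_mem_spinGroup hu hv⟩

/-- The subgroup of the spin group generated by the products of two unit vectors. -/
def unitPairs (m : ℕ) : Subgroup (Spin m) :=
  Subgroup.closure {g | ∃ u v hu hv, g = unitPair u v hu hv}

/-- The right side is the reflection of `w` in the hyperplane orthogonal to `u`. Conjugation by a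
product of two unit vectors is therefore a product of two reflections. -/
theorem vec_mul_vec_mul_vec {u : Fin m → ℝ} (hu : u ⬝ᵥ u = 1) (w : Fin m → ℝ) :
    vec u * vec w * vec u = vec (w - (2 * (w ⬝ᵥ u)) • u) := by
  have h1 := vec_mul_vec_add u w
  rw [eq_sub_of_add_eq h1, sub_mul, mul_assoc, vec_mul_self_of_unit hu, map_sub, map_smul,
    dotProduct_comm u w, ← Algebra.smul_def]
  rw [sub_eq_add_neg, add_comm]
  simp [sub_eq_add_neg]

theorem unitPair_conj {u v : Fin m → ℝ} (hu : u ⬝ᵥ u = 1) (hv : v ⬝ᵥ v = 1) (w : Fin m → ℝ) :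
    (unitPair u v hu hv : Cl m) * vec w * star (unitPair u v hu hv : Cl m) =
      vec (w - (2 * (w ⬝ᵥ v)) • v - (2 * ((w - (2 * (w ⬝ᵥ v)) • v) ⬝ᵥ u)) • u) := by
  rw [← vec_mul_vec_mul_vec hu, ← vec_mul_vec_mul_vec hv]
  simp only [unitPair, star_mul, star_ι]
  noncomm_ring

/-- The reflection along `u` takes `u` to `-u`, and the reflection along the bisector `u + v`, which
is nonzero by `h`, takes `-u` to `v`. -/
theorem exists_rotor {u v : Fin m → ℝ} (hu : u ⬝ᵥ u = 1) (hv : v ⬝ᵥ v = 1) (h : v ≠ -u) :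
    ∃ t ∈ unitPairs m, (t : Cl m) * vec u * star (t : Cl m) = vec v ∧
      ∀ w, w ⬝ᵥ u = 0 → w ⬝ᵥ v = 0 → (t : Cl m) * vec w * star (t : Cl m) = vec w := by
  have huv : (u + v) ⬝ᵥ (u + v) = 2 * (1 + u ⬝ᵥ v) := by
    rw [add_dotProduct, dotProduct_add, dotProduct_add, hu, hv, dotProduct_comm v u]; ring
  have hpos : 0 < 2 * (1 + u ⬝ᵥ v) := by
    rw [← huv]
    have h0 : 0 ≤ (u + v) ⬝ᵥ (u + v) := Finset.sum_nonneg fun i _ => mul_self_nonneg ((u + v) i)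
    refine lt_of_le_of_ne h0 fun h0 => h ?_
    exact (neg_eq_of_add_eq_zero_right (dotProduct_self_eq_zero.1 h0.symm)).symm
  set s := Real.sqrt (2 * (1 + u ⬝ᵥ v)) with hs
  have hss : s * s = 2 * (1 + u ⬝ᵥ v) := Real.mul_self_sqrt hpos.le
  have hs0 : s ≠ 0 := (Real.sqrt_pos.2 hpos).ne'
  have hn : (s⁻¹ • (u + v)) ⬝ᵥ (s⁻¹ • (u + v)) = 1 := by
    rw [smul_dotProduct, dotProduct_smul, huv, ← hss]
    simp only [smul_eq_mul]
    field_simp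
  refine ⟨unitPair _ u hn hu, Subgroup.subset_closure ⟨_, _, _, _, rfl⟩, ?_, fun w hwu hwv => ?_⟩
  · rw [unitPair_conj]
    congr 1
    have h1 : u - (2 * (u ⬝ᵥ u)) • u = -u := by rw [hu]; module
    rw [h1, neg_dotProduct, dotProduct_smul, dotProduct_add, hu, smul_eq_mul, smul_smul]
    rw [show 2 * -(s⁻¹ * (1 + u ⬝ᵥ v)) * s⁻¹ = -1 by
      field_simp
      linarith]
    module
  · rw [unitPair_conj]
    congr 1
    rw [hwu]
    simp [dotProduct_add, hwu, hwv]

/-- This is the half turn in the plane of `u` and a spare direction `c`. It replaces `exists_rotor`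
when the bisector vanishes. -/
theorem exists_rotor_neg {u c : Fin m → ℝ} (hu : u ⬝ᵥ u = 1) (hc : c ⬝ᵥ c = 1)
    (h : u ⬝ᵥ c = 0) :
    ∃ t ∈ unitPairs m, (t : Cl m) * vec u * star (t : Cl m) = vec (-u) ∧
      ∀ w, w ⬝ᵥ u = 0 → w ⬝ᵥ c = 0 → (t : Cl m) * vec w * star (t : Cl m) = vec w := by
  refine ⟨unitPair u c hu hc, Subgroup.subset_closure ⟨_, _, _, _, rfl⟩, ?_, fun w hwu hwc => ?_⟩
  · rw [unitPair_conj]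
    congr 1
    rw [h]
    simp only [mul_zero, zero_smul, sub_zero, hu]
    module
  · rw [unitPair_conj]
    congr 1
    rw [hwc]
    simp [hwu]

theorem SO.mulVec_dotProduct (R : SO m) (v w : Fin m → ℝ) :
    ((R : Matrix (Fin m) (Fin m) ℝ) *ᵥ v) ⬝ᵥ ((R : Matrix (Fin m) (Fin m) ℝ) *ᵥ w) = v ⬝ᵥ w := by
  have h := (Matrix.mem_orthogonalGroup_iff' (Fin m) ℝ).1
    (Matrix.mem_specialOrthogonalGroup_iff.1 R.2).1
  rw [Matrix.dotProduct_mulVec, ← Matrix.mulVec_transpose, Matrix.mulVec_mulVec, h,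
    Matrix.one_mulVec]

theorem SO.det_eq (R : SO m) : (R : Matrix (Fin m) (Fin m) ℝ).det = 1 :=
  (Matrix.mem_specialOrthogonalGroup_iff.1 R.2).2

theorem SO.transpose_mul (R : SO m) :
    (R : Matrix (Fin m) (Fin m) ℝ)ᵀ * (R : Matrix (Fin m) (Fin m) ℝ) = 1 :=
  (Matrix.mem_orthogonalGroup_iff' (Fin m) ℝ).1 (Matrix.mem_specialOrthogonalGroup_iff.1 R.2).1

theorem SO.adjugate_eq (R : SO m) :
    (R : Matrix (Fin m) (Fin m) ℝ).adjugate = (R : Matrix (Fin m) (Fin m) ℝ)ᵀ := by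
  have h1 := Matrix.mul_adjugate (R : Matrix (Fin m) (Fin m) ℝ)
  rw [SO.det_eq, one_smul] at h1
  calc _ = ((R : Matrix (Fin m) (Fin m) ℝ)ᵀ * (R : Matrix (Fin m) (Fin m) ℝ)) *
      (R : Matrix (Fin m) (Fin m) ℝ).adjugate := by rw [SO.transpose_mul, one_mul]
    _ = _ := by rw [mul_assoc, h1, mul_one]

/-- A rotation is determined by all but one of its columns. -/
theorem SO.ext_of_columns {R R' : SO m} (j : Fin m)
    (h : ∀ i, i ≠ j → (R : Matrix (Fin m) (Fin m) ℝ) *ᵥ stdVec m i =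
      (R' : Matrix (Fin m) (Fin m) ℝ) *ᵥ stdVec m i) : R = R' := by
  have hcol : ∀ i l, i ≠ j →
      (R : Matrix (Fin m) (Fin m) ℝ) l i = (R' : Matrix (Fin m) (Fin m) ℝ) l i := by
    intro i l hi
    simpa [stdVec] using congrFun (h i hi) l
  refine Subtype.ext (Matrix.ext fun l i => ?_)
  by_cases hi : i = j
  · subst hi
    -- For a rotation the adjugate is the transpose, so an entry is its own cofactor, which involves
    -- only the other columns.
    have h1 : ∀ Q : SO m, (Q : Matrix (Fin m) (Fin m) ℝ) l i =
        ((Q : Matrix (Fin m) (Fin m) ℝ)ᵀ.updateRow i (Pi.single l 1)).det := by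
      intro Q
      rw [← Matrix.adjugate_apply, ← Matrix.adjugate_transpose, SO.adjugate_eq,
        Matrix.transpose_transpose]
    rw [h1, h1]
    congr 1
    ext a b
    by_cases ha : a = i
    · subst ha; simp
    · simp [Matrix.updateRow_ne ha, hcol a b ha]
  · exact hcol i l hi

/-- Induction on the number of matched columns. The next rotor moves one vector orthogonal to the
matched columns to another, hence fixes those columns. -/
theorem exists_unitPairs_columns (A : SO m) (j : ℕ) (hj : j < m) :
    ∃ t ∈ unitPairs m, ∀ i : Fin m, (i : ℕ) < j →
      (t : Cl m) * vec (stdVec m i) * star (t : Cl m) =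
        vec ((A : Matrix (Fin m) (Fin m) ℝ) *ᵥ stdVec m i) := by
  induction j with
  | zero => exact ⟨1, one_mem _, fun i hi => absurd hi (Nat.not_lt_zero _)⟩
  | succ j ih =>
    obtain ⟨t, ht, htA⟩ := ih (by omega)
    obtain ⟨R, hR⟩ := exists_covers t
    set j' : Fin m := ⟨j, by omega⟩ with hj'
    set u := (R : Matrix (Fin m) (Fin m) ℝ) *ᵥ stdVec m j' with hu
    set v := (A : Matrix (Fin m) (Fin m) ℝ) *ᵥ stdVec m j' with hv
    have hu1 : u ⬝ᵥ u = 1 := by rw [hu, SO.mulVec_dotProduct, stdVec_unit]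
    have hv1 : v ⬝ᵥ v = 1 := by rw [hv, SO.mulVec_dotProduct, stdVec_unit]
    have hRA : ∀ i : Fin m, (i : ℕ) < j → (R : Matrix (Fin m) (Fin m) ℝ) *ᵥ stdVec m i =
        (A : Matrix (Fin m) (Fin m) ℝ) *ᵥ stdVec m i := fun i hi =>
      vec_injective ((hR.conj _).symm.trans (htA i hi))
    have hne : ∀ i : Fin m, (i : ℕ) < j → i ≠ j' := by
      rintro i hi rfl
      exact lt_irrefl _ hi
    have hAu : ∀ i : Fin m, (i : ℕ) < j →
        ((A : Matrix (Fin m) (Fin m) ℝ) *ᵥ stdVec m i) ⬝ᵥ u = 0 := fun i hi => by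
      rw [← hRA i hi, hu, SO.mulVec_dotProduct, stdVec_orthogonal (hne i hi)]
    have hAv : ∀ i : Fin m, (i : ℕ) < j →
        ((A : Matrix (Fin m) (Fin m) ℝ) *ᵥ stdVec m i) ⬝ᵥ v = 0 := fun i hi => by
      rw [hv, SO.mulVec_dotProduct, stdVec_orthogonal (hne i hi)]
    have key : ∃ s ∈ unitPairs m, (s : Cl m) * vec u * star (s : Cl m) = vec v ∧
        ∀ i : Fin m, (i : ℕ) < j →
          (s : Cl m) * vec ((A : Matrix (Fin m) (Fin m) ℝ) *ᵥ stdVec m i) * star (s : Cl m) =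
            vec ((A : Matrix (Fin m) (Fin m) ℝ) *ᵥ stdVec m i) := by
      by_cases hvu : v = -u
      -- The spare direction of the half turn is the next column of `A`; this is why at least one
      -- column stays unmatched.
      · set l : Fin m := ⟨j + 1, hj⟩ with hl
        have hjl : j' ≠ l := by simp [hj', hl]
        have hc1 : ((A : Matrix (Fin m) (Fin m) ℝ) *ᵥ stdVec m l) ⬝ᵥ
            ((A : Matrix (Fin m) (Fin m) ℝ) *ᵥ stdVec m l) = 1 := by
          rw [SO.mulVec_dotProduct, stdVec_unit]
        have huc : u ⬝ᵥ ((A : Matrix (Fin m) (Fin m) ℝ) *ᵥ stdVec m l) = 0 := by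
          rw [← neg_neg u, ← hvu, neg_dotProduct, hv, SO.mulVec_dotProduct, stdVec_orthogonal hjl,
            neg_zero]
        obtain ⟨s, hs, h1, h2⟩ := exists_rotor_neg hu1 hc1 huc
        refine ⟨s, hs, by rw [h1, hvu], fun i hi => h2 _ (hAu i hi) ?_⟩
        rw [SO.mulVec_dotProduct, stdVec_orthogonal]
        rintro rfl
        simp only [hl] at hi
        omega
      · obtain ⟨s, hs, h1, h2⟩ := exists_rotor hu1 hv1 hvu
        exact ⟨s, hs, h1, fun i hi => h2 _ (hAu i hi) (hAv i hi)⟩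
    obtain ⟨s, hs, h1, h2⟩ := key
    refine ⟨s * t, mul_mem hs ht, fun i hi => ?_⟩
    have hst : ((s * t : Spin m) : Cl m) * vec (stdVec m i) * star ((s * t : Spin m) : Cl m) =
        (s : Cl m) * ((t : Cl m) * vec (stdVec m i) * star (t : Cl m)) * star (s : Cl m) := by
      simp [mul_assoc]
    rw [hst]
    rcases Nat.lt_succ_iff_lt_or_eq.1 hi with hi | hi
    · rw [htA i hi, h2 i hi]
    · obtain rfl : i = j' := Fin.ext hi
      rw [hR.conj, ← hu, h1, hv]

/-- Every rotation is covered by a product of unit vectors. -/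
theorem exists_unitPairs_covers (A : SO m) : ∃ t ∈ unitPairs m, Covers t A := by
  rcases Nat.eq_zero_or_pos m with rfl | hm
  · exact ⟨1, one_mem _, fun v => by simp [Subsingleton.elim v 0]⟩
  · obtain ⟨t, ht, htA⟩ := exists_unitPairs_columns A (m - 1) (by omega)
    obtain ⟨R, hR⟩ := exists_covers t
    refine ⟨t, ht, ?_⟩
    rwa [← SO.ext_of_columns (R := R) (R' := A) ⟨m - 1, by omega⟩ fun i hi => ?_]
    refine vec_injective ((hR.conj _).symm.trans (htA i ?_))
    have := i.2
    rw [ne_eq, Fin.ext_iff] at hi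
    simp only at hi
    omega

end Rotations

/-! ### The stabilizer of the base point as a product of two spin groups -/

section Stabilizer

variable {a b m : ℕ}

theorem coordEmbedding_apply (τ : Fin a ↪ Fin m) (v : Fin a → ℝ) (i : Fin a) :
    coordEmbedding τ v (τ i) = v i :=
  τ.injective.extend_apply v (0 : Fin m → ℝ) i

theorem coordEmbedding_apply_of_notMem (τ : Fin a ↪ Fin m) (v : Fin a → ℝ) {l : Fin m}
    (hl : ∀ i, τ i ≠ l) : coordEmbedding τ v l = 0 :=
  Function.extend_apply' v (0 : Fin m → ℝ) l fun ⟨i, hi⟩ => hl i hi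

theorem coordEmbedding_dotProduct_right (τ : Fin a ↪ Fin m) (v : Fin a → ℝ) (w : Fin m → ℝ) :
    coordEmbedding τ v ⬝ᵥ w = ∑ i, v i * w (τ i) := by
  rw [dotProduct, ← Finset.sum_subset (Finset.subset_univ (Finset.univ.map τ)), Finset.sum_map]
  · simp [coordEmbedding_apply]
  · intro l _ hl
    have h0 : ∀ i, τ i ≠ l := by
      rintro i rfl
      exact hl (Finset.mem_map_of_mem τ (Finset.mem_univ i))
    rw [coordEmbedding_apply_of_notMem τ v h0, zero_mul]

theorem coordEmbedding_dotProduct (τ : Fin a ↪ Fin m) (v w : Fin a → ℝ) :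
    coordEmbedding τ v ⬝ᵥ coordEmbedding τ w = v ⬝ᵥ w := by
  rw [coordEmbedding_dotProduct_right]
  simp [coordEmbedding_apply, dotProduct]

theorem coordEmbedding_stdVec (τ : Fin a ↪ Fin m) (i : Fin a) :
    coordEmbedding τ (stdVec a i) = stdVec m (τ i) := by
  funext l
  by_cases hl : ∃ j, τ j = l
  · obtain ⟨j, rfl⟩ := hl
    rw [coordEmbedding_apply]
    simp [stdVec, Pi.single_apply]
  · push Not at hl
    rw [coordEmbedding_apply_of_notMem τ _ hl]
    simp [stdVec, (hl i).symm]

theorem map_coordEmbedding_vec (τ : Fin a ↪ Fin m) (v : Fin a → ℝ) :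
    CliffordAlgebra.map (coordEmbedding τ) (vec v) = vec (coordEmbedding τ v) :=
  CliffordAlgebra.map_apply_ι _ v

/-- The subgroup generated by products of two unit vectors in a coordinate subspace. -/
def coordUnitPairs (τ : Fin a ↪ Fin m) : Subgroup (Spin m) :=
  Subgroup.closure {g | ∃ u v : Fin a → ℝ, u ⬝ᵥ u = 1 ∧ v ⬝ᵥ v = 1 ∧
    (g : Cl m) = vec (coordEmbedding τ u) * vec (coordEmbedding τ v)}

theorem exists_mem_coordUnitPairs (τ : Fin a ↪ Fin m) {t : Spin a} (ht : t ∈ unitPairs a) :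
    ∃ g ∈ coordUnitPairs τ, (g : Cl m) = CliffordAlgebra.map (coordEmbedding τ) (t : Cl a) := by
  induction ht using Subgroup.closure_induction with
  | mem t ht =>
    obtain ⟨u, v, hu, hv, rfl⟩ := ht
    refine ⟨unitPair (coordEmbedding τ u) (coordEmbedding τ v)
      (by rw [coordEmbedding_dotProduct, hu]) (by rw [coordEmbedding_dotProduct, hv]),
      Subgroup.subset_closure ⟨u, v, hu, hv, rfl⟩, ?_⟩
    simp only [unitPair]
    rw [map_mul, map_coordEmbedding_vec, map_coordEmbedding_vec]
  | one => exact ⟨1, one_mem _, by simp⟩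
  | mul s t _ _ hs ht =>
    obtain ⟨g, hg, hgs⟩ := hs
    obtain ⟨h, hh, hht⟩ := ht
    exact ⟨g * h, mul_mem hg hh, by simp [hgs, hht]⟩
  | inv s _ hs =>
    obtain ⟨g, hg, hgs⟩ := hs
    exact ⟨g⁻¹, inv_mem hg, by rw [Spin.coe_inv, hgs, Spin.coe_inv, map_star]⟩

theorem coordUnitPairs_le (τ : Fin a ↪ Fin m) : coordUnitPairs τ ≤ spinSubgroup τ := by
  rw [coordUnitPairs, Subgroup.closure_le]
  rintro g ⟨u, v, hu, hv, hg⟩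
  exact ⟨unitPair u v hu hv, by
    rw [hg, ← map_coordEmbedding_vec, ← map_coordEmbedding_vec, ← map_mul]; rfl⟩

theorem commute_map_of_orthogonal (τ : Fin a ↪ Fin m) {w : Fin m → ℝ} (hw : ∀ i, w (τ i) = 0)
    (t : Spin a) : Commute (CliffordAlgebra.map (coordEmbedding τ) (t : Cl a)) (vec w) := by
  refine commute_of_mem_even (CliffordAlgebra.map (coordEmbedding τ)) (c := -1) (by norm_num)
    (fun v => ?_) (Spin.mem_even t)
  rw [map_coordEmbedding_vec, vec_mul_vec_of_orthogonal]
  · simp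
  · rw [coordEmbedding_dotProduct_right]
    simp [hw]

/-- A rotation of a coordinate subspace is covered by a product of unit vectors of this subspace,
which fixes the orthogonal complement. -/
theorem exists_coordUnitPairs_conj (τ : Fin a ↪ Fin m) (A : SO a) :
    ∃ g ∈ coordUnitPairs τ,
      (∀ v, (g : Cl m) * vec (coordEmbedding τ v) * star (g : Cl m) =
        vec (coordEmbedding τ ((A : Matrix (Fin a) (Fin a) ℝ) *ᵥ v))) ∧
      ∀ w : Fin m → ℝ, (∀ i, w (τ i) = 0) → (g : Cl m) * vec w * star (g : Cl m) = vec w := by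
  obtain ⟨t, ht, htA⟩ := exists_unitPairs_covers A
  obtain ⟨g, hg, hgt⟩ := exists_mem_coordUnitPairs τ ht
  refine ⟨g, hg, fun v => ?_, fun w hw => ?_⟩
  · rw [← map_coordEmbedding_vec, ← map_coordEmbedding_vec, ← htA.conj, hgt, ← map_star, map_mul,
      map_mul]
  · have h1 : Commute (g : Cl m) (vec w) := by
      rw [hgt]
      exact commute_map_of_orthogonal τ hw t
    rw [h1.eq, mul_assoc, Spin.mul_star, mul_one]

/-- The embedding of the first block of coordinates. -/
abbrev embL (σ : Fin a ⊕ Fin b ≃ Fin m) : Fin a ↪ Fin m :=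
  Function.Embedding.inl.trans σ.toEmbedding

/-- The embedding of the second block of coordinates. -/
abbrev embR (σ : Fin a ⊕ Fin b ≃ Fin m) : Fin b ↪ Fin m :=
  Function.Embedding.inr.trans σ.toEmbedding

theorem embL_ne_embR (σ : Fin a ⊕ Fin b ≃ Fin m) (i : Fin a) (j : Fin b) :
    embL σ i ≠ embR σ j := fun h => Sum.inl_ne_inr (σ.injective h)

theorem forall_fin_of_split (σ : Fin a ⊕ Fin b ≃ Fin m) {P : Fin m → Prop}
    (hl : ∀ i, P (embL σ i)) (hr : ∀ j, P (embR σ j)) (l : Fin m) : P l := by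
  obtain ⟨s, rfl⟩ := σ.surjective l
  rcases s with i | j
  exacts [hl i, hr j]

theorem eq_coordEmbedding_add (σ : Fin a ⊕ Fin b ≃ Fin m) (v : Fin m → ℝ) :
    v = coordEmbedding (embL σ) (v ∘ embL σ) + coordEmbedding (embR σ) (v ∘ embR σ) := by
  funext l
  revert l
  refine forall_fin_of_split σ (fun i => ?_) fun j => ?_
  · rw [Pi.add_apply, coordEmbedding_apply, coordEmbedding_apply_of_notMem]
    · simp
    · exact fun j => (embL_ne_embR σ i j).symm
  · rw [Pi.add_apply, coordEmbedding_apply, coordEmbedding_apply_of_notMem]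
    · simp
    · exact fun i => embL_ne_embR σ i j

theorem blockDiag_mulVec (σ : Fin a ⊕ Fin b ≃ Fin m) (A : Matrix (Fin a) (Fin a) ℝ)
    (B : Matrix (Fin b) (Fin b) ℝ) (v : Fin m → ℝ) :
    blockDiag σ A B *ᵥ v = coordEmbedding (embL σ) (A *ᵥ (v ∘ embL σ)) +
      coordEmbedding (embR σ) (B *ᵥ (v ∘ embR σ)) := by
  have h1 : blockDiag σ A B *ᵥ v =
      (Matrix.fromBlocks A 0 0 B *ᵥ (v ∘ σ)) ∘ σ.symm := by
    rw [blockDiag, Matrix.submatrix_mulVec_equiv]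
    rfl
  rw [h1, Matrix.fromBlocks_mulVec]
  funext l
  revert l
  refine forall_fin_of_split σ (fun i => ?_) fun j => ?_
  · rw [Pi.add_apply, coordEmbedding_apply, coordEmbedding_apply_of_notMem]
    · simp [embL, Function.comp_def]
    · exact fun j => (embL_ne_embR σ i j).symm
  · rw [Pi.add_apply, coordEmbedding_apply, coordEmbedding_apply_of_notMem]
    · simp [embR, Function.comp_def]
    · exact fun i => embL_ne_embR σ i j

theorem det_blockDiag (σ : Fin a ⊕ Fin b ≃ Fin m) (A : Matrix (Fin a) (Fin a) ℝ)
    (B : Matrix (Fin b) (Fin b) ℝ) : (blockDiag σ A B).det = A.det * B.det := by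
  rw [blockDiag, Matrix.det_submatrix_equiv_self, Matrix.det_fromBlocks_zero₂₁]

theorem eq_blockDiag (σ : Fin a ⊕ Fin b ≃ Fin m) (R : Matrix (Fin m) (Fin m) ℝ)
    (h1 : ∀ i j, R (embR σ j) (embL σ i) = 0) (h2 : ∀ i j, R (embL σ i) (embR σ j) = 0) :
    R = blockDiag σ (R.submatrix (embL σ) (embL σ)) (R.submatrix (embR σ) (embR σ)) := by
  ext l l'
  revert l l'
  refine forall_fin_of_split σ (fun i => forall_fin_of_split σ (fun i' => ?_) fun j' => ?_)
    fun j => forall_fin_of_split σ (fun i' => ?_) fun j' => ?_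
  · simp [blockDiag]
  · rw [h2]; simp [blockDiag]
  · rw [h1]; simp [blockDiag]
  · simp [blockDiag]

theorem blockDiag_injective (σ : Fin a ⊕ Fin b ≃ Fin m) {A A' : Matrix (Fin a) (Fin a) ℝ}
    {B B' : Matrix (Fin b) (Fin b) ℝ} (h : blockDiag σ A B = blockDiag σ A' B') :
    A = A' ∧ B = B' := by
  have h1 : Matrix.fromBlocks A 0 0 B = Matrix.fromBlocks A' 0 0 B' := by
    ext s s'
    simpa [blockDiag] using congrFun (congrFun h (σ s)) (σ s')
  obtain ⟨h2, _, _, h3⟩ := Matrix.fromBlocks_inj.1 h1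
  exact ⟨h2, h3⟩

/-- A rotation that preserves the first block of coordinates is block diagonal. -/
theorem exists_blockDiag_of_SO (σ : Fin a ⊕ Fin b ≃ Fin m) (R : SO m)
    (h1 : ∀ i j, (R : Matrix (Fin m) (Fin m) ℝ) (embR σ j) (embL σ i) = 0)
    (h2 : ∀ i j, (R : Matrix (Fin m) (Fin m) ℝ) (embL σ i) (embR σ j) = 0) :
    ∃ A ∈ Matrix.orthogonalGroup (Fin a) ℝ, ∃ B ∈ Matrix.orthogonalGroup (Fin b) ℝ,
      (R : Matrix (Fin m) (Fin m) ℝ) = blockDiag σ A B := by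
  have h := eq_blockDiag σ _ h1 h2
  set A := (R : Matrix (Fin m) (Fin m) ℝ).submatrix (embL σ) (embL σ)
  set B := (R : Matrix (Fin m) (Fin m) ℝ).submatrix (embR σ) (embR σ)
  have h3 : blockDiag σ (star A * A) (star B * B) = blockDiag σ 1 1 := by
    rw [blockDiag_mul, blockDiag_star, ← h, blockDiag_one]
    exact SO.transpose_mul R
  obtain ⟨hA, hB⟩ := blockDiag_injective σ h3
  exact ⟨A, (Matrix.mem_orthogonalGroup_iff' _ _).2 hA, B,
    (Matrix.mem_orthogonalGroup_iff' _ _).2 hB, h⟩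

/-! ### The base point -/

/-- The standard frame of the first block of coordinates. -/
def baseFrame (σ : Fin a ⊕ Fin b ≃ Fin m) (i : Fin a) : Fin m → ℝ := stdVec m (embL σ i)

theorem baseFrame_orthogonal (σ : Fin a ⊕ Fin b ≃ Fin m) (i j : Fin a) (h : i ≠ j) :
    baseFrame σ i ⬝ᵥ baseFrame σ j = 0 :=
  stdVec_orthogonal fun hij => h ((embL σ).injective hij)

/-- The alternating form which is the minor of the coordinates `p`. -/
def minorForm (p : Fin a → Fin m) : (Fin m → ℝ) [⋀^Fin a]→ₗ[ℝ] ℝ :=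
  Matrix.detRowAlternating.compLinearMap (LinearMap.funLeft ℝ ℝ p)

theorem minorForm_apply (p : Fin a → Fin m) (v : Fin a → Fin m → ℝ) :
    minorForm p v = (Matrix.of fun i j => v i (p j)).det := rfl

theorem minorForm_baseFrame (σ : Fin a ⊕ Fin b ≃ Fin m) :
    minorForm (embL σ) (baseFrame σ) = 1 := by
  rw [minorForm_apply, ← Matrix.det_one (n := Fin a) (R := ℝ)]
  congr 1
  ext i j
  simp [baseFrame, stdVec, Matrix.one_apply, Pi.single_apply, eq_comm]

variable (σ : Fin a ⊕ Fin b ≃ Fin m) (ha : Even a) {c : ℝ} (hc : c * c = 1) {x : Spin m}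
  (hx : (x : Cl m) = c • vecProd (baseFrame σ))

include hx in
-- This Plücker coordinate distinguishes `x` from `-x`, and it is the denominator of the chart at
-- `x`.
theorem baseFunctional_apply : wedgeFunctional (minorForm (embL σ)) (x : Cl m) = c := by
  rw [hx, map_smul, vecProd, ← wedge_of_orthogonal _ (baseFrame_orthogonal σ),
    wedgeFunctional_wedge, minorForm_baseFrame, smul_eq_mul, mul_one]

include ha hx in
-- A basis vector of the first block changes sign at the `a - 1` other factors, an odd number.
theorem vec_mul_base_left (v : Fin a → ℝ) :
    vec (coordEmbedding (embL σ) v) * (x : Cl m) =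
      -((x : Cl m) * vec (coordEmbedding (embL σ) v)) := by
  have h1 : coordEmbedding (embL σ) v = ∑ i, v i • baseFrame σ i := by
    conv_lhs => rw [pi_eq_sum_univ' v]
    rw [map_sum]
    refine Finset.sum_congr rfl fun i _ => ?_
    rw [map_smul, baseFrame, ← coordEmbedding_stdVec]
  rw [h1, map_sum, Finset.sum_mul, Finset.mul_sum, ← Finset.sum_neg_distrib]
  refine Finset.sum_congr rfl fun i _ => ?_
  have hodd : Odd (a - 1) := by
    have := i.2
    exact Nat.Even.sub_odd (by omega) ha odd_one
  rw [hx, map_smul, smul_mul_assoc, mul_smul_comm,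
    vec_mul_vecProd_of_mem (baseFrame_orthogonal σ), hodd.neg_one_pow]
  simp

include ha hx in
-- A vector of the second block changes sign at all `a` factors, an even number.
theorem vec_mul_base_right (v : Fin b → ℝ) :
    Commute (vec (coordEmbedding (embR σ) v)) (x : Cl m) := by
  change _ * _ = _ * _
  rw [hx, mul_smul_comm, vec_mul_vecProd_of_orthogonal, ha.neg_one_pow, one_smul, smul_mul_assoc]
  intro i
  rw [coordEmbedding_dotProduct_right, baseFrame]
  refine Finset.sum_eq_zero fun j _ => ?_
  simp [stdVec]

include ha hx in
-- The second component of `v` both commutes and anticommutes with the invertible element `x`.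
theorem eq_zero_of_anticommute_base {v : Fin m → ℝ} (h : vec v * (x : Cl m) = -((x : Cl m) * vec v))
    (j : Fin b) : v (embR σ j) = 0 := by
  rw [eq_coordEmbedding_add σ v, map_add, add_mul, vec_mul_base_left σ ha hx,
    (vec_mul_base_right σ ha hx _).eq, mul_add, neg_add] at h
  have h1 : (2 : ℝ) • ((x : Cl m) * vec (coordEmbedding (embR σ) (v ∘ embR σ))) = 0 := by
    rw [two_smul]
    nth_rewrite 1 [add_left_cancel h]
    simp
  have h2 := (smul_eq_zero.1 h1).resolve_left two_ne_zero
  have h3 : vec (coordEmbedding (embR σ) (v ∘ embR σ)) = 0 := by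
    rw [← one_mul (vec _), ← Spin.star_mul x, mul_assoc, h2, mul_zero]
  have h4 := vec_injective (h3.trans (map_zero _).symm)
  have h5 := coordEmbedding_apply (embR σ) (v ∘ embR σ) j
  rw [h4] at h5
  exact h5.symm

include ha hx in
theorem eq_zero_of_commute_base {v : Fin m → ℝ} (h : vec v * (x : Cl m) = (x : Cl m) * vec v)
    (i : Fin a) : v (embL σ i) = 0 := by
  rw [eq_coordEmbedding_add σ v, map_add, add_mul, vec_mul_base_left σ ha hx,
    (vec_mul_base_right σ ha hx _).eq, mul_add] at h
  have h1 : (2 : ℝ) • ((x : Cl m) * vec (coordEmbedding (embL σ) (v ∘ embL σ))) = 0 := by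
    rw [two_smul]
    nth_rewrite 1 [← add_right_cancel h]
    simp
  have h2 := (smul_eq_zero.1 h1).resolve_left two_ne_zero
  have h3 : vec (coordEmbedding (embL σ) (v ∘ embL σ)) = 0 := by
    rw [← one_mul (vec _), ← Spin.star_mul x, mul_assoc, h2, mul_zero]
  have h4 := vec_injective (h3.trans (map_zero _).symm)
  have h5 := coordEmbedding_apply (embL σ) (v ∘ embL σ) i
  rw [h4] at h5
  exact h5.symm

include hx in
theorem Covers.conj_base {g : Spin m} {R : SO m} (hg : Covers g R) :
    (g : Cl m) * x * star (g : Cl m) =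
      c • vecProd fun i => (R : Matrix (Fin m) (Fin m) ℝ) *ᵥ baseFrame σ i := by
  rw [hx, mul_smul_comm, smul_mul_assoc, Spin.conj_vecProd g fun i => hg.conj _]

include hx in
-- The Clifford product of the orthogonal vectors `R e_i` is their exterior product, and `R` acts on
-- the base frame by the matrix `A`.
theorem Covers.conj_base_of_blockDiag {g : Spin m} {R : SO m} (hg : Covers g R)
    {A : Matrix (Fin a) (Fin a) ℝ} {B : Matrix (Fin b) (Fin b) ℝ}
    (hR : (R : Matrix (Fin m) (Fin m) ℝ) = blockDiag σ A B) :
    (g : Cl m) * x * star (g : Cl m) = A.det • (x : Cl m) := by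
  have h1 : ∀ i, (R : Matrix (Fin m) (Fin m) ℝ) *ᵥ baseFrame σ i =
      ∑ j, Aᵀ i j • baseFrame σ j := by
    intro i
    have hL : baseFrame σ i ∘ embL σ = stdVec a i := by
      funext j
      simp [baseFrame, stdVec, Pi.single_apply]
    have hR' : baseFrame σ i ∘ embR σ = 0 := by
      funext j
      simp [baseFrame, stdVec]
    rw [hR, blockDiag_mulVec, hL, hR', Matrix.mulVec_zero, map_zero, add_zero,
      mulVec_eq_sum_stdVec, map_sum]
    simp only [map_smul, coordEmbedding_stdVec, Matrix.transpose_apply]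
    rfl
  rw [hg.conj_base σ hx, hx, smul_comm, vecProd, vecProd,
    ← wedge_of_orthogonal _ (baseFrame_orthogonal σ), ← wedge_of_orthogonal]
  · simp only [h1]
    rw [map_sum_smul_eq_det_smul, Matrix.det_transpose]
  · intro i j hij
    rw [SO.mulVec_dotProduct, baseFrame_orthogonal σ i j hij]

theorem mem_centralizer_iff {g : Spin m} : g ∈ Subgroup.centralizer {x} ↔
    (g : Cl m) * x * star (g : Cl m) = x := by
  rw [Subgroup.mem_centralizer_singleton_iff]
  constructor
  · intro h
    have h1 : (g : Cl m) * x = x * g := congrArg Subtype.val h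
    rw [h1, mul_assoc, Spin.mul_star, mul_one]
  · intro h
    refine Subtype.ext ?_
    change (g : Cl m) * x = x * g
    conv_rhs => rw [← h]
    rw [mul_assoc, Spin.star_mul, mul_one]

include ha hx in
-- Conjugation by `g` fixes `x`, so it preserves the relations of anticommuting and commuting with
-- `x`, which characterize the two blocks. The scalar by which `x` is multiplied gives `det A = 1`,
-- and `det R = 1` gives the rest.
theorem exists_blockDiag_of_mem_centralizer {g : Spin m} (hg : g ∈ Subgroup.centralizer {x}) :
    ∃ (A : SO a) (B : SO b) (R : SO m), Covers g R ∧
      (R : Matrix (Fin m) (Fin m) ℝ) = blockDiag σ A B := by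
  obtain ⟨R, hR⟩ := exists_covers g
  have hgx := mem_centralizer_iff.1 hg
  have h1 : ∀ i j, (R : Matrix (Fin m) (Fin m) ℝ) (embR σ j) (embL σ i) = 0 := by
    intro i j
    have h := vec_mul_base_left σ ha hx (stdVec a i)
    have h' := congrArg (fun z => (g : Cl m) * z * star (g : Cl m)) h
    simp only [mul_neg, neg_mul] at h'
    rw [Spin.conj_mul, Spin.conj_mul, hgx, hR.conj, coordEmbedding_stdVec] at h'
    simpa [stdVec] using eq_zero_of_anticommute_base σ ha hx h' j
  have h2 : ∀ i j, (R : Matrix (Fin m) (Fin m) ℝ) (embL σ i) (embR σ j) = 0 := by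
    intro i j
    have h := (vec_mul_base_right σ ha hx (stdVec b j)).eq
    have h' := congrArg (fun z => (g : Cl m) * z * star (g : Cl m)) h
    beta_reduce at h'
    rw [Spin.conj_mul, Spin.conj_mul, hgx, hR.conj, coordEmbedding_stdVec] at h'
    simpa [stdVec] using eq_zero_of_commute_base σ ha hx h' i
  obtain ⟨A, hA, B, hB, hAB⟩ := exists_blockDiag_of_SO σ R h1 h2
  have h3 := hR.conj_base_of_blockDiag σ hx hAB
  rw [hgx] at h3
  have hx0 : (x : Cl m) ≠ 0 := fun h0 => by
    have := Spin.mul_star x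
    rw [h0, zero_mul] at this
    exact zero_ne_one this
  have hdA : A.det = 1 :=
    smul_left_injective ℝ hx0 (h3.symm.trans (one_smul ℝ (x : Cl m)).symm)
  have hdB : B.det = 1 := by
    have := SO.det_eq R
    rwa [hAB, det_blockDiag, hdA, one_mul] at this
  exact ⟨⟨A, Matrix.mem_specialOrthogonalGroup_iff.2 ⟨hA, hdA⟩⟩,
    ⟨B, Matrix.mem_specialOrthogonalGroup_iff.2 ⟨hB, hdB⟩⟩, R, hR, hAB⟩

include ha hx in
theorem spinSubgroup_embL_le : spinSubgroup (embL σ) ≤ Subgroup.centralizer {x} := by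
  rintro g ⟨h, hg⟩
  rw [Subgroup.mem_centralizer_singleton_iff]
  refine Subtype.ext ?_
  change (g : Cl m) * x = x * g
  rw [hg]
  refine (commute_of_mem_even (CliffordAlgebra.map (coordEmbedding (embL σ))) (c := -1)
    (by norm_num) (fun v => ?_) (Spin.mem_even h)).eq
  rw [map_coordEmbedding_vec, vec_mul_base_left σ ha hx]
  simp

include ha hx in
theorem spinSubgroup_embR_le : spinSubgroup (embR σ) ≤ Subgroup.centralizer {x} := by
  rintro g ⟨h, hg⟩
  rw [Subgroup.mem_centralizer_singleton_iff]
  refine Subtype.ext ?_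
  change (g : Cl m) * x = x * g
  rw [hg]
  refine (commute_of_mem_even (CliffordAlgebra.map (coordEmbedding (embR σ))) (c := 1)
    (by norm_num) (fun v => ?_) (Spin.mem_even h)).eq
  rw [map_coordEmbedding_vec, (vec_mul_base_right σ ha hx _).eq, one_smul]

/-- The element `-1` of the spin group as a product of unit vectors. -/
theorem exists_neg_one_mem_coordUnitPairs (τ : Fin a ↪ Fin m) (i : Fin a) :
    ∃ g ∈ coordUnitPairs τ, (g : Cl m) = -1 := by
  have h : coordEmbedding τ (stdVec a i) ⬝ᵥ coordEmbedding τ (stdVec a i) = 1 := by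
    rw [coordEmbedding_dotProduct, stdVec_unit]
  exact ⟨unitPair _ _ h h, Subgroup.subset_closure
    ⟨stdVec a i, stdVec a i, stdVec_unit i, stdVec_unit i, rfl⟩, vec_mul_self_of_unit h⟩

include ha hx in
-- The product of lifts of `A` and `B` covers the same rotation as `g`, so it differs from `g` by
-- `±1`. The sign is absorbed by the first factor, which contains `-1 = e e` for any unit vector `e`
-- of its block; `i₀` supplies one.
theorem mem_coordUnitPairs_mul (i₀ : Fin a) {g : Spin m} (hg : g ∈ Subgroup.centralizer {x}) :
    ∃ s ∈ coordUnitPairs (embL σ), ∃ t ∈ coordUnitPairs (embR σ), g = s * t := by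
  obtain ⟨A, B, R, hR, hAB⟩ := exists_blockDiag_of_mem_centralizer σ ha hx hg
  obtain ⟨s, hs, hs1, hs2⟩ := exists_coordUnitPairs_conj (embL σ) A
  obtain ⟨t, ht, ht1, ht2⟩ := exists_coordUnitPairs_conj (embR σ) B
  have hst : Covers (s * t) R := by
    intro v
    change ((s * t : Spin m) : Cl m) * vec v * star ((s * t : Spin m) : Cl m) = vec _
    have h1 : ((s * t : Spin m) : Cl m) * vec v * star ((s * t : Spin m) : Cl m) =
        (s : Cl m) * ((t : Cl m) * vec v * star (t : Cl m)) * star (s : Cl m) := by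
      simp [mul_assoc]
    rw [h1, hAB, blockDiag_mulVec]
    nth_rewrite 1 [eq_coordEmbedding_add σ v]
    rw [map_add, mul_add, add_mul, ht1, ht2, mul_add, add_mul, hs1, hs2, map_add]
    · exact fun i => coordEmbedding_apply_of_notMem _ _ fun j => (embL_ne_embR σ i j).symm
    · exact fun j => coordEmbedding_apply_of_notMem _ _ fun i => embL_ne_embR σ i j
  have h1 : Covers (g * (s * t)⁻¹) 1 := by
    have := hR.mul hst.inv
    rwa [mul_inv_cancel] at this
  rcases eq_one_or_neg_one_of_covers_one h1 with h | h
  · exact ⟨s, hs, t, ht, mul_inv_eq_one.1 (Subtype.ext h)⟩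
  · obtain ⟨z, hz, hz1⟩ := exists_neg_one_mem_coordUnitPairs (embL σ) i₀
    refine ⟨z * s, mul_mem hz hs, t, ht, ?_⟩
    have h2 : g * (s * t)⁻¹ = z := Subtype.ext (h.trans hz1.symm)
    rw [mul_assoc, ← h2, inv_mul_cancel_right]

include ha hx in
theorem centralizer_eq_mul (i₀ : Fin a) : (Subgroup.centralizer {x} : Set (Spin m)) =
    (spinSubgroup (embL σ) : Set (Spin m)) * (spinSubgroup (embR σ) : Set (Spin m)) := by
  refine Set.Subset.antisymm (fun g hg => ?_) ?_
  · obtain ⟨s, hs, t, ht, rfl⟩ := mem_coordUnitPairs_mul σ ha hx i₀ hg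
    exact Set.mul_mem_mul (coordUnitPairs_le _ hs) (coordUnitPairs_le _ ht)
  · rintro _ ⟨s, hs, t, ht, rfl⟩
    exact mul_mem (spinSubgroup_embL_le σ ha hx hs) (spinSubgroup_embR_le σ ha hx ht)

include ha hx in
theorem centralizer_eq_sup (i₀ : Fin a) :
    Subgroup.centralizer {x} = spinSubgroup (embL σ) ⊔ spinSubgroup (embR σ) := by
  refine le_antisymm (fun g hg => ?_)
    (sup_le (spinSubgroup_embL_le σ ha hx) (spinSubgroup_embR_le σ ha hx))
  obtain ⟨s, hs, t, ht, rfl⟩ := mem_coordUnitPairs_mul σ ha hx i₀ hg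
  exact mul_mem (Subgroup.mem_sup_left (coordUnitPairs_le _ hs))
    (Subgroup.mem_sup_right (coordUnitPairs_le _ ht))

end Stabilizer

/-! ## The exponential of the vertex -/

section Exponential

variable {m : ℕ}

/-- The left regular representation is a continuous injection into a matrix algebra. -/
instance (m : ℕ) : T2Space (Cl m) := by
  let φ := Algebra.leftMulMatrix (Module.finBasis ℝ (Cl m))
  exact T2Space.of_injective_continuous (f := φ) (Algebra.leftMulMatrix_injective _)
    (IsModuleTopology.continuous_of_linearMap (R := ℝ) φ.toLinearMap)

section MatrixExp

open scoped Matrix.Norms.Operator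

/-- The series is summed in the normed algebra of matrices and brought back to `Cl m` by a linear
left inverse of the regular representation. -/
theorem map_exp_leftMulMatrix (x : Cl m) :
    Algebra.leftMulMatrix (Module.finBasis ℝ (Cl m)) (NormedSpace.exp x) =
      NormedSpace.exp (Algebra.leftMulMatrix (Module.finBasis ℝ (Cl m)) x) := by
  let φ := Algebra.leftMulMatrix (Module.finBasis ℝ (Cl m))
  have hφ : Function.Injective φ := Algebra.leftMulMatrix_injective _
  obtain ⟨ψ, hψ⟩ := LinearMap.exists_leftInverse_of_injective φ.toLinearMap
    (LinearMap.ker_eq_bot.2 hφ)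
  have hψφ : ∀ y, ψ (φ y) = y := fun y => LinearMap.congr_fun hψ y
  have hψc : Continuous ψ := LinearMap.continuous_of_finiteDimensional ψ
  have hφc : Continuous φ := IsModuleTopology.continuous_of_linearMap (R := ℝ) φ.toLinearMap
  have h1 := NormedSpace.exp_series_hasSum_exp' (𝕂 := ℝ) (φ x)
  have h2 : HasSum (fun n : ℕ => (n.factorial : ℝ)⁻¹ • x ^ n) (ψ (NormedSpace.exp (φ x))) := by
    have := h1.map ψ hψc
    refine this.congr_fun ?_ 
    intro n
    simp only [Function.comp_apply]
    rw [← map_pow, ← map_smul, hψφ]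
  have h3 : HasSum (fun n : ℕ => (n.factorial : ℝ)⁻¹ • φ x ^ n) (φ (ψ (NormedSpace.exp (φ x)))) := by
    have := h2.map φ hφc
    refine this.congr_fun ?_
    intro n
    simp only [Function.comp_apply]
    rw [map_smul, map_pow]
  rw [NormedSpace.exp_eq_tsum ℝ]
  simp only
  rw [h2.tsum_eq]
  exact h3.unique h1

/-- The matrix `J` defines an algebra map from `ℂ` with `i ↦ J`, and `exp (iπ/2) = i`. -/
theorem exp_half_pi_smul {N : ℕ} {J : Matrix (Fin N) (Fin N) ℝ} (hJ : J * J = -1) :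
    NormedSpace.exp ((Real.pi / 2) • J) = J := by
  let ρ : ℂ →ₐ[ℝ] Matrix (Fin N) (Fin N) ℝ := Complex.liftAux J hJ
  have hρc : Continuous ρ := LinearMap.continuous_of_finiteDimensional ρ.toLinearMap
  have h1 := NormedSpace.map_exp ρ hρc ((Real.pi / 2 : ℝ) • Complex.I)
  have h2 : ρ Complex.I = J := by simp [ρ, Complex.liftAux_apply]
  have h3 : NormedSpace.exp ((Real.pi / 2 : ℝ) • Complex.I) = Complex.I := by
    rw [← Complex.exp_eq_exp_ℂ, Complex.real_smul, Complex.exp_mul_I]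
    push_cast
    simp
  rw [h3, map_smul, h2] at h1
  exact h1.symm

theorem exp_sum_half_pi {N : ℕ} (J : ℕ → Matrix (Fin N) (Fin N) ℝ) (K : ℕ)
    (hJ : ∀ j < K, J j * J j = -1) (hc : ∀ i < K, ∀ j < K, Commute (J i) (J j)) :
    NormedSpace.exp (∑ j ∈ Finset.range K, (Real.pi / 2) • J j) =
      ((List.range K).map J).prod := by
  induction K with
  | zero => simp
  | succ K ih =>
    rw [Finset.sum_range_succ, Matrix.exp_add_of_commute, ih, exp_half_pi_smul,
      List.range_succ, List.map_append, List.prod_append]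
    · simp
    · exact hJ K (by omega)
    · exact fun j hj => hJ j (by omega)
    · exact fun i hi j hj => hc i (by omega) j (by omega)
    · refine Commute.sum_left _ _ _ fun j hj => ?_
      have := Finset.mem_range.1 hj
      exact ((hc j (by omega) K (by omega)).smul_left _).smul_right _

end MatrixExp

theorem exp_sum_half_pi_clifford (J : ℕ → Cl m) (K : ℕ)
    (hJ : ∀ j < K, J j * J j = -1) (hc : ∀ i < K, ∀ j < K, Commute (J i) (J j)) :
    NormedSpace.exp (∑ j ∈ Finset.range K, (Real.pi / 2) • J j) =
      ((List.range K).map J).prod := by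
  refine Algebra.leftMulMatrix_injective (Module.finBasis ℝ (Cl m)) ?_
  rw [map_exp_leftMulMatrix, map_sum, map_list_prod, List.map_map]
  simp only [map_smul]
  refine exp_sum_half_pi (fun j => Algebra.leftMulMatrix (Module.finBasis ℝ (Cl m)) (J j)) K
    (fun j hj => ?_) fun i hi j hj => (hc i hi j hj).map _
  rw [← map_mul, hJ j hj, map_neg, map_one]

theorem vec_mul_vec_mul_self {u v : Fin m → ℝ} (hu : u ⬝ᵥ u = 1) (hv : v ⬝ᵥ v = 1)
    (huv : u ⬝ᵥ v = 0) : vec u * vec v * (vec u * vec v) = -1 := by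
  calc vec u * vec v * (vec u * vec v) = vec u * (vec v * vec u) * vec v := by noncomm_ring
    _ = -((vec u * vec u) * (vec v * vec v)) := by
      rw [vec_mul_vec_of_orthogonal (by rwa [dotProduct_comm])]; noncomm_ring
    _ = -1 := by rw [vec_mul_self_of_unit hu, vec_mul_self_of_unit hv]; simp

theorem commute_vec_mul_vec {u v w : Fin m → ℝ} (hu : u ⬝ᵥ w = 0) (hv : v ⬝ᵥ w = 0) :
    Commute (vec u * vec v) (vec w) := by
  change _ * _ = _ * _
  calc vec u * vec v * vec w = vec u * (vec v * vec w) := mul_assoc _ _ _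
    _ = -(vec u * vec w) * vec v := by rw [vec_mul_vec_of_orthogonal hv]; noncomm_ring
    _ = vec w * (vec u * vec v) := by rw [vec_mul_vec_of_orthogonal hu]; noncomm_ring

/-- The vertex `v_k` exponentiates to `(-1)ᵏ e₁ ⋯ e₂ₖ`. -/
theorem exp_torusElement_vertex (n k : ℕ) (hkn : k ≤ n) :
    NormedSpace.exp (torusElement n fun j : Fin n => if (j : ℕ) < k then Real.pi else 0) =
      (-1 : ℝ) ^ k • vecProd (baseFrame (splitEquiv n k hkn)) := by
  -- Basis vectors indexed by natural numbers, with value `0` out of range, so that products can run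
  -- over `List.range`. Orthogonality survives for all indices, the unit norm only below `2 * n +
  -- 1`.
  let u : ℕ → Fin (2 * n + 1) → ℝ := fun l =>
    if h : l < 2 * n + 1 then stdVec (2 * n + 1) ⟨l, h⟩ else 0
  have hu : ∀ l (h : l < 2 * n + 1), u l = stdVec (2 * n + 1) ⟨l, h⟩ := fun l h => dif_pos h
  have hu0 : ∀ l, ¬ l < 2 * n + 1 → u l = 0 := fun l h => dif_neg h
  have hunit : ∀ l, l < 2 * n + 1 → u l ⬝ᵥ u l = 1 := fun l h => by rw [hu l h, stdVec_unit]
  have horth : ∀ l l', l ≠ l' → u l ⬝ᵥ u l' = 0 := by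
    intro l l' hll
    by_cases h : l < 2 * n + 1
    · by_cases h' : l' < 2 * n + 1
      · rw [hu l h, hu l' h', stdVec_orthogonal]
        simpa [Fin.ext_iff] using hll
      · rw [hu0 l' h', dotProduct_zero]
    · rw [hu0 l h, zero_dotProduct]
  -- The factor `1/2` of the torus basis turns the coordinate `π` into the angle `π / 2` for an
  -- element of square `-1`.
  let J : ℕ → Cl (2 * n + 1) := fun j => -(vec (u (2 * j)) * vec (u (2 * j + 1)))
  have hsum : torusElement n (fun j : Fin n => if (j : ℕ) < k then Real.pi else 0) =
      ∑ j ∈ Finset.range k, (Real.pi / 2) • J j := by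
    have h1 : ∀ j : Fin n, (if (j : ℕ) < k then Real.pi else 0) • torusBasis n j =
        (fun l : ℕ => if l < k then (Real.pi / 2) • J l else 0) j := by
      intro j
      have hj := j.2
      by_cases hjk : (j : ℕ) < k
      · simp only [hjk, if_true, torusBasis, e, J]
        rw [hu _ (by omega), hu _ (by omega), smul_smul, smul_neg, ← neg_smul]
        congr 1
        ring
      · simp [hjk]
    rw [torusElement, Finset.sum_congr rfl fun j _ => h1 j,
      Fin.sum_univ_eq_sum_range (fun l : ℕ => if l < k then (Real.pi / 2) • J l else 0) n,
      Finset.sum_ite, Finset.sum_const_zero, add_zero]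
    refine Finset.sum_congr ?_ fun _ _ => rfl
    ext l
    simp only [Finset.mem_filter, Finset.mem_range]
    omega
  rw [hsum, exp_sum_half_pi_clifford J k]
  · have h2 : ∀ K, ((List.range K).map J).prod =
        (-1 : ℝ) ^ K • ((List.range (2 * K)).map fun l => vec (u l)).prod := by
      intro K
      induction K with
      | zero => simp
      | succ K ih =>
        rw [List.range_succ, List.map_append, List.prod_append, ih,
          show 2 * (K + 1) = 2 * K + 1 + 1 by ring, List.range_succ, List.range_succ]
        simp only [List.map_append, List.prod_append, List.map_cons, List.map_nil, List.prod_cons,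
          List.prod_nil, mul_one, J]
        rw [pow_succ, mul_neg_one, neg_smul, smul_mul_assoc, mul_neg, smul_neg, mul_assoc]
    rw [h2]
    congr 2
    refine List.ext_getElem (by simp) fun i hi hi' => ?_
    simp only [List.length_map, List.length_range] at hi
    simp only [List.getElem_map, List.getElem_range, List.getElem_ofFn]
    rw [hu i (by omega)]
    rfl
  · intro j hj
    simp only [J, neg_mul_neg]
    exact vec_mul_vec_mul_self (hunit _ (by omega)) (hunit _ (by omega)) (horth _ _ (by omega))
  · intro i hi j hj
    by_cases hij : i = j
    · rw [hij]
    · exact ((commute_vec_mul_vec (horth _ _ (by omega)) (horth _ _ (by omega))).mul_right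
        (commute_vec_mul_vec (horth _ _ (by omega)) (horth _ _ (by omega)))).neg_left.neg_right

end Exponential

/-! ## Connectedness of the stabilizer -/

section Connected

variable {a b m : ℕ}

theorem continuous_vec : Continuous (vec (m := m)) := LinearMap.continuous_of_finiteDimensional _

theorem continuous_star_cl : Continuous (star : Cl m → Cl m) := by
  let L : Cl m →ₗ[ℝ] Cl m :=
    { toFun := star
      map_add' := star_add
      map_smul' := fun r x => star_smul r x }
  exact IsModuleTopology.continuous_of_linearMap (R := ℝ) L

theorem continuous_spin_conj (x : Cl m) :
    Continuous fun g : Spin m => (g : Cl m) * x * star (g : Cl m) :=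
  (continuous_subtype_val.mul continuous_const).mul (continuous_star_cl.comp continuous_subtype_val)

/-- The elements of `H` that are joined to `1` by a connected subset of `H`. -/
def connectedPart (H : Subgroup (Spin m)) : Subgroup (Spin m) where
  carrier := {g | ∃ D ⊆ (H : Set (Spin m)), IsPreconnected D ∧ 1 ∈ D ∧ g ∈ D}
  one_mem' := ⟨{1}, by simp, isPreconnected_singleton, rfl, rfl⟩
  mul_mem' := by
    rintro g h ⟨D, hD, hc, h1, hg⟩ ⟨D', hD', hc', h1', hh⟩
    refine ⟨(fun p : Spin m × Spin m => p.1 * p.2) '' (D ×ˢ D'), ?_,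
      (hc.prod hc').image _ continuous_mul.continuousOn, ⟨(1, 1), ⟨h1, h1'⟩, one_mul 1⟩,
      ⟨(g, h), ⟨hg, hh⟩, rfl⟩⟩
    rintro _ ⟨⟨p, q⟩, ⟨hp, hq⟩, rfl⟩
    exact mul_mem (hD hp) (hD' hq)
  inv_mem' := by
    rintro g ⟨D, hD, hc, h1, hg⟩
    have hinv : Continuous fun g : Spin m => g⁻¹ :=
      (continuous_star_cl.comp continuous_subtype_val).subtype_mk _
    refine ⟨(fun g => g⁻¹) '' D, ?_, hc.image _ hinv.continuousOn, ⟨1, h1, inv_one⟩,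
      ⟨g, hg, rfl⟩⟩
    rintro _ ⟨p, hp, rfl⟩
    exact inv_mem (hD hp)

/-- With `u` fixed, the products `u w` over the unit sphere form a connected set that contains `u v`
and `u (-u) = 1`. The sphere is connected because `2 ≤ a`. -/
theorem coordUnitPairs_le_connectedPart (τ : Fin a ↪ Fin m) (ha : 2 ≤ a) (H : Subgroup (Spin m))
    (hH : spinSubgroup τ ≤ H) : coordUnitPairs τ ≤ connectedPart H := by
  rw [coordUnitPairs, Subgroup.closure_le]
  rintro g ⟨u, v, hu, hv, hg⟩
  have hrank : 1 < Module.rank ℝ (EuclideanSpace ℝ (Fin a)) := by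
    rw [← Module.finrank_eq_rank, finrank_euclideanSpace_fin]
    exact_mod_cast ha
  have : PreconnectedSpace (Metric.sphere (0 : EuclideanSpace ℝ (Fin a)) 1) :=
    Subtype.preconnectedSpace (isConnected_sphere hrank 0 zero_le_one).isPreconnected
  have hsph : ∀ w : EuclideanSpace ℝ (Fin a),
      w ∈ Metric.sphere (0 : EuclideanSpace ℝ (Fin a)) 1 ↔ w.ofLp ⬝ᵥ w.ofLp = 1 := by
    intro w
    rw [mem_sphere_zero_iff_norm, EuclideanSpace.norm_eq, Real.sqrt_eq_one]
    simp [dotProduct, pow_two]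
  have hu' : coordEmbedding τ u ⬝ᵥ coordEmbedding τ u = 1 := by rw [coordEmbedding_dotProduct, hu]
  have hw' : ∀ w : Metric.sphere (0 : EuclideanSpace ℝ (Fin a)) 1,
      coordEmbedding τ w.1.ofLp ⬝ᵥ coordEmbedding τ w.1.ofLp = 1 := fun w => by
    rw [coordEmbedding_dotProduct, (hsph _).1 w.2]
  let F : Metric.sphere (0 : EuclideanSpace ℝ (Fin a)) 1 → Spin m := fun w =>
    unitPair (coordEmbedding τ u) (coordEmbedding τ w.1.ofLp) hu' (hw' w)
  have hF : Continuous F := by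
    refine Continuous.subtype_mk (continuous_const.mul (continuous_vec.comp ?_)) _
    have h1 : Continuous (coordEmbedding τ).toLinearMap :=
      LinearMap.continuous_of_finiteDimensional _
    exact h1.comp ((PiLp.continuous_ofLp 2 _).comp continuous_subtype_val)
  refine ⟨Set.range F, ?_, isPreconnected_range hF, ?_, ?_⟩
  · rintro _ ⟨w, rfl⟩
    refine hH ⟨unitPair u w.1.ofLp hu ((hsph _).1 w.2), ?_⟩
    change vec _ * vec _ = CliffordAlgebra.map (coordEmbedding τ) (vec _ * vec _)
    rw [map_mul, map_coordEmbedding_vec, map_coordEmbedding_vec]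
  · refine ⟨⟨WithLp.toLp 2 (-u), (hsph _).2 (by simpa using hu)⟩, Subtype.ext ?_⟩
    change vec (coordEmbedding τ u) * vec (coordEmbedding τ (-u)) = 1
    rw [map_neg, map_neg, mul_neg, vec_mul_self_of_unit hu', neg_neg]
  · refine ⟨⟨WithLp.toLp 2 v, (hsph _).2 hv⟩, Subtype.ext ?_⟩
    exact hg.symm

variable (σ : Fin a ⊕ Fin b ≃ Fin m) (ha : Even a) {c : ℝ} (hc : c * c = 1) {x : Spin m}
  (hx : (x : Cl m) = c • vecProd (baseFrame σ))

include ha hx in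
theorem centralizer_le_connectedPart (ha2 : 2 ≤ a) :
    Subgroup.centralizer {x} ≤ connectedPart (Subgroup.centralizer {x}) := by
  intro g hg
  have hL := coordUnitPairs_le_connectedPart (embL σ) ha2 _ (spinSubgroup_embL_le σ ha hx)
  obtain ⟨s, hs, t, ht, rfl⟩ := mem_coordUnitPairs_mul σ ha hx ⟨0, by omega⟩ hg
  refine mul_mem (hL hs) ?_
  by_cases hb : 2 ≤ b
  · exact coordUnitPairs_le_connectedPart (embR σ) hb _ (spinSubgroup_embR_le σ ha hx) ht
  -- In dimension at most one, the products of two unit vectors are `±1`, and `-1` is joined to `1`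
  -- through the first block.
  · obtain ⟨z, hz, hz1⟩ := exists_neg_one_mem_coordUnitPairs (embL σ) (⟨0, by omega⟩ : Fin a)
    have hR : coordUnitPairs (embR σ) ≤ connectedPart (Subgroup.centralizer {x}) := by
      rw [coordUnitPairs, Subgroup.closure_le]
      rintro g ⟨u, v, hu, hv, hgu⟩
      have hu' : coordEmbedding (embR σ) u ⬝ᵥ coordEmbedding (embR σ) u = 1 := by
        rw [coordEmbedding_dotProduct, hu]
      have huv : v = u ∨ v = -u := by
        obtain rfl | rfl : b = 0 ∨ b = 1 := by omega
        · exact Or.inl (Subsingleton.elim _ _)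
        · simp only [dotProduct, Fin.sum_univ_one] at hu hv
          rcases mul_self_eq_mul_self_iff.1 (hv.trans hu.symm) with h | h
          · exact Or.inl (funext fun i => by rw [Subsingleton.elim i 0, h])
          · exact Or.inr (funext fun i => by rw [Subsingleton.elim i 0, h]; rfl)
      rcases huv with rfl | rfl
      · have : g = z := Subtype.ext (by rw [hgu, hz1, vec_mul_self_of_unit hu'])
        rw [this]
        exact hL hz
      · have : g = 1 := Subtype.ext (by
          rw [hgu, map_neg, map_neg, mul_neg, vec_mul_self_of_unit hu', neg_neg]; rfl)
        rw [this]
        exact one_mem _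
    exact hR ht

include ha hc hx in
/-- The stabilizer is the identity component of the preimage of `S(O(a) × O(b))`. -/
theorem centralizer_eq_connectedComponentIn (ha2 : 2 ≤ a) :
    (Subgroup.centralizer {x} : Set (Spin m)) =
      connectedComponentIn (coverPreimage (SOO σ)) 1 := by
  have hsub : (Subgroup.centralizer {x} : Set (Spin m)) ⊆ coverPreimage (SOO σ) := by
    intro g hg
    obtain ⟨A, B, R, hR, hAB⟩ := exists_blockDiag_of_mem_centralizer σ ha hx hg
    exact ⟨R, ⟨A, (Matrix.mem_specialOrthogonalGroup_iff.1 A.2).1, B,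
      (Matrix.mem_specialOrthogonalGroup_iff.1 B.2).1, hAB⟩, hR⟩
  refine Set.Subset.antisymm (fun g hg => ?_) fun g hg => ?_
  · obtain ⟨D, hD, hDc, h1, hgD⟩ := centralizer_le_connectedPart σ ha hx ha2 hg
    exact hDc.subset_connectedComponentIn h1 (hD.trans hsub) hgD
  -- Since `l x = 1` and every element of the preimage takes `x` to `±x`, the continuous function
  -- `f` has only the values `±1` there. On the component of `1` it cannot reach `-1` without
  -- passing through `0`.
  · let l : Cl m →ₗ[ℝ] ℝ := c • wedgeFunctional (minorForm (embL σ))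
    have hl : l x = 1 := by
      rw [LinearMap.smul_apply, baseFunctional_apply σ hx, smul_eq_mul, hc]
    let f : Spin m → ℝ := fun g => l ((g : Cl m) * x * star (g : Cl m))
    have hf : Continuous f :=
      (IsModuleTopology.continuous_of_linearMap (R := ℝ) l).comp (continuous_spin_conj _)
    have hval : ∀ h ∈ coverPreimage (SOO σ),
        (h : Cl m) * x * star (h : Cl m) = x ∨ (h : Cl m) * x * star (h : Cl m) = -x := by
      rintro h ⟨R, ⟨A, hA, B, hB, hAB⟩, hR⟩
      have hdet := Covers.conj_base_of_blockDiag σ hx hR hAB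
      have hA1 : A.det * A.det = 1 := by
        have := congrArg Matrix.det ((Matrix.mem_orthogonalGroup_iff' _ _).1 hA)
        rwa [Matrix.det_mul, Matrix.det_transpose, Matrix.det_one] at this
      rcases mul_self_eq_one_iff.1 hA1 with h1 | h1
      · left; rw [hdet, h1, one_smul]
      · right; rw [hdet, h1, neg_smul, one_smul]
    have h1mem : (1 : Spin m) ∈ coverPreimage (SOO σ) := hsub (one_mem _)
    rcases hval g (connectedComponentIn_subset _ _ hg) with h | h
    · exact mem_centralizer_iff.2 h
    · exfalso
      have hf1 : f 1 = 1 := by simp [f, hl]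
      have hfg : f g = -1 := by simp only [f]; rw [h, map_neg, hl]
      have hmem : (0 : ℝ) ∈ Set.Icc (f g) (f 1) := by rw [hf1, hfg]; norm_num
      obtain ⟨h0, hh0, hf0⟩ := isPreconnected_connectedComponentIn.intermediate_value hg
        (mem_connectedComponentIn h1mem) hf.continuousOn hmem
      rcases hval h0 (connectedComponentIn_subset _ _ hh0) with h2 | h2
      · simp only [f] at hf0
        rw [h2, hl] at hf0
        exact one_ne_zero hf0
      · simp only [f] at hf0
        rw [h2, map_neg, hl] at hf0
        norm_num at hf0

end Connected

/-! ## The unit multivector of an oriented plane -/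

section Plucker

variable {a b m : ℕ}

theorem alternating_mul {N : Type*} [AddCommGroup N] [Module ℝ N]
    (f : (Fin m → ℝ) [⋀^Fin a]→ₗ[ℝ] N) (A : Matrix (Fin a) (Fin a) ℝ)
    (v : Matrix (Fin a) (Fin m) ℝ) : f (A * v) = A.det • f v := by
  refine (congrArg f (funext fun i => funext fun l => ?_)).trans (map_sum_smul_eq_det_smul f v A)
  rw [Matrix.mul_apply, Finset.sum_apply]
  rfl

/-- The Gram determinant of a family of vectors. -/
def gramDet (v : Matrix (Fin a) (Fin m) ℝ) : ℝ := (v * vᵀ).det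

theorem gramDet_mul (A : Matrix (Fin a) (Fin a) ℝ) (v : Matrix (Fin a) (Fin m) ℝ) :
    gramDet (A * v) = A.det ^ 2 * gramDet v := by
  rw [gramDet, Matrix.transpose_mul, Matrix.mul_assoc, ← Matrix.mul_assoc v, ← Matrix.mul_assoc,
    Matrix.det_mul, Matrix.det_mul, Matrix.det_transpose, gramDet]
  ring

theorem gramDet_pos {v : Matrix (Fin a) (Fin m) ℝ} (hv : LinearIndependent ℝ v) :
    0 < gramDet v := by
  have := Matrix.PosDef.mul_conjTranspose_self v (Matrix.vecMul_injective_iff.2 hv)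
  rw [Matrix.conjTranspose_eq_transpose_of_trivial] at this
  exact this.det_pos

theorem gramDet_of_orthonormal {v : Matrix (Fin a) (Fin m) ℝ} (hv : v * vᵀ = 1) :
    gramDet v = 1 := by
  rw [gramDet, hv, Matrix.det_one]

theorem dotProduct_of_orthonormal {v : Matrix (Fin a) (Fin m) ℝ} (hv : v * vᵀ = 1) (i j : Fin a) :
    v i ⬝ᵥ v j = (1 : Matrix (Fin a) (Fin a) ℝ) i j := by
  rw [← hv]
  rfl

theorem linearIndependent_of_orthonormal {v : Matrix (Fin a) (Fin m) ℝ} (hv : v * vᵀ = 1) :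
    LinearIndependent ℝ v := by
  refine (Matrix.vecMul_injective_iff (M := v)).1 fun x y hxy => ?_
  have := congrArg (fun z => Matrix.vecMul z vᵀ) hxy
  simpa [Matrix.vecMul_vecMul, hv] using this

/-- The multivector of a frame, normalized and multiplied by the sign `c`. -/
def unitMultivector (c : ℝ) (v : Matrix (Fin a) (Fin m) ℝ) : Cl m :=
  (c / Real.sqrt (gramDet v)) • wedge a m v

/-- The exterior product is scaled by `det A` and the root of the Gram determinant by `|det A|`.
These cancel for positive determinant. -/
theorem unitMultivector_mul (c : ℝ) {A : Matrix (Fin a) (Fin a) ℝ} (hA : 0 < A.det)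
    (v : Matrix (Fin a) (Fin m) ℝ) : unitMultivector c (A * v) = unitMultivector c v := by
  rw [unitMultivector, unitMultivector, gramDet_mul, Real.sqrt_mul (sq_nonneg _),
    Real.sqrt_sq hA.le, alternating_mul, smul_smul]
  congr 1
  field_simp

theorem unitMultivector_of_orthonormal (c : ℝ) {v : Matrix (Fin a) (Fin m) ℝ} (hv : v * vᵀ = 1) :
    unitMultivector c v = c • vecProd v := by
  rw [unitMultivector, gramDet_of_orthonormal hv, Real.sqrt_one, div_one,
    wedge_of_orthogonal v fun i j hij => by
      rw [dotProduct_of_orthonormal hv, Matrix.one_apply_ne hij]]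
  rfl

/-- The diagonal matrix with entry `-1` at `l` and `1` elsewhere. -/
def signFlip (l : Fin m) : Matrix (Fin m) (Fin m) ℝ := Matrix.diagonal (Function.update 1 l (-1))

theorem signFlip_mul_self (l : Fin m) : signFlip l * signFlip l = 1 := by
  rw [signFlip, Matrix.diagonal_mul_diagonal, ← Matrix.diagonal_one]
  congr 1
  funext i
  by_cases hi : i = l
  · subst hi; simp
  · rw [Function.update_of_ne hi]; simp

theorem det_signFlip (l : Fin m) : (signFlip l).det = -1 := by
  rw [signFlip, Matrix.det_diagonal, Finset.prod_update_of_mem (Finset.mem_univ _)]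
  simp

theorem transpose_signFlip (l : Fin m) : (signFlip l)ᵀ = signFlip l := Matrix.diagonal_transpose _

/-- Every frame arises from an orthonormal frame by a change of basis with positive determinant. -/
theorem exists_orthonormal_eq_mul {v : Matrix (Fin a) (Fin m) ℝ} (hv : LinearIndependent ℝ v) :
    ∃ (o : Matrix (Fin a) (Fin m) ℝ) (A : Matrix (Fin a) (Fin a) ℝ),
      o * oᵀ = 1 ∧ 0 < A.det ∧ v = A * o := by
  let v' : Fin a → EuclideanSpace ℝ (Fin m) := fun i => WithLp.toLp 2 (v i)
  have hv' : LinearIndependent ℝ v' :=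
    hv.map' (WithLp.linearEquiv 2 ℝ (Fin m → ℝ)).symm.toLinearMap (LinearEquiv.ker _)
  let W := Submodule.span ℝ (Set.range v')
  have hW : Module.finrank ℝ W = a := by simpa using finrank_span_eq_card hv'
  let B := (stdOrthonormalBasis ℝ W).reindex (finCongr hW)
  let o : Matrix (Fin a) (Fin m) ℝ := fun i => (B i : EuclideanSpace ℝ (Fin m)).ofLp
  have ho : o * oᵀ = 1 := by
    ext i j
    have h1 := orthonormal_iff_ite.1 B.orthonormal i j
    rw [Submodule.coe_inner, EuclideanSpace.inner_eq_star_dotProduct] at h1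
    rw [Matrix.mul_apply', Matrix.one_apply, ← h1, dotProduct_comm]
    rfl
  let A : Matrix (Fin a) (Fin a) ℝ := fun i =>
    (B.repr ⟨v' i, Submodule.subset_span ⟨i, rfl⟩⟩).ofLp
  have hA : v = A * o := by
    ext i l
    have h1 := B.sum_repr ⟨v' i, Submodule.subset_span ⟨i, rfl⟩⟩
    have h2 := congrArg (fun w : W => (w : EuclideanSpace ℝ (Fin m)).ofLp l) h1
    simp only [Submodule.coe_sum, Submodule.coe_smul, WithLp.ofLp_sum, WithLp.ofLp_smul,
      Finset.sum_apply, Pi.smul_apply, smul_eq_mul] at h2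
    rw [Matrix.mul_apply]
    exact h2.symm
  have hdet : A.det ≠ 0 := by
    intro h0
    have h1 := gramDet_pos hv
    rw [hA, gramDet_mul, h0] at h1
    simp at h1
  rcases lt_or_gt_of_ne hdet with h | h
  · have ha : 0 < a := by
      rcases Nat.eq_zero_or_pos a with rfl | h'
      · rw [Matrix.det_isEmpty] at h; linarith
      · exact h'
    -- Reversing one vector of the orthonormal frame changes the sign of the determinant of the base
    -- change.
    set D := signFlip (⟨0, ha⟩ : Fin a) with hD
    have hDD : D * D = 1 := signFlip_mul_self _
    refine ⟨D * o, A * D, ?_, ?_, ?_⟩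
    · rw [Matrix.transpose_mul, Matrix.mul_assoc, ← Matrix.mul_assoc o, ho, Matrix.one_mul,
        transpose_signFlip, hDD]
    · rw [Matrix.det_mul, det_signFlip]
      linarith
    · rw [Matrix.mul_assoc, ← Matrix.mul_assoc D, hDD, Matrix.one_mul, hA]
  · exact ⟨o, A, ho, h, hA⟩

variable (σ : Fin a ⊕ Fin b ≃ Fin m)

/-- The matrix of the standard frame. -/
abbrev baseMatrix : Matrix (Fin a) (Fin m) ℝ := baseFrame σ

theorem baseMatrix_orthonormal : baseMatrix σ * (baseMatrix σ)ᵀ = 1 := by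
  ext i j
  rw [Matrix.mul_apply', Matrix.one_apply]
  change baseFrame σ i ⬝ᵥ baseFrame σ j = _
  split_ifs with h
  · rw [h, baseFrame, stdVec_unit]
  · exact baseFrame_orthogonal σ i j h

/-- Every orthonormal frame is the image of the standard frame under a rotation. -/
theorem exists_SO_of_orthonormal (j₀ : Fin b) {o : Matrix (Fin a) (Fin m) ℝ} (ho : o * oᵀ = 1) :
    ∃ R : SO m, ∀ i, (R : Matrix (Fin m) (Fin m) ℝ) *ᵥ baseFrame σ i = o i := by
  let s : Set (Fin m) := Set.range (embL σ)
  let v : Fin m → EuclideanSpace ℝ (Fin m) := fun l =>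
    Sum.elim (fun i => WithLp.toLp 2 (o i)) (fun _ => 0) (σ.symm l)
  have hvL : ∀ i, v (embL σ i) = WithLp.toLp 2 (o i) := fun i => by simp [v]
  have hs : Orthonormal ℝ (s.domRestrict v) := by
    rw [orthonormal_iff_ite]
    rintro ⟨_, i, rfl⟩ ⟨_, j, rfl⟩
    change inner ℝ (v (embL σ i)) (v (embL σ j)) = _
    have h1 : inner ℝ (v (embL σ i)) (v (embL σ j)) = o j ⬝ᵥ o i := by
      rw [hvL, hvL, EuclideanSpace.inner_eq_star_dotProduct, star_trivial]
    rw [h1, dotProduct_of_orthonormal ho, Matrix.one_apply]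
    refine if_congr ⟨?_, fun h => ?_⟩ rfl rfl
    · rintro rfl
      rfl
    · exact ((embL σ).injective (congrArg Subtype.val h)).symm
  obtain ⟨B, hB⟩ := Orthonormal.exists_orthonormalBasis_extension_of_card_eq
    (by simp) hs
  let R : Matrix (Fin m) (Fin m) ℝ := fun l l' => (B l').ofLp l
  have hRR : Rᵀ * R = 1 := by
    ext l l'
    have h1 := orthonormal_iff_ite.1 B.orthonormal l l'
    rw [EuclideanSpace.inner_eq_star_dotProduct] at h1
    rw [Matrix.mul_apply', Matrix.one_apply, ← h1, dotProduct_comm]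
    rfl
  have hRcol : ∀ i l, R l (embL σ i) = o i l := by
    intro i l
    change (B (embL σ i)).ofLp l = _
    rw [hB _ ⟨i, rfl⟩, hvL]
  have hfin : ∀ Q : Matrix (Fin m) (Fin m) ℝ, Qᵀ * Q = 1 → Q.det = 1 →
      (∀ i l, Q l (embL σ i) = o i l) →
      ∃ R : SO m, ∀ i, (R : Matrix (Fin m) (Fin m) ℝ) *ᵥ baseFrame σ i = o i := by
    intro Q h1 h2 h3
    refine ⟨⟨Q, Matrix.mem_specialOrthogonalGroup_iff.2
      ⟨(Matrix.mem_orthogonalGroup_iff' _ _).2 h1, h2⟩⟩, fun i => ?_⟩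
    funext l
    simp only [baseFrame, stdVec, Matrix.mulVec_single_one, Matrix.col_apply]
    exact h3 i l
  have hdet : R.det * R.det = 1 := by
    have := congrArg Matrix.det hRR
    rwa [Matrix.det_mul, Matrix.det_transpose, Matrix.det_one] at this
  rcases mul_self_eq_one_iff.1 hdet with h | h
  · exact hfin R hRR h hRcol
  -- The determinant is corrected by reversing a column outside the prescribed ones, which exists
  -- because of `j₀`.
  · set D := signFlip (embR σ j₀) with hD
    have hDD : D * D = 1 := signFlip_mul_self _
    refine hfin (R * D) ?_ ?_ fun i l => ?_
    · rw [Matrix.transpose_mul, Matrix.mul_assoc, ← Matrix.mul_assoc Rᵀ, hRR, Matrix.one_mul,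
        transpose_signFlip, hDD]
    · rw [Matrix.det_mul, h, det_signFlip]; norm_num
    · rw [hD, signFlip, Matrix.mul_diagonal, Function.update_of_ne (embL_ne_embR σ i j₀), hRcol]
      simp

variable {c : ℝ} {x : Spin m} (hx : (x : Cl m) = c • vecProd (baseFrame σ))

include hx in
theorem base_eq_unitMultivector : (x : Cl m) = unitMultivector c (baseMatrix σ) := by
  rw [unitMultivector_of_orthonormal c (baseMatrix_orthonormal σ), hx]

include hx in
theorem conj_base_eq_unitMultivector {g : Spin m} {o : Matrix (Fin a) (Fin m) ℝ}
    (ho : o * oᵀ = 1)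
    (hg : ∀ i, (g : Cl m) * vec (baseFrame σ i) * star (g : Cl m) = vec (o i)) :
    (g : Cl m) * x * star (g : Cl m) = unitMultivector c o := by
  rw [hx, mul_smul_comm, smul_mul_assoc, Spin.conj_vecProd g hg,
    unitMultivector_of_orthonormal c ho]

include hx in
theorem exists_conj_eq_unitMultivector (j₀ : Fin b) {v : Matrix (Fin a) (Fin m) ℝ}
    (hv : LinearIndependent ℝ v) :
    ∃ g : Spin m, (g : Cl m) * x * star (g : Cl m) = unitMultivector c v := by
  obtain ⟨o, A, ho, hA, rfl⟩ := exists_orthonormal_eq_mul hv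
  obtain ⟨R, hR⟩ := exists_SO_of_orthonormal σ j₀ ho
  obtain ⟨g, _, hg⟩ := exists_unitPairs_covers R
  refine ⟨g, ?_⟩
  rw [unitMultivector_mul c hA]
  exact conj_base_eq_unitMultivector σ hx ho fun i => by rw [hg.conj, hR]

variable (ha : Even a)

include ha hx in
/-- Two frames have the same unit multivector if and only if they differ by a change of basis with
positive determinant. -/
theorem unitMultivector_eq_iff (j₀ : Fin b) {v v' : Matrix (Fin a) (Fin m) ℝ}
    (hv : LinearIndependent ℝ v) (hv' : LinearIndependent ℝ v') :
    unitMultivector c v = unitMultivector c v' ↔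
      ∃ A : Matrix (Fin a) (Fin a) ℝ, 0 < A.det ∧ v' = A * v := by
  constructor
  · intro h
    have hvo := hv
    obtain ⟨o, A, ho, hA, rfl⟩ := exists_orthonormal_eq_mul hv
    obtain ⟨o', A', ho', hA', rfl⟩ := exists_orthonormal_eq_mul hv'
    rw [unitMultivector_mul c hA, unitMultivector_mul c hA'] at h
    obtain ⟨R, hR⟩ := exists_SO_of_orthonormal σ j₀ ho
    obtain ⟨R', hR'⟩ := exists_SO_of_orthonormal σ j₀ ho'
    obtain ⟨g, _, hg⟩ := exists_unitPairs_covers R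
    obtain ⟨g', _, hg'⟩ := exists_unitPairs_covers R'
    have h1 := conj_base_eq_unitMultivector σ hx ho (g := g) fun i => by rw [hg.conj, hR]
    have h2 := conj_base_eq_unitMultivector σ hx ho' (g := g') fun i => by rw [hg'.conj, hR']
    -- Equal multivectors mean that `g` and `g'` move `x` to the same point. The known stabilizer
    -- then relates the two orthonormal frames by a matrix of `SO(a)`.
    have h3 : g⁻¹ * g' ∈ Subgroup.centralizer {x} := by
      rw [mem_centralizer_iff]
      have h4 : ((g⁻¹ * g' : Spin m) : Cl m) * x * star ((g⁻¹ * g' : Spin m) : Cl m) =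
          star (g : Cl m) * ((g' : Cl m) * x * star (g' : Cl m)) * g := by
        simp [Spin.coe_inv, mul_assoc]
      rw [h4, h2, ← h, ← h1, ← mul_assoc, ← mul_assoc, Spin.star_mul, one_mul, mul_assoc,
        Spin.star_mul, mul_one]
    obtain ⟨C, D, Q, hQ, hCD⟩ := exists_blockDiag_of_mem_centralizer σ ha hx h3
    have hQR : Q = R⁻¹ * R' := hQ.unique (hg.inv.mul hg')
    have hR'Q : R' = R * Q := by rw [hQR, mul_inv_cancel_left]
    have hoo : o' = (C : Matrix (Fin a) (Fin a) ℝ)ᵀ * o := by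
      refine funext fun i => ?_
      have hL : baseFrame σ i ∘ embL σ = stdVec a i := by
        funext j
        simp [baseFrame, stdVec, Pi.single_apply]
      have hRr : baseFrame σ i ∘ embR σ = 0 := by
        funext j
        simp [baseFrame, stdVec]
      rw [← hR' i, hR'Q, show ((R * Q : SO m) : Matrix (Fin m) (Fin m) ℝ) = R * Q from rfl,
        ← Matrix.mulVec_mulVec, hCD, blockDiag_mulVec, hL, hRr, Matrix.mulVec_zero, map_zero,
        add_zero, mulVec_eq_sum_stdVec, map_sum]
      simp only [map_smul, coordEmbedding_stdVec]
      rw [← Matrix.mulVecLin_apply, map_sum]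
      simp only [map_smul, Matrix.mulVecLin_apply]
      funext l
      rw [Matrix.mul_apply, Finset.sum_apply]
      refine Finset.sum_congr rfl fun j _ => ?_
      rw [← hR j]
      rfl
    refine ⟨A' * (C : Matrix (Fin a) (Fin a) ℝ)ᵀ * A⁻¹, ?_, ?_⟩
    · rw [Matrix.det_mul, Matrix.det_mul, Matrix.det_transpose, SO.det_eq, mul_one,
        Matrix.det_nonsing_inv, Ring.inverse_eq_inv']
      positivity
    · rw [Matrix.mul_assoc, ← Matrix.mul_assoc A⁻¹, Matrix.nonsing_inv_mul _ (isUnit_iff_ne_zero.2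
        hA.ne'), Matrix.one_mul, Matrix.mul_assoc, ← hoo]
  · rintro ⟨A, hA, rfl⟩
    rw [unitMultivector_mul c hA]

end Plucker

/-! ## Continuity and smoothness through linear functionals -/

section Functionals

variable {X Y V V' : Type} [TopologicalSpace X] [TopologicalSpace Y]
  [AddCommGroup V] [Module ℝ V] [AddCommGroup V'] [Module ℝ V']

theorem weaklyContinuous_of_continuous [TopologicalSpace V] [IsTopologicalAddGroup V]
    [ContinuousSMul ℝ V] [T2Space V] [FiniteDimensional ℝ V] {i : X → V} (hi : Continuous i) :
    WeaklyContinuous i := fun l => (LinearMap.continuous_of_finiteDimensional l).comp hi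

theorem continuousAt_of_linear [TopologicalSpace V] [IsTopologicalAddGroup V]
    [ContinuousSMul ℝ V] [FiniteDimensional ℝ V] {f : X → V} {x : X}
    (h : ∀ l : V →ₗ[ℝ] ℝ, ContinuousAt (fun y => l (f y)) x) : ContinuousAt f x := by
  let B := Module.finBasis ℝ V
  have h1 : Continuous B.equivFun.symm :=
    LinearMap.continuous_of_finiteDimensional B.equivFun.symm.toLinearMap
  have h2 : ContinuousAt (fun y => B.equivFun (f y)) x :=
    continuousAt_pi.2 fun p => h (B.coord p)
  have h3 := h1.continuousAt.comp h2
  simpa [Function.comp_def] using h3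

/-- Continuity need not be assumed: the topology of `Y` is induced from `V'`, and the linear
functionals pull back to smooth, hence continuous, functions. -/
theorem pullsBack_of_inducing [TopologicalSpace V'] [IsTopologicalAddGroup V']
    [ContinuousSMul ℝ V'] [FiniteDimensional ℝ V'] {i : X → V} {j : Y → V'}
    (hi : WeaklyContinuous i) (hj : Topology.IsInducing j) {N : Set X} (hN : IsOpen N) {t : X → Y}
    (h : ∀ l : V' →ₗ[ℝ] ℝ, smoothOfEmbedding i N (fun x => l (j (t x)))) :
    PullsBack (smoothOfEmbedding i) (smoothOfEmbedding j) N t := by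
  refine pullsBack_of_linear hi hN (fun x hx => ContinuousAt.continuousWithinAt ?_) h
  rw [hj.continuousAt_iff]
  exact continuousAt_of_linear fun l => (h l).continuousAt hi hx

theorem smoothOfEmbedding_of_contDiffOn {E : Type} [NormedAddCommGroup E] [NormedSpace ℝ E]
    [FiniteDimensional ℝ E] {i : X → E} (hi : Continuous i) {Ω : Set E} (hΩ : IsOpen Ω)
    {G : E → ℝ} (hG : ContDiffOn ℝ ∞ G Ω) {U : Set X} (hU : ∀ x ∈ U, i x ∈ Ω) :
    smoothOfEmbedding i U (fun x => G (i x)) := by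
  intro x hx
  obtain ⟨H, hH, hHG⟩ := exists_contDiff_eventuallyEq hΩ hG (hU x hx)
  refine ⟨H, IsSmoothFunction.of_comp_linear (LinearMap.id : E →ₗ[ℝ] E) hH, ?_⟩
  filter_upwards [hi.continuousAt.eventually hHG] with y hy
  exact hy.symm

theorem IsSmoothFunction.contDiffAt_comp {E : Type*} [NormedAddCommGroup E] [NormedSpace ℝ E]
    {F : V → ℝ} (hF : IsSmoothFunction F) {g : E → V}
    (hg : ∀ l : V →ₗ[ℝ] ℝ, ContDiff ℝ ∞ (fun z => l (g z))) : ContDiff ℝ ∞ (fun z => F (g z)) := by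
  obtain ⟨N, L, G, hG, rfl⟩ := hF
  exact hG.comp (contDiff_pi.2 fun a => hg (LinearMap.proj a ∘ₗ L))

end Functionals

/-! ## The charts of the conjugacy class -/

section Chart

variable {a b m : ℕ}

theorem contDiff_alternating {n : WithTop ℕ∞} (f : (Fin m → ℝ) [⋀^Fin a]→ₗ[ℝ] ℝ) :
    ContDiff ℝ n (fun v : Fin a → Fin m → ℝ => f v) := by
  have h : ∀ v : Fin a → Fin m → ℝ,
      f v = ∑ r : Fin a → Fin m, (∏ i, v i (r i)) * f fun i => stdVec m (r i) := by
    intro v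
    have h1 : v = fun i => ∑ l, v i l • stdVec m l := funext fun i => by
      conv_lhs => rw [pi_eq_sum_univ' (v i)]
    conv_lhs => rw [h1]
    have h2 := f.toMultilinearMap.map_sum (fun (i : Fin a) (l : Fin m) => v i l • stdVec m l)
    refine h2.trans (Finset.sum_congr rfl fun r _ => ?_)
    exact f.toMultilinearMap.map_smul_univ (fun i => v i (r i)) fun i => stdVec m (r i)
  rw [show (fun v : Fin a → Fin m → ℝ => f v) = fun v => ∑ r : Fin a → Fin m,
    (∏ i, v i (r i)) * f fun i => stdVec m (r i) from funext h]
  refine ContDiff.sum fun r _ => ContDiff.mul (contDiff_prod fun i _ => ?_) contDiff_const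
  exact (contDiff_apply ℝ ℝ (r i)).comp (contDiff_apply ℝ (Fin m → ℝ) i)

theorem contDiff_gramDet {n : WithTop ℕ∞} :
    ContDiff ℝ n (fun v : Fin a → Fin m → ℝ => gramDet v) := by
  have h : ∀ v : Fin a → Fin m → ℝ,
      gramDet v = ∑ s : Equiv.Perm (Fin a), Equiv.Perm.sign s • ∏ i, ∑ l, v (s i) l * v i l :=
    fun v => Matrix.det_apply _
  rw [show (fun v : Fin a → Fin m → ℝ => gramDet v) = fun v => ∑ s : Equiv.Perm (Fin a),
    Equiv.Perm.sign s • ∏ i, ∑ l, v (s i) l * v i l from funext h]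
  refine ContDiff.sum fun s _ => ContDiff.const_smul _ (contDiff_prod fun i _ =>
    ContDiff.sum fun l _ => ContDiff.mul ?_ ?_)
  · exact (contDiff_apply ℝ ℝ l).comp (contDiff_apply ℝ (Fin m → ℝ) (s i))
  · exact (contDiff_apply ℝ ℝ l).comp (contDiff_apply ℝ (Fin m → ℝ) i)

theorem contDiffOn_unitMultivector (c : ℝ) (l : Cl m →ₗ[ℝ] ℝ) :
    ContDiffOn ℝ ∞ (fun v : Fin a → Fin m → ℝ => l (unitMultivector c v))
      {v | 0 < gramDet v} := by
  simp only [unitMultivector, map_smul, smul_eq_mul]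
  refine ContDiffOn.mul (contDiffOn_const.div (contDiff_gramDet.contDiffOn.sqrt fun v hv => ?_)
    fun v hv => ?_) (contDiff_alternating (l.compAlternatingMap (wedge a m))).contDiffOn
  · exact (ne_of_gt hv)
  · exact (Real.sqrt_pos.2 hv).ne'

theorem isOpen_gramDet_pos : IsOpen {v : Fin a → Fin m → ℝ | 0 < gramDet v} :=
  isOpen_lt continuous_const (contDiff_gramDet (n := 0)).continuous

theorem weaklyContinuous_spin : WeaklyContinuous (fun g : Spin m => (g : Cl m)) :=
  weaklyContinuous_of_continuous continuous_subtype_val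

theorem weaklyContinuous_orbit (x : Spin m) :
    WeaklyContinuous (fun y : conjugatesOf x => ((y : Spin m) : Cl m)) :=
  weaklyContinuous_of_continuous (continuous_subtype_val.comp continuous_subtype_val)

theorem isInducing_orbit (x : Spin m) :
    Topology.IsInducing (fun y : conjugatesOf x => ((y : Spin m) : Cl m)) :=
  Topology.IsInducing.subtypeVal.comp Topology.IsInducing.subtypeVal

variable (σ : Fin a ⊕ Fin b ≃ Fin m) {c : ℝ} {x : Spin m}
  (hx : (x : Cl m) = c • vecProd (baseFrame σ)) (j₀ : Fin b)

/-- The point of the conjugacy class of `x` given by a frame. -/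
def toOrbit (v : Frame a m) : conjugatesOf x :=
  ⟨⟨unitMultivector c v.1, by
    obtain ⟨g, hg⟩ := exists_conj_eq_unitMultivector σ hx j₀ v.2
    rw [← hg]
    exact (g * x * g⁻¹ : Spin m).2⟩, by
    obtain ⟨g, hg⟩ := exists_conj_eq_unitMultivector σ hx j₀ v.2
    exact isConj_iff.2 ⟨g, Subtype.ext hg⟩⟩

theorem pullsBack_toOrbit : PullsBack (smoothOfEmbedding fun v : Frame a m => v.1)
    (smoothConjugacyClass x) Set.univ (toOrbit σ hx j₀) :=
  pullsBack_of_inducing (weaklyContinuous_of_continuous continuous_subtype_val)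
    (isInducing_orbit x) isOpen_univ fun l =>
    smoothOfEmbedding_of_contDiffOn (i := fun v : Frame a m => v.1) continuous_subtype_val
      isOpen_gramDet_pos (contDiffOn_unitMultivector c l) fun v _ => gramDet_pos v.2

theorem orthonormal_columns (R : SO m) :
    (Matrix.of fun i => (R : Matrix (Fin m) (Fin m) ℝ) *ᵥ baseFrame σ i) *
      (Matrix.of fun i => (R : Matrix (Fin m) (Fin m) ℝ) *ᵥ baseFrame σ i)ᵀ = 1 := by
  ext i j
  refine (SO.mulVec_dotProduct R (baseFrame σ i) (baseFrame σ j)).trans ?_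
  exact dotProduct_of_orthonormal (baseMatrix_orthonormal σ) i j

theorem toOrbit_surjective : Function.Surjective (toOrbit σ hx j₀) := by
  rintro ⟨y, hy⟩
  obtain ⟨g, rfl⟩ := isConj_iff.1 hy
  obtain ⟨R, hR⟩ := exists_covers g
  refine ⟨⟨_, linearIndependent_of_orthonormal (orthonormal_columns σ R)⟩, Subtype.ext (Subtype.ext ?_)⟩
  exact (conj_base_eq_unitMultivector σ hx (orthonormal_columns σ R) fun i => hR.conj _).symm

/-- The frame of the graph of a linear map between the two blocks of coordinates. -/
def graphMatrix (L : Fin a × Fin b → ℝ) : Fin a → Fin m → ℝ := fun i =>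
  coordEmbedding (embL σ) (stdVec a i) + coordEmbedding (embR σ) (fun j => L (i, j))

theorem graphMatrix_embL (L : Fin a × Fin b → ℝ) (i r : Fin a) :
    graphMatrix σ L i (embL σ r) = (1 : Matrix (Fin a) (Fin a) ℝ) i r := by
  rw [graphMatrix, Pi.add_apply, coordEmbedding_apply, coordEmbedding_apply_of_notMem]
  · simp [stdVec, Matrix.one_apply, Pi.single_apply, eq_comm]
  · exact fun j => (embL_ne_embR σ r j).symm

theorem graphMatrix_embR (L : Fin a × Fin b → ℝ) (i : Fin a) (j : Fin b) :
    graphMatrix σ L i (embR σ j) = L (i, j) := by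
  rw [graphMatrix, Pi.add_apply, coordEmbedding_apply, coordEmbedding_apply_of_notMem, zero_add]
  exact fun i => embL_ne_embR σ i j

theorem minorForm_graphMatrix (L : Fin a × Fin b → ℝ) :
    minorForm (embL σ) (graphMatrix σ L) = 1 := by
  rw [minorForm_apply, ← Matrix.det_one (n := Fin a) (R := ℝ)]
  congr 1
  ext i r
  exact graphMatrix_embL σ L i r

/-- The minor is that of an identity matrix with one column replaced by a column of `L`, so Cramer's
rule reads off the entry. Single entries of `L` are thus Plücker coordinates. -/
theorem minorForm_update_graphMatrix (L : Fin a × Fin b → ℝ) (i : Fin a) (j : Fin b) :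
    minorForm (Function.update (embL σ) i (embR σ j)) (graphMatrix σ L) = L (i, j) := by
  have h1 : (Matrix.of fun r s => graphMatrix σ L r (Function.update (embL σ) i (embR σ j) s)) =
      (1 : Matrix (Fin a) (Fin a) ℝ).updateCol i (fun r => L (r, j)) := by
    ext r s
    by_cases hs : s = i
    · subst hs
      simp only [Matrix.of_apply, Function.update_self, Matrix.updateCol_self]
      exact graphMatrix_embR σ L r j
    · rw [Matrix.of_apply, Function.update_of_ne hs, Matrix.updateCol_ne hs]
      exact graphMatrix_embL σ L r s
  rw [minorForm_apply, h1, ← Matrix.cramer_apply, Matrix.cramer_one]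
  rfl

theorem linearIndependent_of_minor_ne_zero {v : Fin a → Fin m → ℝ} {p : Fin a → Fin m}
    (h : minorForm p v ≠ 0) : LinearIndependent ℝ v := by
  by_contra hv
  exact h (AlternatingMap.map_linearDependent _ _ hv)

/-- The frame of the graph of a linear map. -/
def graphFrame (L : Fin a × Fin b → ℝ) : Frame a m :=
  ⟨graphMatrix σ L, linearIndependent_of_minor_ne_zero (p := embL σ) (by
    rw [minorForm_graphMatrix]; exact one_ne_zero)⟩

theorem contDiff_graphMatrix {n : WithTop ℕ∞} :
    ContDiff ℝ n (fun L : Fin a × Fin b → ℝ => graphMatrix σ L) := by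
  refine contDiff_pi.2 fun i => contDiff_pi.2 fun l => ?_
  revert l
  refine forall_fin_of_split σ (fun r => ?_) fun j => ?_
  · simp only [graphMatrix_embL]
    exact contDiff_const
  · simp only [graphMatrix_embR]
    exact contDiff_apply ℝ ℝ (i, j)

/-- The denominator of the chart around the base point. -/
def chartDen (z : Cl m) : ℝ := wedgeFunctional (minorForm (embL σ)) z

/-- The chart around the base point. -/
def chartFun (z : Cl m) (q : Fin a × Fin b) : ℝ :=
  wedgeFunctional (minorForm (Function.update (embL σ) q.1 (embR σ q.2))) z / chartDen σ z

theorem wedgeFunctional_unitMultivector (c : ℝ) (f : (Fin m → ℝ) [⋀^Fin a]→ₗ[ℝ] ℝ)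
    (v : Fin a → Fin m → ℝ) :
    wedgeFunctional f (unitMultivector c v) = c / Real.sqrt (gramDet v) * f v := by
  refine (map_smul (wedgeFunctional f) (c / Real.sqrt (gramDet v)) (wedge a m v)).trans ?_
  rw [smul_eq_mul, wedgeFunctional_wedge]

/-- The normalization of the multivector cancels in the ratio of Plücker coordinates, and the
denominator minor of a graph is `1`. -/
theorem chartFun_graphMatrix (hc : c * c = 1) (L : Fin a × Fin b → ℝ) :
    chartFun σ (unitMultivector c (graphMatrix σ L)) = L := by
  funext q
  have hg := gramDet_pos (graphFrame σ L).2
  have h1 : c / Real.sqrt (gramDet (graphMatrix σ L)) ≠ 0 :=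
    div_ne_zero (left_ne_zero_of_mul_eq_one hc) (Real.sqrt_pos.2 hg).ne'
  rw [chartFun, chartDen, wedgeFunctional_unitMultivector, wedgeFunctional_unitMultivector,
    minorForm_graphMatrix, minorForm_update_graphMatrix]
  rw [mul_one, mul_div_cancel_left₀ _ h1]

theorem chartDen_unitMultivector_pos_iff (hc : c * c = 1) (v : Frame a m) :
    0 < c * chartDen σ (unitMultivector c v.1) ↔ 0 < minorForm (embL σ) v.1 := by
  rw [chartDen, wedgeFunctional_unitMultivector, ← mul_assoc, mul_div_assoc', hc]
  exact mul_pos_iff_of_pos_left (div_pos one_pos (Real.sqrt_pos.2 (gramDet_pos v.2)))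

/-- A frame with positive first minor spans the same oriented plane as a graph. -/
theorem exists_toOrbit_eq_graph {v : Frame a m} (hv : 0 < minorForm (embL σ) v.1) :
    ∃ L, toOrbit σ hx j₀ v = toOrbit σ hx j₀ (graphFrame σ L) := by
  let A : Matrix (Fin a) (Fin a) ℝ := Matrix.of fun i r => v.1 i (embL σ r)
  let B : Matrix (Fin a) (Fin b) ℝ := Matrix.of fun i j => v.1 i (embR σ j)
  have hA : 0 < A.det := hv
  -- Row reduction of the block matrix `(A | B)` to `(1 | A⁻¹ B)`. The base change `A` has positive
  -- determinant, so the multivector is unchanged.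
  let L : Fin a × Fin b → ℝ := fun q => (A⁻¹ * B) q.1 q.2
  have hAL : A * (Matrix.of (graphMatrix σ L)) = Matrix.of v.1 := by
    refine Matrix.ext fun i l => ?_
    revert l
    refine forall_fin_of_split σ (fun r => ?_) fun j => ?_
    · refine Matrix.mul_apply.trans ((Finset.sum_congr rfl fun p _ =>
        congrArg (A i p * ·) (graphMatrix_embL σ L p r)).trans ?_)
      refine (Matrix.mul_apply (M := A) (N := 1) (i := i) (k := r)).symm.trans ?_
      rw [Matrix.mul_one]
      rfl
    · refine Matrix.mul_apply.trans ((Finset.sum_congr rfl fun p _ =>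
        congrArg (A i p * ·) (graphMatrix_embR σ L p j)).trans ?_)
      refine (Matrix.mul_apply (M := A) (N := A⁻¹ * B) (i := i) (k := j)).symm.trans ?_
      rw [← Matrix.mul_assoc, Matrix.mul_nonsing_inv _ (isUnit_iff_ne_zero.2 hA.ne'),
        Matrix.one_mul]
      rfl
  refine ⟨L, Subtype.ext (Subtype.ext ?_)⟩
  exact (congrArg (unitMultivector c) hAL).symm.trans (unitMultivector_mul c hA _)

theorem continuous_chartDen : Continuous (chartDen σ) :=
  IsModuleTopology.continuous_of_linearMap (R := ℝ) (wedgeFunctional _)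

/-- The chart of the conjugacy class around the base point. -/
def orbitChart (hc : c * c = 1) : OpenPartialHomeomorph (conjugatesOf x) (Fin a × Fin b → ℝ) where
  toFun y := chartFun σ ((y : Spin m) : Cl m)
  invFun L := toOrbit σ hx j₀ (graphFrame σ L)
  source := {y | 0 < c * chartDen σ ((y : Spin m) : Cl m)}
  target := Set.univ
  map_source' _ _ := trivial
  map_target' L _ := by
    refine (chartDen_unitMultivector_pos_iff σ hc (graphFrame σ L)).2 ?_
    exact (minorForm_graphMatrix σ L).symm ▸ one_pos
  left_inv' y hy := by
    obtain ⟨v, rfl⟩ := toOrbit_surjective σ hx j₀ y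
    obtain ⟨L, hL⟩ := exists_toOrbit_eq_graph σ hx j₀
      ((chartDen_unitMultivector_pos_iff σ hc v).1 hy)
    rw [hL]
    exact congrArg (fun L => toOrbit σ hx j₀ (graphFrame σ L)) (chartFun_graphMatrix σ hc L)
  right_inv' L _ := chartFun_graphMatrix σ hc L
  open_source := isOpen_lt continuous_const (continuous_const.mul ((continuous_chartDen σ).comp
    (continuous_subtype_val.comp continuous_subtype_val)))
  open_target := isOpen_univ
  continuousOn_toFun := by
    refine continuousOn_pi.2 fun q => ContinuousOn.div ?_ ?_ fun y hy => ?_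
    · exact ((IsModuleTopology.continuous_of_linearMap (R := ℝ) (wedgeFunctional _)).comp
        (continuous_subtype_val.comp continuous_subtype_val)).continuousOn
    · exact ((continuous_chartDen σ).comp
        (continuous_subtype_val.comp continuous_subtype_val)).continuousOn
    · exact right_ne_zero_of_mul (ne_of_gt hy)
  continuousOn_invFun := by
    refine ((continuousOn_univ.1 (pullsBack_toOrbit σ hx j₀).1).comp ?_).continuousOn
    exact (contDiff_graphMatrix (n := 0) σ).continuous.subtype_mk _

theorem smooth_chartFun (q : Fin a × Fin b) :
    smoothConjugacyClass x {y | 0 < c * chartDen σ ((y : Spin m) : Cl m)}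
      (fun y => chartFun σ ((y : Spin m) : Cl m) q) :=
  smoothOfEmbedding.div (weaklyContinuous_orbit x) (smoothOfEmbedding_linear _ _)
    (smoothOfEmbedding_linear _ _) fun _ hy => right_ne_zero_of_mul (ne_of_gt hy)

theorem contDiff_toOrbit_graph (l : Cl m →ₗ[ℝ] ℝ) :
    ContDiff ℝ ∞ fun L : Fin a × Fin b → ℝ => l (unitMultivector c (graphMatrix σ L)) := by
  rw [← contDiffOn_univ]
  exact (contDiffOn_unitMultivector c l).comp (contDiff_graphMatrix σ).contDiffOn
    fun L _ => gramDet_pos (graphFrame σ L).2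

/-- An ambient extension of `f` becomes smooth on the graph parameters because the parametrization
is smooth. Conversely the chart coordinates are ratios of linear functionals of the Clifford
algebra. -/
theorem isSmoothChart_orbitChart (hc : c * c = 1) :
    IsSmoothChart (smoothConjugacyClass x) (orbitChart σ hx j₀ hc) := by
  intro U f hU hUs
  have hopen : IsOpen (orbitChart σ hx j₀ hc '' U) :=
    (orbitChart σ hx j₀ hc).isOpen_image_of_subset_source hU hUs
  constructor
  · rintro hf _ ⟨y, hy, rfl⟩
    obtain ⟨F, hF, hFf⟩ := hf y hy
    refine ContDiffAt.contDiffWithinAt ?_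
    have h1 : ContDiff ℝ ∞ fun L : Fin a × Fin b → ℝ => F (unitMultivector c (graphMatrix σ L)) :=
      hF.contDiffAt_comp (contDiff_toOrbit_graph σ)
    refine h1.contDiffAt.congr_of_eventuallyEq ?_
    have h2 := (orbitChart σ hx j₀ hc).continuousAt_symm
      ((orbitChart σ hx j₀ hc).map_source (hUs hy))
    have h3 : Filter.Tendsto (orbitChart σ hx j₀ hc).symm (𝓝 (orbitChart σ hx j₀ hc y)) (𝓝 y) := by
      have := h2.tendsto
      rwa [(orbitChart σ hx j₀ hc).left_inv (hUs hy)] at this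
    filter_upwards [h3.eventually hFf] with L hL
    exact hL
  · intro hf
    have h1 := smoothOfEmbedding.comp (weaklyContinuous_orbit x)
      (fun q => (smooth_chartFun σ (c := c) (x := x) q).mono hUs) hopen hf
      (fun y hy => ⟨y, hy, rfl⟩)
    refine h1.congr hU fun y hy => ?_
    change f y = f ((orbitChart σ hx j₀ hc).symm (orbitChart σ hx j₀ hc y))
    rw [(orbitChart σ hx j₀ hc).left_inv (hUs hy)]

/-- The conjugation by `g` on a conjugacy class. -/
def orbitConj (x g : Spin m) : conjugatesOf x ≃ₜ conjugatesOf x where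
  toFun y := ⟨g * y * g⁻¹, y.2.trans (isConj_iff.2 ⟨g, rfl⟩)⟩
  invFun y := ⟨g⁻¹ * y * g, y.2.trans (isConj_iff.2 ⟨g⁻¹, by rw [inv_inv]⟩)⟩
  left_inv y := Subtype.ext (by simp [mul_assoc])
  right_inv y := Subtype.ext (by simp [mul_assoc])
  continuous_toFun := ((continuous_const.mul continuous_subtype_val).mul
    continuous_const).subtype_mk _
  continuous_invFun := ((continuous_const.mul continuous_subtype_val).mul
    continuous_const).subtype_mk _

theorem pullsBack_conj (x g h : Spin m) {t : conjugatesOf x → conjugatesOf x}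
    (ht : ∀ y, (t y : Spin m) = g * y * h) :
    PullsBack (smoothConjugacyClass x) (smoothConjugacyClass x) Set.univ t := by
  refine pullsBack_of_inducing (weaklyContinuous_orbit x) (isInducing_orbit x) isOpen_univ
    fun l => ?_
  have h1 := smoothOfEmbedding_linear (i := fun y : conjugatesOf x => ((y : Spin m) : Cl m))
    (l ∘ₗ LinearMap.mulLeft ℝ (g : Cl m) ∘ₗ LinearMap.mulRight ℝ (h : Cl m)) Set.univ
  refine h1.congr isOpen_univ fun y _ => ?_
  rw [ht]
  simp [mul_assoc]

theorem orbitConj_smooth (x g : Spin m) (U : Set (conjugatesOf x)) (f : conjugatesOf x → ℝ)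
    (hU : IsOpen U) : smoothConjugacyClass x U f ↔
      smoothConjugacyClass x (orbitConj x g ⁻¹' U) (f ∘ orbitConj x g) := by
  constructor
  · intro hf
    simpa using (pullsBack_conj x g g⁻¹ (t := orbitConj x g) fun y => rfl).2 U f hU hf
  · intro hf
    have h1 := (pullsBack_conj x g⁻¹ g (t := (orbitConj x g).symm) fun y => rfl).2 _ _
      (hU.preimage (orbitConj x g).continuous) hf
    have h2 : (f ∘ orbitConj x g) ∘ (orbitConj x g).symm = f := by funext y; simp
    rw [h2, Set.univ_inter] at h1
    exact h1.mono fun y hy => by simpa using hy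

theorem base_mem_source (hc : c * c = 1) :
    (⟨x, mem_conjugatesOf_self⟩ : conjugatesOf x) ∈ (orbitChart σ hx j₀ hc).source := by
  change 0 < c * chartDen σ (x : Cl m)
  rw [chartDen, baseFunctional_apply σ hx, hc]
  exact one_pos

include σ hx j₀ in
/-- The conjugacy class has smooth charts around all its points. -/
theorem exists_isSmoothChart (hc : c * c = 1) (p : conjugatesOf x) :
    ∃ φ : OpenPartialHomeomorph (conjugatesOf x) (EuclideanSpace ℝ (Fin (a * b))),
      p ∈ φ.source ∧ IsSmoothChart (smoothConjugacyClass x) φ := by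
  obtain ⟨y, hy⟩ := p
  obtain ⟨g, rfl⟩ := isConj_iff.1 hy
  let T : (Fin a × Fin b → ℝ) ≃L[ℝ] EuclideanSpace ℝ (Fin (a * b)) :=
    ContinuousLinearEquiv.ofFinrankEq (by simp)
  refine ⟨((orbitConj x g).symm.transOpenPartialHomeomorph
    (orbitChart σ hx j₀ hc)).transHomeomorph T.toHomeomorph, ?_, ?_⟩
  · change (orbitConj x g).symm ⟨g * x * g⁻¹, hy⟩ ∈ (orbitChart σ hx j₀ hc).source
    convert base_mem_source σ hx j₀ hc using 1
    exact (orbitConj x g).symm_apply_eq.2 rfl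
  · refine IsSmoothChart.trans_equiv (IsSmoothChart.of_homeomorph _ (fun U f hU => ?_)
      (isSmoothChart_orbitChart σ hx j₀ hc)) T
    have h1 := orbitConj_smooth x g ((orbitConj x g).symm ⁻¹' U) (f ∘ (orbitConj x g).symm)
      (hU.preimage (orbitConj x g).symm.continuous)
    rw [h1]
    have h2 : (f ∘ (orbitConj x g).symm) ∘ orbitConj x g = f := by funext y; simp
    have h3 : orbitConj x g ⁻¹' ((orbitConj x g).symm ⁻¹' U) = U := by ext y; simp
    rw [h2, h3]

end Chart

/-! ## Local sections of the orbit map -/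

section WeaklySmooth

variable {E : Type} [NormedAddCommGroup E] [NormedSpace ℝ E] {m : ℕ} {F G : E → Cl m} {z : E}

/-- A function with values in the Clifford algebra is analytic at `z` if its compositions with the
linear functionals are. -/
def WeaklyAnalyticAt (F : E → Cl m) (z : E) : Prop :=
  ∀ l : Cl m →ₗ[ℝ] ℝ, ContDiffAt ℝ ω (fun L => l (F L)) z

/-- Bilinearity reduces regularity of a product to that of the coordinates of its factors. -/
theorem map_mul_eq_sum (l : Cl m →ₗ[ℝ] ℝ) (x y : Cl m) :
    l (x * y) = ∑ p, ∑ q, (Module.finBasis ℝ (Cl m)).coord p x *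
      (Module.finBasis ℝ (Cl m)).coord q y *
        l (Module.finBasis ℝ (Cl m) p * Module.finBasis ℝ (Cl m) q) := by
  conv_lhs => rw [← (Module.finBasis ℝ (Cl m)).sum_repr x, ← (Module.finBasis ℝ (Cl m)).sum_repr y]
  rw [Finset.sum_mul_sum, map_sum]
  refine Finset.sum_congr rfl fun p _ => ?_
  rw [map_sum]
  refine Finset.sum_congr rfl fun q _ => ?_
  rw [smul_mul_smul_comm, map_smul]
  rfl

theorem WeaklyAnalyticAt.mul (hF : WeaklyAnalyticAt F z) (hG : WeaklyAnalyticAt G z) :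
    WeaklyAnalyticAt (fun L => F L * G L) z := by
  intro l
  rw [show (fun L => l (F L * G L)) = _ from funext fun L => map_mul_eq_sum l (F L) (G L)]
  exact ContDiffAt.sum fun p _ => ContDiffAt.sum fun q _ =>
    ((hF _).mul (hG _)).mul contDiffAt_const

/-- The conjugation of the Clifford algebra, as a linear map. -/
def starLinear (m : ℕ) : Cl m →ₗ[ℝ] Cl m where
  toFun := star
  map_add' := star_add
  map_smul' r x := star_smul r x

theorem WeaklyAnalyticAt.star (hF : WeaklyAnalyticAt F z) :
    WeaklyAnalyticAt (fun L => star (F L)) z := fun l => hF (l ∘ₗ starLinear m)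

theorem weaklyAnalyticAt_vec {w : E → Fin m → ℝ} (hw : ∀ i, ContDiffAt ℝ ω (fun L => w L i) z) :
    WeaklyAnalyticAt (fun L => vec (w L)) z := by
  intro l
  simp only [vec_sum_stdVec (w _), map_sum, map_smul, smul_eq_mul]
  exact ContDiffAt.sum fun i _ => (hw i).mul contDiffAt_const

/-- A linear left inverse of the embedding of `ℝᵐ` in its Clifford algebra. -/
def vecInv (m : ℕ) : Cl m →ₗ[ℝ] Fin m → ℝ :=
  (LinearMap.exists_leftInverse_of_injective (vec (m := m))
    (LinearMap.ker_eq_bot.2 vec_injective)).choose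

theorem vecInv_vec (v : Fin m → ℝ) : vecInv m (vec v) = v :=
  LinearMap.congr_fun (LinearMap.exists_leftInverse_of_injective (vec (m := m))
    (LinearMap.ker_eq_bot.2 vec_injective)).choose_spec v

end WeaklySmooth

/-! ### Explicit rotors for orthogonalization -/

section Rotor

variable {a m : ℕ}

theorem unitPair_conj_of_orthogonal {u v w : Fin m → ℝ} (hu : u ⬝ᵥ u = 1) (hv : v ⬝ᵥ v = 1)
    (hwu : w ⬝ᵥ u = 0) (hwv : w ⬝ᵥ v = 0) :
    (unitPair u v hu hv : Cl m) * vec w * star (unitPair u v hu hv : Cl m) = vec w := by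
  rw [unitPair_conj]
  simp [hwu, hwv]

theorem star_unitPair {u v : Fin m → ℝ} (hu : u ⬝ᵥ u = 1) (hv : v ⬝ᵥ v = 1) :
    star (unitPair u v hu hv : Cl m) = (unitPair v u hv hu : Cl m) := by
  simp only [unitPair, star_mul, star_ι, neg_mul_neg]

/-- The rotor that moves the direction of `p` to a unit vector `e`, by the vector `p + ‖p‖ e`. -/
theorem exists_rotor_to {p e : Fin m → ℝ} (he : e ⬝ᵥ e = 1) {N : ℝ} (hN : N * N = p ⬝ᵥ p)
    (h0 : 0 < N) (hpe : 0 < p ⬝ᵥ e + N) :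
    ∃ t : Spin m, (t : Cl m) = vec ((Real.sqrt ((p + N • e) ⬝ᵥ (p + N • e)))⁻¹ • (p + N • e)) *
        vec (-e) ∧
      star (t : Cl m) * vec p * t = vec (N • e) ∧
      ∀ u, u ⬝ᵥ p = 0 → u ⬝ᵥ e = 0 → star (t : Cl m) * vec u * t = vec u := by
  set q := p + N • e with hq
  have hqq : q ⬝ᵥ q = 2 * N * (p ⬝ᵥ e + N) := by
    simp only [hq, add_dotProduct, dotProduct_add, smul_dotProduct, dotProduct_smul, he,
      smul_eq_mul, dotProduct_comm e p, ← hN]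
    ring
  have hpq : p ⬝ᵥ q = N * (p ⬝ᵥ e + N) := by
    simp only [hq, dotProduct_add, dotProduct_smul, smul_eq_mul, ← hN]
    ring
  have hQ : 0 < q ⬝ᵥ q := by rw [hqq]; positivity
  set s := Real.sqrt (q ⬝ᵥ q) with hs
  have hss : s * s = q ⬝ᵥ q := Real.mul_self_sqrt hQ.le
  have hs0 : s ≠ 0 := (Real.sqrt_pos.2 hQ).ne'
  have hn : (s⁻¹ • q) ⬝ᵥ (s⁻¹ • q) = 1 := by
    rw [smul_dotProduct, dotProduct_smul, smul_eq_mul, smul_eq_mul, ← hss]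
    field_simp
  have he' : (-e) ⬝ᵥ (-e) = 1 := by rw [neg_dotProduct_neg, he]
  have hst : ∀ w, star (unitPair (s⁻¹ • q) (-e) hn he' : Cl m) * vec w *
      (unitPair (s⁻¹ • q) (-e) hn he' : Cl m) = (unitPair (-e) (s⁻¹ • q) he' hn : Cl m) * vec w *
      star (unitPair (-e) (s⁻¹ • q) he' hn : Cl m) := fun w => by
    rw [star_unitPair, star_unitPair]
  refine ⟨unitPair (s⁻¹ • q) (-e) hn he', rfl, ?_, fun u hup hue => ?_⟩
  · rw [hst, unitPair_conj]
    congr 1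
    -- As `p` and `N • e` have equal length, the reflection along their sum `q` takes `p` to `-(N •
    -- e)`. The reflection along `-e` then restores the sign.
    have h1 : (2 * (p ⬝ᵥ (s⁻¹ • q))) • (s⁻¹ • q) = q := by
      rw [dotProduct_smul, hpq, smul_smul]
      have : 2 * (s⁻¹ • (N * (p ⬝ᵥ e + N))) * s⁻¹ = 1 := by
        rw [smul_eq_mul]
        field_simp
        rw [pow_two, hss, hqq]
      rw [this, one_smul]
    rw [h1, show p - q = -(N • e) by rw [hq]; abel]
    rw [neg_dotProduct_neg, smul_dotProduct, he]
    module
  · rw [hst]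
    refine unitPair_conj_of_orthogonal _ _ ?_ ?_
    · rw [dotProduct_neg, hue, neg_zero]
    · rw [dotProduct_smul, hq, dotProduct_add, dotProduct_smul, hup, hue]
      simp

end Rotor

/-! ### Analytic Gram–Schmidt by rotors -/

section Triangular

variable {a m : ℕ}

/-- The vector `v`, moved by the inverse of `g`, lies in the span of the standard vectors
`ρ 0, …, ρ i`, with a positive last coefficient. -/
def IsTriangularRow (ρ : Fin a ↪ Fin m) (g : Spin m) (i : Fin a) (v : Fin m → ℝ) : Prop :=
  ∃ w, star (g : Cl m) * vec v * (g : Cl m) = vec w ∧ 0 < w (ρ i) ∧ ∀ l, (∀ r ≤ i, ρ r ≠ l) → w l = 0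

theorem exists_star_conj (g : Spin m) (v : Fin m → ℝ) :
    ∃ w, star (g : Cl m) * vec v * (g : Cl m) = vec w := by
  obtain ⟨R, hR⟩ := exists_covers g⁻¹
  refine ⟨(R : Matrix (Fin m) (Fin m) ℝ) *ᵥ v, ?_⟩
  have := hR.conj v
  rwa [Spin.coe_inv, star_star] at this

theorem star_conj_mul (g t : Spin m) (z : Cl m) :
    star ((g * t : Spin m) : Cl m) * z * ((g * t : Spin m) : Cl m) =
      star (t : Cl m) * (star (g : Cl m) * z * g) * t := by
  simp only [Submonoid.coe_mul, star_mul, mul_assoc]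

variable {E : Type} [NormedAddCommGroup E] [NormedSpace ℝ E] {z : E}

/-- One step of Gram–Schmidt: the next vector is pulled back by the current `g`, and a rotor turns
its component orthogonal to the earlier directions to the next standard vector. The earlier
directions are fixed, so the triangular rows already obtained survive. -/
theorem exists_triangular_step (ρ : Fin a ↪ Fin m) {v : E → Fin a → Fin m → ℝ}
    (hv : ∀ i l, ContDiffAt ℝ ω (fun L => v L i l) z) (hvz : ∀ i, v z i = stdVec m (ρ i))
    (j : Fin a) {F : E → Cl m} (hF : WeaklyAnalyticAt F z) (hFz : F z = 1)
    (hrow : ∀ᶠ L in 𝓝 z, ∃ g : Spin m, (g : Cl m) = F L ∧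
      ∀ i < j, IsTriangularRow ρ g i (v L i)) :
    ∃ F' : E → Cl m, WeaklyAnalyticAt F' z ∧ F' z = 1 ∧
      ∀ᶠ L in 𝓝 z, ∃ g : Spin m, (g : Cl m) = F' L ∧
        ∀ i ≤ j, IsTriangularRow ρ g i (v L i) := by
  classical
  set e := stdVec m (ρ j) with he
  have hee : e ⬝ᵥ e = 1 := stdVec_unit _
  let W : E → Fin m → ℝ := fun L => vecInv m (star (F L) * vec (v L j) * F L)
  -- The pulled back vector without its components along the earlier directions. At `z` it is `e`
  -- itself, so the roots and inverses below are taken away from zero.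
  let p : E → Fin m → ℝ := fun L l => if ∃ r < j, ρ r = l then 0 else W L l
  let N : E → ℝ := fun L => Real.sqrt (p L ⬝ᵥ p L)
  let q : E → Fin m → ℝ := fun L => p L + N L • e
  let s : E → ℝ := fun L => Real.sqrt (q L ⬝ᵥ q L)
  have hW : ∀ l, ContDiffAt ℝ ω (fun L => W L l) z := fun l =>
    ((hF.star.mul (weaklyAnalyticAt_vec fun i => hv j i)).mul hF) (LinearMap.proj l ∘ₗ vecInv m)
  have hp : ∀ l, ContDiffAt ℝ ω (fun L => p L l) z := fun l => by
    by_cases h : ∃ r < j, ρ r = l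
    · simp only [p, h, if_true]
      exact contDiffAt_const
    · simp only [p, h, if_false]
      exact hW l
  have hpz : p z = e := by
    funext l
    have hWz : W z = e := by
      simp only [W, hFz, hvz, star_one, one_mul, mul_one, vecInv_vec, he]
    simp only [p, hWz]
    split_ifs with h
    · obtain ⟨r, hr, rfl⟩ := h
      rw [he, stdVec, Pi.single_eq_of_ne fun h => hr.ne (ρ.injective h)]
    · rfl
  have hppz : p z ⬝ᵥ p z = 1 := by rw [hpz, hee]
  have hNz : N z = 1 := by simp only [N, hppz, Real.sqrt_one]
  have hpp : ContDiffAt ℝ ω (fun L => p L ⬝ᵥ p L) z :=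
    ContDiffAt.sum fun l _ => (hp l).mul (hp l)
  have hN : ContDiffAt ℝ ω N z := hpp.sqrt (by rw [hppz]; exact one_ne_zero)
  have hq : ∀ l, ContDiffAt ℝ ω (fun L => q L l) z := fun l =>
    (hp l).add (hN.mul contDiffAt_const)
  have hqz : q z = (2 : ℝ) • e := by
    simp only [q, hpz, hNz]
    module
  have hqqz : q z ⬝ᵥ q z = 2 * 2 := by
    rw [hqz, smul_dotProduct, dotProduct_smul, hee]
    norm_num
  have hqq : ContDiffAt ℝ ω (fun L => q L ⬝ᵥ q L) z :=
    ContDiffAt.sum fun l _ => (hq l).mul (hq l)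
  have hs : ContDiffAt ℝ ω s z := hqq.sqrt (by rw [hqqz]; norm_num)
  have hsz : s z = 2 := by
    simp only [s, hqqz]
    exact Real.sqrt_mul_self (by norm_num)
  have hn : ∀ l, ContDiffAt ℝ ω (fun L => ((s L)⁻¹ • q L) l) z := fun l =>
    (hs.inv (by rw [hsz]; norm_num)).mul (hq l)
  have hpe : ContDiffAt ℝ ω (fun L => p L ⬝ᵥ e + N L) z :=
    (ContDiffAt.sum fun l _ => (hp l).mul contDiffAt_const).add hN
  refine ⟨fun L => F L * (vec ((s L)⁻¹ • q L) * vec (-e)),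
    hF.mul ((weaklyAnalyticAt_vec hn).mul fun l => contDiffAt_const), ?_, ?_⟩
  · simp only [hFz, hsz, hqz, one_mul, map_neg, smul_smul, mul_neg]
    rw [show (2 : ℝ)⁻¹ * 2 = 1 by norm_num, one_smul, vec_mul_self_of_unit hee, neg_neg]
  · have h1 : ∀ᶠ L in 𝓝 z, 0 < p L ⬝ᵥ p L :=
      hpp.continuousAt.eventually (lt_mem_nhds (hppz.symm ▸ one_pos : (0 : ℝ) < p z ⬝ᵥ p z))
    have h2 : ∀ᶠ L in 𝓝 z, 0 < p L ⬝ᵥ e + N L :=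
      hpe.continuousAt.eventually (lt_mem_nhds (by
        change 0 < p z ⬝ᵥ e + N z
        rw [hpz, hee, hNz]
        norm_num))
    filter_upwards [hrow, h1, h2] with L hL hL1 hL2
    obtain ⟨g, hg, hgrow⟩ := hL
    obtain ⟨t, ht, htp, htu⟩ := exists_rotor_to hee (Real.mul_self_sqrt hL1.le)
      (Real.sqrt_pos.2 hL1) hL2
    have hfix : ∀ u : Fin m → ℝ, (∀ l, (∀ r < j, ρ r ≠ l) → u l = 0) →
        star (t : Cl m) * vec u * t = vec u := by
      intro u hu
      refine htu u ?_ ?_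
      · refine Finset.sum_eq_zero fun l _ => ?_
        by_cases h : ∃ r < j, ρ r = l
        · simp only [p, h, if_true, mul_zero]
        · rw [hu l fun r hr hrl => h ⟨r, hr, hrl⟩, zero_mul]
      · rw [he, dotProduct_single, hu _ fun r hr hrl => hr.ne (ρ.injective hrl), zero_mul]
    refine ⟨g * t, ?_, fun i hi => ?_⟩
    · rw [Submonoid.coe_mul, hg, ht]
    · rcases hi.lt_or_eq with hi | rfl
      · obtain ⟨w, hw, hw0, hwl⟩ := hgrow i hi
        refine ⟨w, ?_, hw0, hwl⟩
        rw [star_conj_mul, hw]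
        exact hfix w fun l hl => hwl l fun r hr => hl r (hr.trans_lt hi)
      · obtain ⟨w, hw⟩ := exists_star_conj g (v L i)
        have hwW : W L = w := by simp only [W, ← hg, hw, vecInv_vec]
        -- The rotor fixes `w - p L`, which lies in the earlier directions, and takes `p L` to `N L
        -- • e`; the diagonal coefficient is the positive number `N L`.
        have hsplit : w = (w - p L) + p L := (sub_add_cancel _ _).symm
        have hu : ∀ l, (∀ r < i, ρ r ≠ l) → (w - p L) l = 0 := by
          intro l hl
          have h : ¬ ∃ r < i, ρ r = l := fun ⟨r, hr, hrl⟩ => hl r hr hrl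
          simp only [Pi.sub_apply, p, h, if_false, hwW, sub_self]
        refine ⟨(w - p L) + N L • e, ?_, ?_, fun l hl => ?_⟩
        · rw [star_conj_mul, hw, hsplit, map_add, mul_add, add_mul, htp, map_add]
          congr 1
          rw [← hsplit]
          exact hfix _ hu
        · rw [Pi.add_apply, hu _ fun r hr hrl => hr.ne (ρ.injective hrl), zero_add, he]
          simp only [Pi.smul_apply, stdVec, Pi.single_eq_same, smul_eq_mul, mul_one]
          exact Real.sqrt_pos.2 hL1
        · rw [Pi.add_apply, hu l fun r hr => hl r hr.le, zero_add, he, Pi.smul_apply, stdVec,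
            Pi.single_eq_of_ne (hl i le_rfl).symm, smul_zero]

theorem exists_triangular (ρ : Fin a ↪ Fin m) {v : E → Fin a → Fin m → ℝ}
    (hv : ∀ i l, ContDiffAt ℝ ω (fun L => v L i l) z) (hvz : ∀ i, v z i = stdVec m (ρ i)) :
    ∃ F : E → Cl m, WeaklyAnalyticAt F z ∧ F z = 1 ∧
      ∀ᶠ L in 𝓝 z, ∃ g : Spin m, (g : Cl m) = F L ∧ ∀ i, IsTriangularRow ρ g i (v L i) := by
  have key : ∀ j ≤ a, ∃ F : E → Cl m, WeaklyAnalyticAt F z ∧ F z = 1 ∧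
      ∀ᶠ L in 𝓝 z, ∃ g : Spin m, (g : Cl m) = F L ∧
        ∀ i : Fin a, (i : ℕ) < j → IsTriangularRow ρ g i (v L i) := by
    intro j
    induction j with
    | zero =>
      exact fun _ => ⟨fun _ => 1, fun l => contDiffAt_const, rfl,
        Filter.Eventually.of_forall fun L => ⟨1, rfl, fun i hi => absurd hi (Nat.not_lt_zero _)⟩⟩
    | succ j ih =>
      intro hj
      obtain ⟨F, hF, hFz, hrow⟩ := ih (by omega)
      obtain ⟨F', hF', hFz', hrow'⟩ := exists_triangular_step ρ hv hvz ⟨j, hj⟩ hF hFz hrow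
      refine ⟨F', hF', hFz', hrow'.mono fun L ⟨g, hg, h⟩ => ⟨g, hg, fun i hi => h i ?_⟩⟩
      exact Fin.le_def.2 (Nat.lt_succ_iff.1 hi)
  obtain ⟨F, hF, hFz, hrow⟩ := key a le_rfl
  exact ⟨F, hF, hFz, hrow.mono fun L ⟨g, hg, h⟩ => ⟨g, hg, fun i => h i i.2⟩⟩

end Triangular

/-! ### Smooth local sections of the conjugation orbit map -/

section Section

variable {a b m : ℕ} (σ : Fin a ⊕ Fin b ≃ Fin m) {c : ℝ} {x : Spin m}
  (hx : (x : Cl m) = c • vecProd (baseFrame σ)) (j₀ : Fin b)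

include hx in
-- The frame `v` is the image of the base frame under the rotation, multiplied by a lower triangular
-- matrix with positive diagonal. That matrix has positive determinant and does not affect the unit
-- multivector.
theorem conj_base_of_triangular {g : Spin m} {v : Fin a → Fin m → ℝ}
    (h : ∀ i, IsTriangularRow (embL σ) g i (v i)) :
    (g : Cl m) * x * star (g : Cl m) = unitMultivector c v := by
  choose w hw hw0 hwl using h
  obtain ⟨R, hR⟩ := exists_covers g
  let o : Matrix (Fin a) (Fin m) ℝ :=
    Matrix.of fun i => (R : Matrix (Fin m) (Fin m) ℝ) *ᵥ baseFrame σ i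
  let A : Matrix (Fin a) (Fin a) ℝ := Matrix.of fun i r => w i (embL σ r)
  have ho : o * oᵀ = 1 := orthonormal_columns σ R
  have hA : 0 < A.det := by
    rw [Matrix.det_of_isLowerTriangular A fun i r hir => hwl i _ fun r' hr' h => ?_]
    · exact Finset.prod_pos fun i _ => hw0 i
    · exact absurd ((embL σ).injective h ▸ hr') (not_le_of_gt hir)
  have hv : ∀ i, v i = (R : Matrix (Fin m) (Fin m) ℝ) *ᵥ w i := by
    intro i
    refine vec_injective ?_
    rw [← hR.conj, ← hw, ← mul_assoc, ← mul_assoc, Spin.mul_star, one_mul, mul_assoc,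
      Spin.mul_star, mul_one]
  have hwsum : ∀ i, w i = ∑ r, A i r • baseFrame σ r := by
    intro i
    funext l
    rw [Finset.sum_apply]
    revert l
    refine forall_fin_of_split σ (fun r => ?_) fun j => ?_
    · rw [Finset.sum_eq_single r]
      · simp [baseFrame, stdVec, A]
      · intro r' _ hr'
        simp [baseFrame, stdVec, hr'.symm]
      · simp
    · rw [hwl i _ fun r _ => embL_ne_embR σ r j]
      refine (Finset.sum_eq_zero fun r _ => ?_).symm
      simp [baseFrame, stdVec]
  have hAo : A * o = Matrix.of v := by
    ext i l
    rw [Matrix.mul_apply, Matrix.of_apply, hv, hwsum, Matrix.mulVec_sum, Finset.sum_apply]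
    refine Finset.sum_congr rfl fun r _ => ?_
    rw [Matrix.mulVec_smul]
    rfl
  have h1 := conj_base_eq_unitMultivector σ hx ho fun i => hR.conj (baseFrame σ i)
  rw [h1, ← unitMultivector_mul c hA]
  exact congrArg (unitMultivector c) hAo

theorem graphMatrix_zero (i : Fin a) : graphMatrix σ 0 i = stdVec m (embL σ i) := by
  funext l
  revert l
  refine forall_fin_of_split σ (fun r => ?_) fun j => ?_
  · rw [graphMatrix_embL]
    simp [stdVec, Matrix.one_apply, Pi.single_apply, eq_comm]
  · rw [graphMatrix_embR]
    simp [stdVec]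

include hx in
/-- An analytic family of elements of the spin group which moves the base point to the points of
its chart. -/
theorem exists_analytic_family : ∃ F : (Fin a × Fin b → ℝ) → Cl m, WeaklyAnalyticAt F 0 ∧
    ∀ᶠ L in 𝓝 0, ∃ g : Spin m, (g : Cl m) = F L ∧
      (g : Cl m) * x * star (g : Cl m) = unitMultivector c (graphMatrix σ L) := by
  obtain ⟨F, hF, _, hrow⟩ := exists_triangular (embL σ) (z := 0)
    (v := fun L : Fin a × Fin b → ℝ => graphMatrix σ L)
    (fun i l => contDiffAt_pi.1 (contDiffAt_pi.1 (contDiff_graphMatrix σ).contDiffAt i) l)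
    (graphMatrix_zero σ)
  exact ⟨F, hF, hrow.mono fun L ⟨g, hg, h⟩ => ⟨g, hg, conj_base_of_triangular σ hx h⟩⟩

include hx j₀ in
-- The section is the chart followed by the analytic family, on the part of the chart domain where
-- the family takes values in the spin group.
theorem exists_section_base (hc : c * c = 1) : ∃ N : Set (conjugatesOf x), IsOpen N ∧
    (⟨x, mem_conjugatesOf_self⟩ : conjugatesOf x) ∈ N ∧ ∃ s : conjugatesOf x → Spin m,
      PullsBack (smoothConjugacyClass x) (smoothSpin m) N s ∧
      ∀ y ∈ N, s y * x * (s y)⁻¹ = y := by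
  classical
  obtain ⟨F, hF, hFg⟩ := exists_analytic_family σ hx
  let B := Module.finBasis ℝ (Cl m)
  -- Here analyticity matters: at a point it extends to a neighbourhood, whereas `ContDiffAt` of
  -- order `∞` gives, for each finite order, a neighbourhood that may shrink with the order.
  have h1 : ∀ᶠ L in 𝓝 (0 : Fin a × Fin b → ℝ), ∀ p, ContDiffAt ℝ ω (fun L => B.coord p (F L)) L :=
    Filter.eventually_all.2 fun p => (hF (B.coord p)).eventually (by simp)
  obtain ⟨Ω, hΩ, hΩo, h0Ω⟩ := eventually_nhds_iff.1 (h1.and hFg)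
  have hFΩ : ∀ l : Cl m →ₗ[ℝ] ℝ, ContDiffOn ℝ ∞ (fun L => l (F L)) Ω := by
    intro l L hL
    have h2 : (fun L => l (F L)) = fun L => ∑ p, B.coord p (F L) * l (B p) := by
      funext L
      conv_lhs => rw [← B.sum_repr (F L)]
      simp only [map_sum, map_smul, smul_eq_mul]
      rfl
    rw [h2]
    exact (ContDiffAt.sum fun p _ => (((hΩ L hL).1 p).of_le le_top).mul
      contDiffAt_const).contDiffWithinAt
  let φ := orbitChart σ hx j₀ hc
  let N : Set (conjugatesOf x) := φ.source ∩ φ ⁻¹' Ω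
  have hN : IsOpen N := φ.isOpen_inter_preimage hΩo
  have hbase := base_mem_source σ hx j₀ hc
  have hφ0 : φ ⟨x, mem_conjugatesOf_self⟩ = 0 := by
    have h2 := chartFun_graphMatrix σ hc 0
    have h3 : (x : Cl m) = unitMultivector c (graphMatrix σ 0) := by
      rw [base_eq_unitMultivector σ hx]
      refine congrArg (unitMultivector c) (funext fun i => ?_)
      exact (graphMatrix_zero σ i).symm
    rw [← h3] at h2
    exact h2
  let s : conjugatesOf x → Spin m := fun y =>
    if h : ∃ g : Spin m, (g : Cl m) = F (φ y) then h.choose else 1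
  have hs : ∀ y ∈ N, (s y : Cl m) = F (φ y) := by
    intro y hy
    obtain ⟨g, hg, _⟩ := (hΩ _ hy.2).2
    have h : ∃ g : Spin m, (g : Cl m) = F (φ y) := ⟨g, hg⟩
    simp only [s, dif_pos h]
    exact h.choose_spec
  refine ⟨N, hN, ⟨hbase, ?_⟩, s, ?_, fun y hy => ?_⟩
  · change φ _ ∈ Ω
    rw [hφ0]
    exact h0Ω
  · refine pullsBack_of_inducing (weaklyContinuous_orbit x) Topology.IsInducing.subtypeVal hN
      fun l => ?_
    have h2 := smoothOfEmbedding.comp (weaklyContinuous_orbit x)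
      (fun q => (smooth_chartFun σ (c := c) (x := x) q).mono
        (Set.inter_subset_left : N ⊆ φ.source)) hΩo (hFΩ l) (fun y hy => hy.2)
    exact h2.congr hN fun y hy => congrArg l (hs y hy)
  · obtain ⟨g, hg, hgx⟩ := (hΩ _ hy.2).2
    have hsg : s y = g := Subtype.ext ((hs y hy).trans hg.symm)
    rw [hsg]
    refine Subtype.ext (hgx.trans ?_)
    exact congrArg (fun y : conjugatesOf x => ((y : Spin m) : Cl m)) (φ.left_inv hy.1)

include hx j₀ in
/-- The orbit map `g ↦ g x g⁻¹` has smooth local sections. -/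
theorem exists_section (hc : c * c = 1) (p : conjugatesOf x) : ∃ N : Set (conjugatesOf x),
    IsOpen N ∧ p ∈ N ∧ ∃ s : conjugatesOf x → Spin m,
      PullsBack (smoothConjugacyClass x) (smoothSpin m) N s ∧
      ∀ y ∈ N, s y * x * (s y)⁻¹ = y := by
  obtain ⟨N, hN, hxN, s, hs, hsx⟩ := exists_section_base σ hx j₀ hc
  obtain ⟨y, hy⟩ := p
  obtain ⟨g, rfl⟩ := isConj_iff.1 hy
  have h1 := hs.comp' hN (pullsBack_conj x g⁻¹ g (t := (orbitConj x g).symm) fun y => rfl)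
  have h2 : PullsBack (smoothSpin m) (smoothSpin m) Set.univ fun h => g * h := by
    refine pullsBack_of_inducing weaklyContinuous_spin Topology.IsInducing.subtypeVal isOpen_univ
      fun l => ?_
    exact smoothOfEmbedding_linear (l ∘ₗ LinearMap.mulLeft ℝ (g : Cl m)) Set.univ
  refine ⟨(orbitConj x g).symm ⁻¹' N, hN.preimage (orbitConj x g).symm.continuous, ?_,
    fun y => g * s ((orbitConj x g).symm y), h2.comp h1, fun y hy => ?_⟩
  · change (orbitConj x g).symm ⟨g * x * g⁻¹, hy⟩ ∈ N
    convert hxN using 1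
    exact (orbitConj x g).symm_apply_eq.2 rfl
  · have h3 := hsx _ hy
    rw [mul_inv_rev, show g * s ((orbitConj x g).symm y) * x *
      ((s ((orbitConj x g).symm y))⁻¹ * g⁻¹) = g * (s ((orbitConj x g).symm y) * x *
        (s ((orbitConj x g).symm y))⁻¹) * g⁻¹ by group, h3]
    change g * (g⁻¹ * y * g) * g⁻¹ = y
    group

end Section

/-! ## Oriented planes and frames -/

section Grassmannian

variable {r m : ℕ}

/-- This lets two frames be compared as bases of one and the same subspace, where orientations can
be equated directly. -/
theorem Frame.toPlane_eq (v : Frame r m) {W : Submodule ℝ (Fin m → ℝ)}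
    (hW : Module.finrank ℝ W = r) (B : Module.Basis (Fin r) ℝ W)
    (hB : ∀ i, (B i : Fin m → ℝ) = v.1 i) : v.toPlane = ⟨W, hW, B.orientation⟩ := by
  have h1 : W = Submodule.span ℝ (Set.range v.1) := by
    have h2 := congrArg (Submodule.map W.subtype) B.span_eq
    rw [Submodule.map_span, Submodule.map_top, Submodule.range_subtype, ← Set.range_comp] at h2
    rw [← h2]
    exact congrArg _ (congrArg _ (funext hB))
  subst h1
  have h3 : B = Module.Basis.span v.2 :=
    Module.Basis.eq_of_apply_eq fun i => Subtype.ext ((hB i).trans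
      (congrArg Subtype.val (Module.Basis.span_apply v.2 i)).symm)
  rw [h3]
  rfl

/-- Two bases of one subspace have the same orientation exactly when their base change has positive
determinant. This is the relation found for unit multivectors in `unitMultivector_eq_iff`. -/
theorem Frame.toPlane_eq_iff (v v' : Frame r m) : v.toPlane = v'.toPlane ↔
    ∃ A : Matrix (Fin r) (Fin r) ℝ, 0 < A.det ∧ v'.1 = A * Matrix.of v.1 := by
  let B := Module.Basis.span v.2
  have hB : ∀ i, (B i : Fin m → ℝ) = v.1 i := fun i =>
    congrArg Subtype.val (Module.Basis.span_apply v.2 i)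
  have hfin : Module.finrank ℝ (Submodule.span ℝ (Set.range v.1)) = r := v.toPlane.finrank_plane
  constructor
  · intro h
    have hp : Submodule.span ℝ (Set.range v'.1) = Submodule.span ℝ (Set.range v.1) :=
      (congrArg OrientedGrassmannian.plane h).symm
    let B' : Module.Basis (Fin r) ℝ (Submodule.span ℝ (Set.range v.1)) :=
      (Module.Basis.span v'.2).map (LinearEquiv.ofEq _ _ hp)
    have hB' : ∀ i, (B' i : Fin m → ℝ) = v'.1 i := fun i =>
      congrArg Subtype.val (Module.Basis.span_apply v'.2 i)
    rw [v.toPlane_eq hfin B hB, v'.toPlane_eq hfin B' hB'] at h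
    have ho : B.orientation = B'.orientation := by
      injection h
    refine ⟨(B.toMatrix B')ᵀ, ?_, ?_⟩
    · rw [Matrix.det_transpose]
      exact (B.orientation_eq_iff_det_pos B').1 ho
    · funext i
      have h1 := congrArg Subtype.val (B.sum_toMatrix_smul_self B' i)
      rw [← hB', ← h1]
      funext l
      refine Eq.trans ?_ Matrix.mul_apply.symm
      rw [Submodule.coe_sum, Finset.sum_apply]
      refine Finset.sum_congr rfl fun j _ => ?_
      rw [Submodule.coe_smul, Pi.smul_apply, hB]
      rfl
  · rintro ⟨A, hA, hv⟩
    let u : Fin r → Submodule.span ℝ (Set.range v.1) := fun i => ∑ j, A i j • B j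
    have hu : ∀ i, (u i : Fin m → ℝ) = v'.1 i := by
      intro i
      funext l
      rw [hv]
      refine Eq.trans ?_ Matrix.mul_apply.symm
      simp [u, hB]
    have hli : LinearIndependent ℝ u := by
      refine LinearIndependent.of_comp (Submodule.subtype _) ?_
      convert v'.2 using 1
      exact funext hu
    let B' := basisOfLinearIndependentOfCardEqFinrank' u hli (by simp [hfin])
    have hBu : ∀ i, B' i = u i := fun i => by simp [B']
    rw [v.toPlane_eq hfin B hB, v'.toPlane_eq hfin B' fun i => by rw [hBu, hu]]
    congr 1
    rw [B.orientation_eq_iff_det_pos, Module.Basis.det_apply]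
    have h1 : B.toMatrix B' = Aᵀ := by
      ext j i
      rw [Module.Basis.toMatrix_apply, hBu]
      simp [u, Finsupp.single_apply]
    rw [h1, Matrix.det_transpose]
    exact hA

theorem Frame.toPlane_surjective (hr : 0 < r) :
    Function.Surjective (Frame.toPlane : Frame r m → OrientedGrassmannian r m) := by
  rintro ⟨W, hW, o⟩
  have : Nonempty (Fin r) := ⟨⟨0, hr⟩⟩
  have hcard : Fintype.card (Fin r) = Module.finrank ℝ W := by simp [hW]
  have hfin : FiniteDimensional ℝ W := inferInstance
  let B := o.someBasis hcard
  have hB : LinearIndependent ℝ fun i => (B i : Fin m → ℝ) :=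
    B.linearIndependent.map' W.subtype (Submodule.ker_subtype W)
  refine ⟨⟨_, hB⟩, (Frame.toPlane_eq ⟨_, hB⟩ hW B fun i => rfl).trans ?_⟩
  rw [o.someBasis_orientation hcard]

theorem Frame.isQuotientMap_toPlane (hr : 0 < r) :
    Topology.IsQuotientMap (Frame.toPlane : Frame r m → OrientedGrassmannian r m) :=
  ⟨⟨rfl⟩, Frame.toPlane_surjective hr⟩

end Grassmannian

/-! ## The four homogeneous spaces -/

section Homogeneous

variable {a b m : ℕ} (σ : Fin a ⊕ Fin b ≃ Fin m) {c : ℝ} {x : Spin m}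
  (hx : (x : Cl m) = c • vecProd (baseFrame σ)) (j₀ : Fin b)

theorem smooth_conj (z : Cl m) (l : Cl m →ₗ[ℝ] ℝ) :
    smoothSpin m Set.univ fun g => l ((g : Cl m) * z * star (g : Cl m)) := by
  rw [show (fun g : Spin m => l ((g : Cl m) * z * star (g : Cl m))) = _ from
    funext fun g => map_mul_eq_sum l ((g : Cl m) * z) (star (g : Cl m))]
  have hw := weaklyContinuous_spin (m := m)
  refine smoothOfEmbedding.sum hw fun p => smoothOfEmbedding.sum hw fun q =>
    smoothOfEmbedding.mul hw (smoothOfEmbedding.mul hw ?_ ?_) (smoothOfEmbedding_const _ _)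
  · exact smoothOfEmbedding_linear
      ((Module.finBasis ℝ (Cl m)).coord p ∘ₗ LinearMap.mulRight ℝ z) _
  · exact smoothOfEmbedding_linear ((Module.finBasis ℝ (Cl m)).coord q ∘ₗ starLinear m) _

/-- The orbit map of the conjugation. -/
def spinToOrbit (x g : Spin m) : conjugatesOf x := ⟨g * x * g⁻¹, isConj_iff.2 ⟨g, rfl⟩⟩

theorem pullsBack_spinToOrbit (x : Spin m) :
    PullsBack (smoothSpin m) (smoothConjugacyClass x) Set.univ (spinToOrbit x) :=
  pullsBack_of_inducing weaklyContinuous_spin (isInducing_orbit x) isOpen_univ fun l =>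
    smooth_conj (x : Cl m) l

theorem spinToOrbit_eq_iff (g h : Spin m) :
    spinToOrbit x g = spinToOrbit x h ↔ g⁻¹ * h ∈ Subgroup.centralizer {x} := by
  rw [Subgroup.mem_centralizer_singleton_iff]
  refine Subtype.ext_iff.trans ?_
  change g * x * g⁻¹ = h * x * h⁻¹ ↔ _
  constructor
  · intro H
    calc g⁻¹ * h * x = g⁻¹ * (h * x * h⁻¹) * h := by group
      _ = x * (g⁻¹ * h) := by rw [← H]; group
  · intro H
    calc g * x * g⁻¹ = g * (x * (g⁻¹ * h)) * h⁻¹ := by group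
      _ = h * x * h⁻¹ := by rw [← H]; group

/-- The double cover `Spin(m) → SO(m)`. -/
def cover (g : Spin m) : SO m := (exists_covers g).choose

theorem covers_cover (g : Spin m) : Covers g (cover g) := (exists_covers g).choose_spec

/-- The matrix entries of the covered rotation are coordinates of `g e_j g*`, which are quadratic in
`g`. -/
theorem pullsBack_cover : PullsBack (smoothSpin m) (smoothSO m) Set.univ cover := by
  refine pullsBack_of_inducing weaklyContinuous_spin Topology.IsInducing.subtypeVal isOpen_univ
    fun l => ?_
  have h1 : ∀ g : Spin m, l (cover g : Matrix (Fin m) (Fin m) ℝ) =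
      ∑ i, ∑ j, (LinearMap.proj i ∘ₗ vecInv m) ((g : Cl m) * vec (stdVec m j) * star (g : Cl m)) *
        l (Matrix.single i j 1) := by
    intro g
    conv_lhs => rw [Matrix.matrix_eq_sum_single (cover g : Matrix (Fin m) (Fin m) ℝ)]
    rw [map_sum]
    refine Finset.sum_congr rfl fun i _ => ?_
    rw [map_sum]
    refine Finset.sum_congr rfl fun j _ => ?_
    rw [LinearMap.comp_apply, (covers_cover g).conj, vecInv_vec, LinearMap.proj_apply,
      Matrix.mulVec_single_one, Matrix.col_apply, ← smul_eq_mul, ← map_smul, Matrix.smul_single,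
      smul_eq_mul, mul_one]
  simp only [h1]
  have hw := weaklyContinuous_spin (m := m)
  exact smoothOfEmbedding.sum hw fun _ => smoothOfEmbedding.sum hw fun _ =>
    smoothOfEmbedding.mul hw (smooth_conj _ _) (smoothOfEmbedding_const _ _)

/-- The frame of the columns of a rotation that belong to the first block. -/
def columns (R : SO m) : Frame a m :=
  ⟨fun i => (R : Matrix (Fin m) (Fin m) ℝ) *ᵥ baseFrame σ i,
    linearIndependent_of_orthonormal (orthonormal_columns σ R)⟩

/-- The rows of a matrix product with a fixed frame, as a linear map. -/
def columnsLinear : Matrix (Fin m) (Fin m) ℝ →ₗ[ℝ] Fin a → Fin m → ℝ where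
  toFun R i := R *ᵥ baseFrame σ i
  map_add' R R' := funext fun _ => Matrix.add_mulVec R R' _
  map_smul' r R := funext fun _ => Matrix.smul_mulVec r R _

theorem pullsBack_columns : PullsBack (smoothSO m)
    (smoothOfEmbedding fun v : Frame a m => v.1) Set.univ (columns σ) :=
  pullsBack_of_inducing (weaklyContinuous_of_continuous continuous_subtype_val)
    Topology.IsInducing.subtypeVal isOpen_univ fun l =>
      smoothOfEmbedding_linear (l ∘ₗ columnsLinear σ) _

theorem toOrbit_columns {g : Spin m} {R : SO m} (hg : Covers g R) :
    toOrbit σ hx j₀ (columns σ R) = spinToOrbit x g :=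
  Subtype.ext (Subtype.ext (conj_base_eq_unitMultivector σ hx (orthonormal_columns σ R)
    fun i => hg.conj (baseFrame σ i)).symm)

variable (hc : c * c = 1)

include σ hx j₀ hc in
theorem exists_section_spin (p : conjugatesOf x) : ∃ N : Set (conjugatesOf x), IsOpen N ∧ p ∈ N ∧
    ∃ s : conjugatesOf x → Spin m, PullsBack (smoothConjugacyClass x) (smoothSpin m) N s ∧
      ∀ y ∈ N, spinToOrbit x (s y) = y := by
  obtain ⟨N, hN, hp, s, hs, h⟩ := exists_section σ hx j₀ hc p
  exact ⟨N, hN, hp, s, hs, fun y hy => Subtype.ext (h y hy)⟩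

include hc in
theorem exists_section_SO (p : conjugatesOf x) : ∃ N : Set (conjugatesOf x), IsOpen N ∧ p ∈ N ∧
    ∃ s : conjugatesOf x → SO m, PullsBack (smoothConjugacyClass x) (smoothSO m) N s ∧
      ∀ y ∈ N, toOrbit σ hx j₀ (columns σ (s y)) = y := by
  obtain ⟨N, hN, hp, s, hs, h⟩ := exists_section_spin σ hx j₀ hc p
  exact ⟨N, hN, hp, _, pullsBack_cover.comp hs, fun y hy =>
    (toOrbit_columns σ hx j₀ (covers_cover (s y))).trans (h y hy)⟩

include hc in
theorem exists_section_frame (p : conjugatesOf x) : ∃ N : Set (conjugatesOf x), IsOpen N ∧ p ∈ N ∧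
    ∃ s : conjugatesOf x → Frame a m,
      PullsBack (smoothConjugacyClass x) (smoothOfEmbedding fun v : Frame a m => v.1) N s ∧
      ∀ y ∈ N, toOrbit σ hx j₀ (s y) = y := by
  obtain ⟨N, hN, hp, s, hs, h⟩ := exists_section_SO σ hx j₀ hc p
  exact ⟨N, hN, hp, _, (pullsBack_columns σ).comp hs, h⟩

variable (ha : Even a)

include hx ha in
theorem mem_centralizer_iff_mem_SOSO {g : Spin m} {R : SO m} (hg : Covers g R) :
    g ∈ Subgroup.centralizer {x} ↔ R ∈ SOSO σ := by
  constructor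
  · intro h
    obtain ⟨A, B, R', hR', hAB⟩ := exists_blockDiag_of_mem_centralizer σ ha hx h
    rw [hg.unique hR']
    exact ⟨A, B, hAB⟩
  · rintro ⟨A, B, hAB⟩
    rw [mem_centralizer_iff, Covers.conj_base_of_blockDiag σ hx hg hAB, SO.det_eq, one_smul]

include hx ha in
theorem toOrbit_columns_eq_iff (R R' : SO m) :
    toOrbit σ hx j₀ (columns σ R) = toOrbit σ hx j₀ (columns σ R') ↔ R⁻¹ * R' ∈ SOSO σ := by
  obtain ⟨g, _, hg⟩ := exists_unitPairs_covers R
  obtain ⟨g', _, hg'⟩ := exists_unitPairs_covers R'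
  rw [toOrbit_columns σ hx j₀ hg, toOrbit_columns σ hx j₀ hg', spinToOrbit_eq_iff,
    mem_centralizer_iff_mem_SOSO σ hx ha (hg.inv.mul hg')]

include ha in
theorem toOrbit_eq_iff (v v' : Frame a m) :
    toOrbit σ hx j₀ v = toOrbit σ hx j₀ v' ↔ v.toPlane = v'.toPlane := by
  rw [Frame.toPlane_eq_iff]
  refine Iff.trans ?_ (unitMultivector_eq_iff σ hx ha j₀ v.2 v'.2)
  exact ⟨fun h => congrArg (fun y : conjugatesOf x => ((y : Spin m) : Cl m)) h,
    fun h => Subtype.ext (Subtype.ext h)⟩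

include σ hx j₀ hc in
theorem smoothlyEquivalent_spinQuotient {H : Subgroup (Spin m)}
    (hH : Subgroup.centralizer {x} = H) :
    SmoothlyEquivalent (smoothSpinQuotient H) (smoothConjugacyClass x) := by
  refine smoothlyEquivalent_of_quotient (isLocalSmoothness_smoothOfEmbedding _)
    (QuotientGroup.isQuotientMap_mk _) (pullsBack_spinToOrbit x) (fun g h => ?_)
    (exists_section_spin σ hx j₀ hc)
  rw [QuotientGroup.eq, spinToOrbit_eq_iff, hH]

include hx j₀ hc ha in
theorem smoothlyEquivalent_SOQuotient :
    SmoothlyEquivalent (smoothSOQuotient (SOSO σ)) (smoothConjugacyClass x) := by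
  refine smoothlyEquivalent_of_quotient (isLocalSmoothness_smoothOfEmbedding _)
    (QuotientGroup.isQuotientMap_mk _) ((pullsBack_toOrbit σ hx j₀).comp (pullsBack_columns σ))
    (fun R R' => ?_) (exists_section_SO σ hx j₀ hc)
  rw [QuotientGroup.eq]
  exact (toOrbit_columns_eq_iff σ hx j₀ ha R R').symm

include σ hx j₀ hc ha in
theorem smoothlyEquivalent_grassmannian (ha0 : 0 < a) :
    SmoothlyEquivalent (smoothGrassmannian a m) (smoothConjugacyClass x) :=
  smoothlyEquivalent_of_quotient (isLocalSmoothness_smoothOfEmbedding _)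
    (Frame.isQuotientMap_toPlane ha0) (pullsBack_toOrbit σ hx j₀)
    (fun v v' => (toOrbit_eq_iff σ hx j₀ ha v v').symm) (exists_section_frame σ hx j₀ hc)

theorem SmoothlyEquivalent.nonempty_diffeomorph {d : ℕ} {X Y : Type} [TopologicalSpace X]
    [TopologicalSpace Y] {SX : Set X → (X → ℝ) → Prop} {SY : Set Y → (Y → ℝ) → Prop}
    {cX : ChartedSpace (EuclideanSpace ℝ (Fin d)) X}
    {cY : ChartedSpace (EuclideanSpace ℝ (Fin d)) Y} (H : SmoothlyEquivalent SX SY)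
    (hX : IsSmoothManifoldWith d cX SX) (hY : IsSmoothManifoldWith d cY SY) :
    Nonempty (Diffeomorph (𝓡 d) (𝓡 d) X Y ∞) := by
  obtain ⟨h, hS⟩ := H
  exact hX.diffeomorph hY h hS

include hx j₀ hc ha in
-- Charts are constructed only on the conjugacy class, in dimension `a * b`; the other three spaces
-- receive them through their equivalences with it.
theorem exists_smooth_structures (ha0 : 0 < a) {H : Subgroup (Spin m)}
    (hH : Subgroup.centralizer {x} = H) :
    ∃ (d : ℕ) (c₁ : ChartedSpace (EuclideanSpace ℝ (Fin d)) (conjugatesOf x))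
      (c₂ : ChartedSpace (EuclideanSpace ℝ (Fin d)) (Spin m ⧸ H))
      (c₃ : ChartedSpace (EuclideanSpace ℝ (Fin d)) (SO m ⧸ SOSO σ))
      (c₄ : ChartedSpace (EuclideanSpace ℝ (Fin d)) (OrientedGrassmannian a m)),
      IsSmoothManifoldWith d c₁ (smoothConjugacyClass x) ∧
      IsSmoothManifoldWith d c₂ (smoothSpinQuotient H) ∧
      IsSmoothManifoldWith d c₃ (smoothSOQuotient (SOSO σ)) ∧
      IsSmoothManifoldWith d c₄ (smoothGrassmannian a m) ∧
      Nonempty (Diffeomorph (𝓡 d) (𝓡 d) (conjugatesOf x) (Spin m ⧸ H) ∞) ∧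
      Nonempty (Diffeomorph (𝓡 d) (𝓡 d) (Spin m ⧸ H) (SO m ⧸ SOSO σ) ∞) ∧
      Nonempty (Diffeomorph (𝓡 d) (𝓡 d) (SO m ⧸ SOSO σ) (OrientedGrassmannian a m) ∞) := by
  have hch := exists_isSmoothChart σ hx j₀ hc
  have e₂ := smoothlyEquivalent_spinQuotient σ hx j₀ hc hH
  have e₃ := smoothlyEquivalent_SOQuotient σ hx j₀ hc ha
  have e₄ := smoothlyEquivalent_grassmannian σ hx j₀ hc ha ha0
  obtain ⟨c₁, h₁⟩ := exists_isSmoothManifoldWith (isLocalSmoothness_smoothOfEmbedding _) hch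
  obtain ⟨c₂, h₂⟩ := e₂.exists_isSmoothManifoldWith
    ((isLocalSmoothness_smoothOfEmbedding _).quotient continuous_quot_mk) hch
  obtain ⟨c₃, h₃⟩ := e₃.exists_isSmoothManifoldWith
    ((isLocalSmoothness_smoothOfEmbedding _).quotient continuous_quot_mk) hch
  obtain ⟨c₄, h₄⟩ := e₄.exists_isSmoothManifoldWith
    ((isLocalSmoothness_smoothOfEmbedding _).quotient continuous_coinduced_rng) hch
  exact ⟨a * b, c₁, c₂, c₃, c₄, h₁, h₂, h₃, h₄, e₂.symm.nonempty_diffeomorph h₁ h₂,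
    (e₂.trans e₃.symm).nonempty_diffeomorph h₂ h₃, (e₃.trans e₄.symm).nonempty_diffeomorph h₃ h₄⟩

end Homogeneous

/-! ### Membership of the base point in the spin group -/

section EvenProducts

variable {m : ℕ}

theorem vecProd_mem_spinGroup (k : ℕ) (v : Fin (2 * k) → Fin m → ℝ) (hv : ∀ i, v i ⬝ᵥ v i = 1) :
    vecProd v ∈ spinGroup (negForm m) := by
  induction k with
  | zero =>
    have : vecProd v = 1 := by simp [vecProd]
    rw [this]
    exact one_mem _
  | succ k ih =>
    have h1 := ih (fun i => v i.succ.succ) fun i => hv _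
    have h2 : vecProd v = vec (v 0) * vec (v (Fin.succ 0)) * vecProd fun i => v i.succ.succ := by
      rw [vecProd, List.ofFn_succ, List.prod_cons]
      erw [List.ofFn_succ]
      rw [List.prod_cons, ← mul_assoc]
      rfl
    rw [h2]
    exact mul_mem (vec_mul_vec_mem_spinGroup (hv _) (hv _)) h1

theorem neg_one_mem_spinGroup (i : Fin m) : (-1 : Cl m) ∈ spinGroup (negForm m) := by
  rw [← vec_mul_self_of_unit (stdVec_unit i)]
  exact vec_mul_vec_mem_spinGroup (stdVec_unit i) (stdVec_unit i)

end EvenProducts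

end

end SpinOrbit

theorem mainTheorem6 (n k : ℕ) (hk : 2 ≤ k) (hkn : k ≤ n) (v : Fin n → ℝ)
    (hv : SpinOrbit.IsAlcoveVertex n (hk.trans hkn) k v) :
    ∃ x : SpinOrbit.Spin (2 * n + 1),
      (x : SpinOrbit.Cl (2 * n + 1)) = NormedSpace.exp (SpinOrbit.torusElement n v) ∧
      (Subgroup.centralizer {x} : Set (SpinOrbit.Spin (2 * n + 1))) =
        connectedComponentIn
          (SpinOrbit.coverPreimage (SpinOrbit.SOO (SpinOrbit.splitEquiv n k hkn))) 1 ∧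
      (Subgroup.centralizer {x} : Set (SpinOrbit.Spin (2 * n + 1))) =
        (SpinOrbit.spinFirst n k hkn : Set (SpinOrbit.Spin (2 * n + 1))) *
          (SpinOrbit.spinLast n k hkn : Set (SpinOrbit.Spin (2 * n + 1))) ∧
      ∃ (d : ℕ)
        (c₁ : ChartedSpace (EuclideanSpace ℝ (Fin d)) (conjugatesOf x))
        (c₂ : ChartedSpace (EuclideanSpace ℝ (Fin d))
          (SpinOrbit.Spin (2 * n + 1) ⧸
            (SpinOrbit.spinFirst n k hkn ⊔ SpinOrbit.spinLast n k hkn)))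
        (c₃ : ChartedSpace (EuclideanSpace ℝ (Fin d))
          (SpinOrbit.SO (2 * n + 1) ⧸ SpinOrbit.SOSO (SpinOrbit.splitEquiv n k hkn)))
        (c₄ : ChartedSpace (EuclideanSpace ℝ (Fin d))
          (SpinOrbit.OrientedGrassmannian (2 * k) (2 * n + 1))),
        SpinOrbit.IsSmoothManifoldWith d c₁ (SpinOrbit.smoothConjugacyClass x) ∧
        SpinOrbit.IsSmoothManifoldWith d c₂ (SpinOrbit.smoothSpinQuotient
          (SpinOrbit.spinFirst n k hkn ⊔ SpinOrbit.spinLast n k hkn)) ∧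
        SpinOrbit.IsSmoothManifoldWith d c₃ (SpinOrbit.smoothSOQuotient
          (SpinOrbit.SOSO (SpinOrbit.splitEquiv n k hkn))) ∧
        SpinOrbit.IsSmoothManifoldWith d c₄ (SpinOrbit.smoothGrassmannian (2 * k) (2 * n + 1)) ∧
        Nonempty (Diffeomorph (𝓡 d) (𝓡 d) (conjugatesOf x)
          (SpinOrbit.Spin (2 * n + 1) ⧸
            (SpinOrbit.spinFirst n k hkn ⊔ SpinOrbit.spinLast n k hkn)) ∞) ∧
        Nonempty (Diffeomorph (𝓡 d) (𝓡 d)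
          (SpinOrbit.Spin (2 * n + 1) ⧸
            (SpinOrbit.spinFirst n k hkn ⊔ SpinOrbit.spinLast n k hkn))
          (SpinOrbit.SO (2 * n + 1) ⧸ SpinOrbit.SOSO (SpinOrbit.splitEquiv n k hkn)) ∞) ∧
        Nonempty (Diffeomorph (𝓡 d) (𝓡 d)
          (SpinOrbit.SO (2 * n + 1) ⧸ SpinOrbit.SOSO (SpinOrbit.splitEquiv n k hkn))
          (SpinOrbit.OrientedGrassmannian (2 * k) (2 * n + 1)) ∞) := by
  rw [SpinOrbit.isAlcoveVertex_iff n (hk.trans hkn) k hk hkn] at hv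
  subst hv
  let σ := SpinOrbit.splitEquiv n k hkn
  have hc : (-1 : ℝ) ^ k * (-1) ^ k = 1 := by rw [← mul_pow]; norm_num
  have ha : Even (2 * k) := even_two_mul k
  let i₀ : Fin (2 * k) := ⟨0, by omega⟩
  -- The second block is never empty because the ambient dimension is odd.
  let j₀ : Fin (2 * n + 1 - 2 * k) := ⟨0, by omega⟩
  have hmem : (-1 : ℝ) ^ k • SpinOrbit.vecProd (SpinOrbit.baseFrame σ) ∈
      spinGroup (SpinOrbit.negForm (2 * n + 1)) := by
    have h1 : (-1 : ℝ) ^ k • SpinOrbit.vecProd (SpinOrbit.baseFrame σ) =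
        (-1) ^ k * SpinOrbit.vecProd (SpinOrbit.baseFrame σ) := by
      rw [Algebra.smul_def, map_pow, map_neg, map_one]
    rw [h1]
    exact mul_mem (pow_mem (SpinOrbit.neg_one_mem_spinGroup 0) k)
      (SpinOrbit.vecProd_mem_spinGroup k _ fun i => SpinOrbit.stdVec_unit _)
  let x : SpinOrbit.Spin (2 * n + 1) := ⟨_, hmem⟩
  have hx : (x : SpinOrbit.Cl (2 * n + 1)) =
    (-1 : ℝ) ^ k • SpinOrbit.vecProd (SpinOrbit.baseFrame σ) := rfl
  exact ⟨x, (SpinOrbit.exp_torusElement_vertex n k hkn).symm,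
    SpinOrbit.centralizer_eq_connectedComponentIn σ ha hc hx (by omega),
    SpinOrbit.centralizer_eq_mul σ ha hx i₀,
    SpinOrbit.exists_smooth_structures σ hx j₀ hc ha (by omega)
      (SpinOrbit.centralizer_eq_sup σ ha hx i₀)⟩
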